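/- Let $n=2$ or $n=3$, let $N=\tfrac12 n(n+1)$, and let $g=g_{ij}\,dx^i dx^j$ be a $C^\infty$ Riemannian metric on an open neighborhood $\Omega_0$ of $0$ in $\mathbb{R}^n$ whose Christoffel symbols vanish at $0$. If $n=2$, assume that the Gauss curvature satisfies $K(0)\neq 0$; if $n=3$, assume that the matrix $$\hat R=\begin{bmatrix} R_{2323}&R_{2331}&R_{1223}\\ R_{2331}&R_{3131}&R_{3112}\\ R_{1223}&R_{3112}&R_{1212}\end{bmatrix}$$ of the Riemann curvature tensor of $g$ at $0$ is nonzero. (The summation convention is used throughout.) Then for every integer $\beta\ge 0$ there exist an open neighborhood $\Omega\subseteq\Omega_0$ of $0$ and a real analytic embedding $\mathbf y:\Omega\to\mathbb{R}^N$, with induced metric $\bar g_{ij}=\partial_i\mathbf y\cdot\partial_j\mathbf y$, Christoffel symbols $\Gamma^k_{ij}$ of $\bar g$, and second fundamental form $H_{ij}=\partial^2_{ij}\mathbf y-\Gamma^k_{ij}\partial_k\mathbf y$, such that: (a) all partial derivatives of order at most $\beta$ of $g_{ij}$ and $\bar g_{ij}$ coincide at $0$; (b) $\mathbf y$ is nondegenerate: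 for each $\mathbf x\in\Omega$ the space $\mathrm{II}_{\mathbf x}=\{[\,H_{ij}(\mathbf x)\cdot \mathbf u\,] : \mathbf u\in\mathbb{R}^N\}$ of symmetric $n\times n$ matrices has dimension $\tfrac12n(n-1)$; (c) there are $C^\infty$ functions $A^{kij}$ on $\Omega$, symmetric in all three indices, such that for each $\mathbf x\in\Omega$ the matrices $A^k(\mathbf x)=[A^{kij}(\mathbf x)]$, $k=1,\dots,n$, form a basis of the space of all symmetric matrices $[s^{ij}]$ with $\sum_{i,j} s^{ij}h_{ij}=0$ for all $[h_{ij}]\in \mathrm{II}_{\mathbf x}$; and there are real numbers $c^i_{jk}=c^i_{kj}$ and constant $n\times n$ matrices $S_1,\dots,S_n$, such that the reduced linearized isometric embedding operator $$(P\bar{\mathbf v})^k=A^{kij}\bigl(\partial_i\bar v_j-\Gamma^\ell_{ij}\bar v_\ell\bigr),\qquad k=1,\dots,n,$$ acting on the tangential components $\bar v_j=\mathbf v\cdot\partial_j\mathbf y$, becomes strongly symmetric positive on an open neighborhood $U$ of $0$ after the change of variables $$x^i=\bar x^i+\tfrac12c^i_{jk}\bar x^j\bar x^k,\qquad \bar{\mathbf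 v}=(I+\bar x^iS_i)\bar{\mathbf w}$$ followed by multiplication on the left by $(I+\bar x^iS_i)^{\mathsf T}$. On $U$ the map $\bar{\mathbf x}\mapsto\mathbf x$ is injective with invertible Jacobian matrix and takes values in $\Omega$, and $I+\bar x^iS_i$ is invertible. Here an operator $\sum_i\tilde A^i\partial_i+\tilde B$ with $C^\infty$ coefficients in $\mathbb{R}^{n\times n}$ is strongly symmetric positive on $U$ if, at each point of $U$, the matrices $\tilde A^i$ are symmetric and the quadratic forms $$Q_0(\xi)=\xi^{\mathsf T}\Bigl(\tilde B+\tilde B^{\mathsf T}-\sum_i\partial_i\tilde A^i\Bigr)\xi,\qquad Q_1(\xi_1,\dots,\xi_n)=\sum_{i,j}\xi_j^{\mathsf T}\bigl(\partial_j\tilde A^i+\partial_i\tilde A^j\bigr)\xi_i$$ on $\mathbb{R}^n$ and $\mathbb{R}^{n\cdot n}$ are positive definite. -/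

import Mathlib

noncomputable section

namespace IsomEmb

open Set Matrix
open scoped ContDiff

/-! ## Calculus in coordinates on `ℝⁿ` -/

/-- The partial derivative `∂_i f`. -/
def pd {n : ℕ} {F : Type*} [NormedAddCommGroup F] [NormedSpace ℝ F]
    (i : Fin n) (f : (Fin n → ℝ) → F) (x : Fin n → ℝ) : F :=
  fderiv ℝ f x (Pi.single i 1)

/-- The entrywise partial derivative `∂_i M` of a matrix-valued function. -/
def pdMat {n s : ℕ} (i : Fin n) (M : (Fin n → ℝ) → Matrix (Fin s) (Fin s) ℝ) (x : Fin n → ℝ) :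
    Matrix (Fin s) (Fin s) ℝ :=
  Matrix.of fun a b => pd i (fun y => M y a b) x

/-- A matrix-valued function with `C^∞` entries on `Ω`. -/
def SmoothMatOn {n s : ℕ} (M : (Fin n → ℝ) → Matrix (Fin s) (Fin s) ℝ)
    (Ω : Set (Fin n → ℝ)) : Prop :=
  ∀ a b, ContDiffOn ℝ ∞ (fun x => M x a b) Ω

/-! ## Riemannian metrics -/

/-- `g = g_{ij} dx^i dx^j` is a `C^∞` Riemannian metric on `Ω`
(`Matrix.PosDef` includes the symmetry `g_{ij} = g_{ji}`). -/
def IsSmoothMetricOn {n : ℕ} (g : (Fin n → ℝ) → Matrix (Fin n) (Fin n) ℝ)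
    (Ω : Set (Fin n → ℝ)) : Prop :=
  SmoothMatOn g Ω ∧ ∀ x ∈ Ω, (g x).PosDef

/-- The Christoffel symbol `Γ^k_{ij}` of the metric `g`. -/
def christoffel {n : ℕ} (g : (Fin n → ℝ) → Matrix (Fin n) (Fin n) ℝ) (k i j : Fin n)
    (x : Fin n → ℝ) : ℝ :=
  (1 / 2) * ∑ l, (g x)⁻¹ k l *
    (pd i (fun y => g y j l) x + pd j (fun y => g y i l) x - pd l (fun y => g y i j) x)

/-- The Riemann curvature tensor `R_{ijkl} = ⟨R(∂_i, ∂_j) ∂_l, ∂_k⟩` of the metric `g`, where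
`R(X, Y) = ∇_X ∇_Y - ∇_Y ∇_X - ∇_{[X, Y]}`; so `R_{ijij} > 0` on round spheres. -/
def riemann {n : ℕ} (g : (Fin n → ℝ) → Matrix (Fin n) (Fin n) ℝ) (i j k l : Fin n)
    (x : Fin n → ℝ) : ℝ :=
  ∑ m, g x k m *
    (pd i (christoffel g m j l) x - pd j (christoffel g m i l) x
      + ∑ p, (christoffel g m i p x * christoffel g p j l x
        - christoffel g m j p x * christoffel g p i l x))

/-- The Gauss curvature of a metric in two variables. -/
def gaussCurvature (g : (Fin 2 → ℝ) → Matrix (Fin 2) (Fin 2) ℝ) (x : Fin 2 → ℝ) : ℝ :=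
  riemann g 0 1 0 1 x / (g x).det

/-- For a metric in three variables, the symmetric matrix `R̂` of the curvature tensor, regarded as
a quadratic form on bivectors, in the basis `∂₂ ∧ ∂₃, ∂₃ ∧ ∂₁, ∂₁ ∧ ∂₂`. The indices
`1, 2, 3` are `0, 1, 2` in `Fin 3`. -/
def curvatureMatrix (g : (Fin 3 → ℝ) → Matrix (Fin 3) (Fin 3) ℝ) (x : Fin 3 → ℝ) :
    Matrix (Fin 3) (Fin 3) ℝ :=
  !![riemann g 1 2 1 2 x, riemann g 1 2 2 0 x, riemann g 0 1 1 2 x;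
     riemann g 1 2 2 0 x, riemann g 2 0 2 0 x, riemann g 2 0 0 1 x;
     riemann g 0 1 1 2 x, riemann g 2 0 0 1 x, riemann g 0 1 0 1 x]

/-! ## Embeddings and their second fundamental form -/

/-- The metric `ḡ_{ij} = ∂_i y · ∂_j y` induced by a map `y` into `ℝ^N`. -/
def inducedMetric {n N : ℕ} (y : (Fin n → ℝ) → (Fin N → ℝ)) (x : Fin n → ℝ) :
    Matrix (Fin n) (Fin n) ℝ :=
  Matrix.of fun i j => pd i y x ⬝ᵥ pd j y x

/-- `H_{ij} = ∂²_{ij} y - Γ^k_{ij} ∂_k y`, the component of `∂²_{ij} y` normal to the image of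
`y`; here `Γ^k_{ij}` are the Christoffel symbols of the induced metric. -/
def secondFF {n N : ℕ} (y : (Fin n → ℝ) → (Fin N → ℝ)) (i j : Fin n) (x : Fin n → ℝ) :
    Fin N → ℝ :=
  pd i (pd j y) x - ∑ k, christoffel (inducedMetric y) k i j x • pd k y x

/-- The linear map `H_x : ℝ^N → 𝒮_n`, `H_x(v) = [⟨H_{ij}(x), v⟩]`. -/
def secondFFMap {n N : ℕ} (y : (Fin n → ℝ) → (Fin N → ℝ)) (x : Fin n → ℝ) :
    (Fin N → ℝ) →ₗ[ℝ] Matrix (Fin n) (Fin n) ℝ where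
  toFun v := Matrix.of fun i j => secondFF y i j x ⬝ᵥ v
  map_add' v w := by ext i j; simp [dotProduct_add]
  map_smul' c v := by ext i j; simp [dotProduct_smul]

/-- The space `II_x = H_x(ℝ^N)`. -/
def spaceII {n N : ℕ} (y : (Fin n → ℝ) → (Fin N → ℝ)) (x : Fin n → ℝ) :
    Submodule ℝ (Matrix (Fin n) (Fin n) ℝ) :=
  LinearMap.range (secondFFMap y x)

/-- The annihilator of a space of quadratic forms: all symmetric matrices `A` with
`∑ A^{ij} H_{ij} = 0` for every `H` in the space. -/
def annihilator {n : ℕ} (V : Submodule ℝ (Matrix (Fin n) (Fin n) ℝ)) :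
    Submodule ℝ (Matrix (Fin n) (Fin n) ℝ) where
  carrier := {A | A.IsSymm ∧ ∀ H ∈ V, ∑ i, ∑ j, A i j * H i j = 0}
  zero_mem' := ⟨Matrix.isSymm_zero, by simp⟩
  add_mem' := fun {A B} hA hB => ⟨hA.1.add hB.1, fun H hH => by
    simp [add_mul, Finset.sum_add_distrib, hA.2 H hH, hB.2 H hH]⟩
  smul_mem' := fun c A hA => ⟨hA.1.smul c, fun H hH => by
    simp [mul_assoc, ← Finset.mul_sum, hA.2 H hH]⟩

/-- The embedding is nondegenerate on `Ω`: `dim II_x = n(n-1)/2` for all `x ∈ Ω`. -/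
def NondegenerateOn {n N : ℕ} (y : (Fin n → ℝ) → (Fin N → ℝ)) (Ω : Set (Fin n → ℝ)) : Prop :=
  ∀ x ∈ Ω, Module.finrank ℝ (spaceII y x) = n * (n - 1) / 2

/-- `y` is a real analytic embedding of `Ω` into `ℝ^N`: an analytic immersion that is a
homeomorphism onto its image. -/
def IsAnalyticEmbeddingOn {n N : ℕ} (y : (Fin n → ℝ) → (Fin N → ℝ))
    (Ω : Set (Fin n → ℝ)) : Prop :=
  AnalyticOnNhd ℝ y Ω ∧ Topology.IsEmbedding (fun x : Ω => y x) ∧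
    ∀ x ∈ Ω, LinearIndependent ℝ fun i => pd i y x

/-- The metrics `g` and `g'` agree at the point `x` up to order `β`: all their partial derivatives
of order at most `β` coincide at `x`. -/
def AgreeToOrder {n : ℕ} (β : ℕ) (g g' : (Fin n → ℝ) → Matrix (Fin n) (Fin n) ℝ)
    (x : Fin n → ℝ) : Prop :=
  ∀ m ≤ β, ∀ i j,
    iteratedFDeriv ℝ m (fun y => g y i j) x = iteratedFDeriv ℝ m (fun y => g' y i j) x

/-- `y` is an approximate isometric embedding of order `β` at `0` for the metric `g`, defined on the
neighborhood `Ω` of `0`: a nondegenerate real analytic embedding whose induced metric (which is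
then real analytic on `Ω`) agrees with `g` up to order `β` at `0`. -/
structure IsApproxIsometricEmbedding {n N : ℕ} (β : ℕ)
    (g : (Fin n → ℝ) → Matrix (Fin n) (Fin n) ℝ)
    (y : (Fin n → ℝ) → (Fin N → ℝ)) (Ω : Set (Fin n → ℝ)) : Prop where
  isOpen : IsOpen Ω
  zero_mem : (0 : Fin n → ℝ) ∈ Ω
  embedding : IsAnalyticEmbeddingOn y Ω
  nondegenerate : NondegenerateOn y Ω
  agree : AgreeToOrder β g (inducedMetric y) 0

/-- `A^1, …, A^n` (with `A k x i j = A^{kij}(x)`) are smooth on `Ω`, form a basis of the annihilator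
of `II_x` at each `x ∈ Ω`, and have coefficients `A^{kij}` symmetric in all three indices. -/
structure IsSymmetricAnnihilatorBasis {n N : ℕ} (y : (Fin n → ℝ) → (Fin N → ℝ))
    (A : Fin n → (Fin n → ℝ) → Matrix (Fin n) (Fin n) ℝ) (Ω : Set (Fin n → ℝ)) : Prop where
  smooth : ∀ k, SmoothMatOn (A k) Ω
  linearIndependent : ∀ x ∈ Ω, LinearIndependent ℝ fun k => A k x
  span_eq : ∀ x ∈ Ω, Submodule.span ℝ (Set.range fun k => A k x) = annihilator (spaceII y x)
  symm_right : ∀ x ∈ Ω, ∀ k i j, A k x i j = A k x j i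
  symm_left : ∀ x ∈ Ω, ∀ k i j, A k x i j = A j x i k

/-! ## First order linear operators and strong symmetric positivity -/

/-- A first order linear partial differential operator `P v = ∑ A^i ∂_i v + B v`, acting on
`ℝ^s`-valued functions of `n` variables. -/
structure FirstOrderOp (n s : ℕ) where
  /-- The coefficients `A^1, …, A^n`. -/
  A : Fin n → (Fin n → ℝ) → Matrix (Fin s) (Fin s) ℝ
  /-- The zeroth order coefficient. -/
  B : (Fin n → ℝ) → Matrix (Fin s) (Fin s) ℝ

/-- The function `P v = ∑ A^i ∂_i v + B v`. -/
def FirstOrderOp.apply {n s : ℕ} (P : FirstOrderOp n s) (v : (Fin n → ℝ) → (Fin s → ℝ))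
    (x : Fin n → ℝ) : Fin s → ℝ :=
  ∑ i, P.A i x *ᵥ pd i v x + P.B x *ᵥ v x

/-- The operator `P` has `C^∞` coefficients on `U` and is strongly symmetric positive there:
the `A^i` are symmetric and the quadratic forms `Q₀` and `Q₁` are positive definite at each point. -/
structure StronglySymmetricPositiveOn {n s : ℕ} (P : FirstOrderOp n s)
    (U : Set (Fin n → ℝ)) : Prop where
  smooth_A : ∀ i, SmoothMatOn (P.A i) U
  smooth_B : SmoothMatOn P.B U
  symm : ∀ x ∈ U, ∀ i, (P.A i x).IsSymm
  pos_Q0 : ∀ x ∈ U, ∀ ξ : Fin s → ℝ, ξ ≠ 0 →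
    0 < ξ ⬝ᵥ ((P.B x + (P.B x)ᵀ - ∑ i, pdMat i (P.A i) x) *ᵥ ξ)
  pos_Q1 : ∀ x ∈ U, ∀ ξ : Fin n → Fin s → ℝ, ξ ≠ 0 →
    0 < ∑ i, ∑ j, ξ j ⬝ᵥ ((pdMat j (P.A i) x + pdMat i (P.A j) x) *ᵥ ξ i)

/-- The reduced linearized isometric embedding operator at `y`, acting on the tangential components
`v̄_j = v · ∂_j y`: `(P v̄)^k = A^{kij} (∂_i v̄_j - Γ^l_{ij} v̄_l)`. Its coefficients are
`(Ā^i)_{kj} = A^{kij}` and `B_{kj} = - A^{klm} Γ^j_{lm}`. -/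
def reducedOp {n N : ℕ} (y : (Fin n → ℝ) → (Fin N → ℝ))
    (A : Fin n → (Fin n → ℝ) → Matrix (Fin n) (Fin n) ℝ) : FirstOrderOp n n where
  A i x := Matrix.of fun k j => A k x i j
  B x := Matrix.of fun k j => -∑ l, ∑ m, A k x l m * christoffel (inducedMetric y) j l m x

/-! ## Changes of variables -/

/-- The Jacobian matrix `[∂φ^i / ∂x̄^j]`. -/
def jacobian {n : ℕ} (φ : (Fin n → ℝ) → (Fin n → ℝ)) (x : Fin n → ℝ) :
    Matrix (Fin n) (Fin n) ℝ :=
  Matrix.of fun i j => pd j (fun y => φ y i) x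

/-- The operator obtained from `P` by the change of variables `x = φ(x̄)`, `v = T(x̄) w` followed by
multiplication by `Tᵀ` on the left, so that `(P.transform φ T) w = Tᵀ ((P v) ∘ φ)`. By the chain
rule `∂/∂x^i = ∑_j (J⁻¹)_{ji} ∂/∂x̄^j` with `J` the Jacobian matrix of `φ`, so its coefficients
are `Ã^j = Tᵀ (∑_i (J⁻¹)_{ji} A^i) T` and `B̃ = Tᵀ (B T + ∑_j (∑_i (J⁻¹)_{ji} A^i) ∂_j T)`,
with `A^i` and `B` evaluated at `φ(x̄)`. -/
def FirstOrderOp.transform {n s : ℕ} (P : FirstOrderOp n s) (φ : (Fin n → ℝ) → (Fin n → ℝ))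
    (T : (Fin n → ℝ) → Matrix (Fin s) (Fin s) ℝ) : FirstOrderOp n s where
  A j x := (T x)ᵀ * (∑ i, (jacobian φ x)⁻¹ j i • P.A i (φ x)) * T x
  B x := (T x)ᵀ * (P.B (φ x) * T x
    + ∑ j, (∑ i, (jacobian φ x)⁻¹ j i • P.A i (φ x)) * pdMat j T x)

/-- The quadratic map `x^i = x̄^i + ½ c^i_{jk} x̄^j x̄^k`. -/
def quadMap {n : ℕ} (c : Fin n → Fin n → Fin n → ℝ) (x : Fin n → ℝ) : Fin n → ℝ :=
  fun i => x i + (1 / 2) * ∑ j, ∑ k, c i j k * x j * x k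

/-- The matrix function `I + x̄^i S_i`. -/
def affineMat {n : ℕ} (S : Fin n → Matrix (Fin n) (Fin n) ℝ) (x : Fin n → ℝ) :
    Matrix (Fin n) (Fin n) ℝ :=
  1 + ∑ i, x i • S i

/-- On the open neighborhood `U` of `0`, the pair `(φ, T)` is an admissible change of variables
`x = φ(x̄)`, `v̄ = T(x̄) w̄` for operators on `Ω`: `φ` is injective and takes `U` into `Ω`, with
`φ(0) = 0`, and `φ` has invertible Jacobian matrix and `T` is invertible on `U`. -/
structure IsChangeOfVariables {n s : ℕ} (φ : (Fin n → ℝ) → (Fin n → ℝ))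
    (T : (Fin n → ℝ) → Matrix (Fin s) (Fin s) ℝ) (U Ω : Set (Fin n → ℝ)) : Prop where
  isOpen : IsOpen U
  zero_mem : (0 : Fin n → ℝ) ∈ U
  map_zero : φ 0 = 0
  mapsTo : MapsTo φ U Ω
  injOn : InjOn φ U
  det_jacobian : ∀ x ∈ U, (jacobian φ x).det ≠ 0
  det_ne_zero : ∀ x ∈ U, (T x).det ≠ 0

/-- For the metric `g` on the neighborhood `Ω₀` of `0` in `ℝⁿ`, and `N = n(n+1)/2`: to every order
`β` there is an approximate isometric embedding `y` of a neighborhood `Ω ⊆ Ω₀` of `0` into `ℝ^N`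
whose reduced linearized system, formed with a suitable symmetric basis of the annihilators of its
second fundamental forms, becomes strongly symmetric positive on a neighborhood `U` of `0` after a
change of variables `x^i = x̄^i + ½ c^i_{jk} x̄^j x̄^k`, `v̄ = (I + x̄^i S_i) w̄`. -/
def HasSSPApproxEmbeddings {n : ℕ} (g : (Fin n → ℝ) → Matrix (Fin n) (Fin n) ℝ)
    (Ω₀ : Set (Fin n → ℝ)) : Prop :=
  ∀ β : ℕ, ∃ (Ω : Set (Fin n → ℝ)) (y : (Fin n → ℝ) → (Fin (n * (n + 1) / 2) → ℝ))
    (A : Fin n → (Fin n → ℝ) → Matrix (Fin n) (Fin n) ℝ)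
    (c : Fin n → Fin n → Fin n → ℝ) (S : Fin n → Matrix (Fin n) (Fin n) ℝ)
    (U : Set (Fin n → ℝ)),
    Ω ⊆ Ω₀ ∧
    IsApproxIsometricEmbedding β g y Ω ∧
    IsSymmetricAnnihilatorBasis y A Ω ∧
    (∀ i j k, c i j k = c i k j) ∧
    IsChangeOfVariables (quadMap c) (affineMat S) U Ω ∧
    StronglySymmetricPositiveOn ((reducedOp y A).transform (quadMap c) (affineMat S)) U

end IsomEmb

end

noncomputable section

namespace IsomEmb

open Set Matrix MvPolynomial
open scoped ContDiff Topology

/-! ## Polynomials and their partial derivatives -/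

/-! Everything demanded of the reduced operator is decided at the origin by finitely many
derivatives of the embedding. The theorem thus splits into formal solvability, a criterion on
one-jets, and algebra at a point.

Formal solvability. Seek polynomial components Y ~ Lx with LᵀL = g(0), and Z_a ~ ½ h^a_{ij} x_i x_j.
If the h^a satisfy the Gauss equations, g is matched through second order, because these equations
are the compatibility condition for the cubic part of Y (`exists_polyMetric_order_two`). At each
later order a symmetric tensor must be written as ∂_i w_j + ∂_j w_i + h^a_{ij} u_a. Contraction with
a basis A^k of the annihilator of the h^a reduces this to A^{kij} ∂_i w_j = f^k, which is solvable
on polynomials as soon as some covector is noncharacteristic (`exists_polyOp_eq`,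
`IsRegularPair.exists_strain`). A solution (v, u) of the homogeneous problem, with u of order three,
can be inserted with an arbitrary factor t (`IsRegularPair.exists_polyMetric_agree`).

Positivity. Strong symmetric positivity is an open condition, so it need only hold at 0, where for
fixed A(0) both forms are linear in the first derivatives of A, in S and in c. Those derivatives are
tied to the third derivatives of Z, which contain t u. When S and c are also scaled by t, each form
becomes a fixed form plus t times a form computed from algebraic data, and large t wins. Hence a
`DeformationJet` with positive forms, for some h obeying the Gauss equations, is enough
(`hasSSPApproxEmbeddings_of_deformationJet`).

Algebra. For n = 2 take h = r diag(1, ±1), with deformations given by third and fourth powers of a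
complex or split-complex variable. For n = 3 take A^{123} = 1, A^{iii} = 2 t_i and t = x s with s_i
= ±1, and let x → 0+. The Gauss equations then force |H_ii|² ~ |R_jk| / x and s_i = sign R_jk for
distinct i, j, k, so the off-diagonal entries of the curvature matrix must not vanish. The
normalization of A and the changes of variables carry poles in x that cancel; the limiting forms are
positive and depend only on s (`symbolDeriv_sing`, `isPosBlockForm_limDeriv`). A linear change of
frame close to the identity makes the off-diagonal entries nonzero. Only eight limits occur, so it
can be taken close enough to preserve positivity before the signs are known. -/

theorem contDiff_eval {n : ℕ} (p : MvPolynomial (Fin n) ℝ) {k : WithTop ℕ∞} :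
    ContDiff ℝ k (fun x : Fin n → ℝ => eval x p) :=
  (AnalyticOnNhd.eval_mvPolynomial p).contDiff

theorem hasFDerivAt_eval {n : ℕ} (p : MvPolynomial (Fin n) ℝ) (x : Fin n → ℝ) :
    HasFDerivAt (fun x : Fin n → ℝ => eval x p)
      (∑ i, eval x (pderiv i p) • (ContinuousLinearMap.proj i : (Fin n → ℝ) →L[ℝ] ℝ)) x := by
  induction p using MvPolynomial.induction_on with
  | C a => simpa using hasFDerivAt_const a x
  | add p q hp hq =>
    simp only [map_add, add_smul, Finset.sum_add_distrib]
    exact hp.add hq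
  | mul_X p j hp =>
    have h := hp.mul (hasFDerivAt_apply (𝕜 := ℝ) j x)
    simp only [map_mul, eval_X]
    refine h.congr_fderiv ?_
    ext v
    simp only [_root_.add_apply, _root_.smul_apply,
      _root_.sum_apply, ContinuousLinearMap.proj_apply, smul_eq_mul, pderiv_mul,
      map_add, map_mul, eval_X, add_mul, Finset.sum_add_distrib, pderiv_X, Finset.mul_sum]
    rw [add_comm]
    congr 1
    · exact Finset.sum_congr rfl fun i _ => by ring
    · rw [Finset.sum_eq_single j]
      · simp
      · intro b _ hb; simp [hb.symm]
      · simp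

theorem pd_eval {n : ℕ} (i : Fin n) (p : MvPolynomial (Fin n) ℝ) :
    pd i (fun x => eval x p) = fun x => eval x (pderiv i p) := by
  funext x
  rw [pd, (hasFDerivAt_eval p x).fderiv]
  simp [Pi.single_apply]

theorem pderiv_pderiv_comm {n : ℕ} (i j : Fin n) (p : MvPolynomial (Fin n) ℝ) :
    pderiv i (pderiv j p) = pderiv j (pderiv i p) := by
  ext m
  simp only [coeff_pderiv]
  by_cases h : i = j
  · subst h; rfl
  · have h' : j ≠ i := fun e => h e.symm
    rw [add_right_comm]
    simp only [Finsupp.add_apply, Finsupp.single_apply, h, h', if_false]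
    push_cast; ring

/-- The ideal of polynomials of order at least `d` at the origin. -/
abbrev orderIdeal (n d : ℕ) : Ideal (MvPolynomial (Fin n) ℝ) :=
  (idealOfVars (Fin n) ℝ) ^ d

theorem orderIdeal_anti {n d e : ℕ} (h : d ≤ e) : orderIdeal n e ≤ orderIdeal n d :=
  Ideal.pow_le_pow_right h

theorem mul_mem_orderIdeal {n d e : ℕ} {p q : MvPolynomial (Fin n) ℝ}
    (hp : p ∈ orderIdeal n d) (hq : q ∈ orderIdeal n e) : p * q ∈ orderIdeal n (d + e) := by
  rw [orderIdeal, pow_add]; exact Ideal.mul_mem_mul hp hq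

theorem pderiv_mem_orderIdeal {n d : ℕ} {p : MvPolynomial (Fin n) ℝ} (i : Fin n)
    (hp : p ∈ orderIdeal n (d + 1)) : pderiv i p ∈ orderIdeal n d := by
  rw [orderIdeal, mem_pow_idealOfVars_iff'] at hp ⊢
  intro x hx
  rw [coeff_pderiv, hp, zero_mul]
  simp [Finsupp.degree_single]; omega

theorem pderiv_mem_orderIdeal_pred {n d : ℕ} {p : MvPolynomial (Fin n) ℝ} (i : Fin n)
    (hp : p ∈ orderIdeal n d) : pderiv i p ∈ orderIdeal n (d - 1) := by
  cases d with
  | zero => simp [orderIdeal]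
  | succ d => exact pderiv_mem_orderIdeal i hp

theorem X_mem_orderIdeal {n : ℕ} (i : Fin n) : (X i : MvPolynomial (Fin n) ℝ) ∈ orderIdeal n 1 := by
  rw [orderIdeal, mem_pow_idealOfVars_iff']
  intro x hx
  classical
  rw [coeff_X, if_neg]
  rintro rfl
  simp [Finsupp.degree_single] at hx

theorem eval_zero_of_mem_orderIdeal {n d : ℕ} {p : MvPolynomial (Fin n) ℝ}
    (hp : p ∈ orderIdeal n (d + 1)) : eval (0 : Fin n → ℝ) p = 0 := by
  rw [orderIdeal, mem_pow_idealOfVars_iff'] at hp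
  have := hp 0 (by simp)
  rwa [eval_zero, constantCoeff_eq]

/-! ## Taylor polynomials -/

theorem contDiff_pd {n : ℕ} {F : Type*} [NormedAddCommGroup F] [NormedSpace ℝ F]
    {f : (Fin n → ℝ) → F} (hf : ContDiff ℝ ∞ f) (i : Fin n) :
    ContDiff ℝ ∞ (IsomEmb.pd i f) :=
  (hf.fderiv_right (m := ∞) (by simp)).clm_apply contDiff_const

/-- The differential is a sum of partial derivatives composed with constant linear maps, so its
derivatives at 0 vanish with theirs. Jets can then be compared by induction on the order, using `pd`
alone. -/
theorem iteratedFDeriv_succ_eq_zero {n m : ℕ} {f : (Fin n → ℝ) → ℝ} (hf : ContDiff ℝ ∞ f)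
    (h : ∀ i, iteratedFDeriv ℝ m (pd i f) 0 = 0) : iteratedFDeriv ℝ (m + 1) f 0 = 0 := by
  have e : (fun y => fderiv ℝ f y) = fun y => ∑ i : Fin n,
      (((ContinuousLinearMap.id ℝ ℝ).smulRight
        (ContinuousLinearMap.proj i : (Fin n → ℝ) →L[ℝ] ℝ)) ∘ pd i f) y := by
    funext y
    ext v
    simp only [Function.comp, pd, _root_.sum_apply, ContinuousLinearMap.smulRight_apply,
      ContinuousLinearMap.id_apply, _root_.smul_apply, ContinuousLinearMap.proj_apply,
      smul_eq_mul]
    conv_lhs => rw [pi_eq_sum_univ' v]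
    simp [mul_comm]
  have hz : iteratedFDeriv ℝ m (fun y => fderiv ℝ f y) 0 = 0 := by
    rw [e]
    have hs : ∀ i : Fin n, ContDiff ℝ m (((ContinuousLinearMap.id ℝ ℝ).smulRight
        (ContinuousLinearMap.proj i : (Fin n → ℝ) →L[ℝ] ℝ)) ∘ pd i f) := fun i =>
      (ContinuousLinearMap.contDiff _).comp ((contDiff_pd hf i).of_le (by exact_mod_cast le_top))
    rw [iteratedFDeriv_fun_sum_apply fun i _ => (hs i).contDiffAt]
    refine Finset.sum_eq_zero fun i _ => ?_
    rw [ContinuousLinearMap.iteratedFDeriv_comp_left (n := m) _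
      ((contDiff_pd hf i).of_le (by exact_mod_cast le_top)).contDiffAt le_rfl, h i]
    ext; simp
  rw [iteratedFDeriv_succ_eq_comp_right, Function.comp, hz]
  exact LinearIsometryEquiv.map_zero _

theorem iteratedFDeriv_eval_eq_zero {n m : ℕ} {p : MvPolynomial (Fin n) ℝ}
    (hp : p ∈ orderIdeal n (m + 1)) : iteratedFDeriv ℝ m (fun x => eval x p) 0 = 0 := by
  induction m generalizing p with
  | zero =>
    ext v
    simpa using eval_zero_of_mem_orderIdeal hp
  | succ m ih =>
    refine iteratedFDeriv_succ_eq_zero (contDiff_eval p) fun i => ?_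
    rw [pd_eval]
    exact ih (pderiv_mem_orderIdeal i hp)

theorem pd_pd_comm {n : ℕ} {F : Type*} [NormedAddCommGroup F] [NormedSpace ℝ F]
    {f : (Fin n → ℝ) → F} {x : Fin n → ℝ} (hf : ContDiffAt ℝ 2 f x)
    (i j : Fin n) : pd i (pd j f) x = pd j (pd i f) x := by
  have hd : DifferentiableAt ℝ (fderiv ℝ f) x :=
    (hf.fderiv_right (m := 1) (by norm_num)).differentiableAt (by norm_num)
  have hs := hf.isSymmSndFDerivAt (by simp)
  have e : ∀ i j, pd i (pd j f) x = fderiv ℝ (fderiv ℝ f) x (Pi.single i 1) (Pi.single j 1) := by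
    intro i j
    have : pd j f = fun y => fderiv ℝ f y (Pi.single j 1) := rfl
    rw [pd, this, fderiv_clm_apply hd (differentiableAt_const _)]
    simp
  rw [e, e, hs.eq]

/-- Smooth functions on `ℝⁿ`. -/
abbrev SmoothFn (n : ℕ) := {f : (Fin n → ℝ) → ℝ // ContDiff ℝ ∞ f}

/-- The partial derivative as an operator on smooth functions. -/
def SmoothFn.pd {n : ℕ} (i : Fin n) (f : SmoothFn n) : SmoothFn n :=
  ⟨IsomEmb.pd i f.1, contDiff_pd f.2 i⟩

/-- Symmetry of second derivatives: it permits folding over the multiset of a multi-index without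
choosing an order. -/
instance {n : ℕ} : LeftCommutative (SmoothFn.pd (n := n)) :=
  ⟨fun i j f => Subtype.ext <| funext fun _ => pd_pd_comm (f.2.of_le (WithTop.coe_le_coe.2 le_top)).contDiffAt i j⟩

/-- The mixed partial derivative of a smooth function given by a multi-index. -/
def SmoothFn.mixed {n : ℕ} (a : Fin n →₀ ℕ) (f : SmoothFn n) : SmoothFn n :=
  (Finsupp.toMultiset a).foldr SmoothFn.pd f

theorem SmoothFn.mixed_add_single {n : ℕ} (a : Fin n →₀ ℕ) (i : Fin n) (f : SmoothFn n) :
    SmoothFn.mixed (a + Finsupp.single i 1) f = SmoothFn.mixed a (SmoothFn.pd i f) := by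
  rw [SmoothFn.mixed, map_add, Multiset.foldr_add]
  simp [SmoothFn.mixed]

/-- The Taylor polynomial of order `k` at the origin. -/
def taylorPoly {n : ℕ} (k : ℕ) (f : SmoothFn n) : MvPolynomial (Fin n) ℝ :=
  ∑ a ∈ (Finset.range (k + 1)).biUnion (fun d => Finset.finsuppAntidiag Finset.univ d),
    monomial a ((SmoothFn.mixed a f).1 0 / ∏ j, ((a j).factorial : ℝ))

theorem coeff_taylorPoly {n : ℕ} (k : ℕ) (f : SmoothFn n) (a : Fin n →₀ ℕ) :
    coeff a (taylorPoly k f) = if a.degree ≤ k then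
      (SmoothFn.mixed a f).1 0 / ∏ j, ((a j).factorial : ℝ) else 0 := by
  classical
  rw [taylorPoly, coeff_sum]
  simp only [coeff_monomial]
  rw [Finset.sum_ite_eq']
  refine if_congr ?_ rfl rfl
  simp [Finset.mem_biUnion, Finset.mem_finsuppAntidiag, Finsupp.degree_eq_sum]

/-- The factorials absorb the exponents produced by differentiation. Because Taylor polynomials
commute with derivatives, agreement of all derivatives reduces inductively to agreement of values at
0. -/
theorem pderiv_taylorPoly {n : ℕ} (k : ℕ) (f : SmoothFn n) (i : Fin n) :
    pderiv i (taylorPoly (k + 1) f) = taylorPoly k (SmoothFn.pd i f) := by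
  ext a
  rw [coeff_pderiv, coeff_taylorPoly, coeff_taylorPoly, SmoothFn.mixed_add_single]
  have hd : (a + Finsupp.single i 1).degree = a.degree + 1 := by
    simp [Finsupp.degree_single]
  rw [hd]
  by_cases h : a.degree ≤ k
  · rw [if_pos h, if_pos (by omega)]
    have : ∏ j, (((a + Finsupp.single i 1 : Fin n →₀ ℕ) j).factorial : ℝ)
        = (a i + 1) * ∏ j, ((a j).factorial : ℝ) := by
      rw [← Finset.mul_prod_erase _ _ (Finset.mem_univ i),
        ← Finset.mul_prod_erase _ (fun j => ((a j).factorial : ℝ)) (Finset.mem_univ i)]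
      rw [← mul_assoc]
      congr 1
      · simp [Nat.factorial_succ]
      · refine Finset.prod_congr rfl fun j hj => ?_
        rw [Finsupp.add_apply, Finsupp.single_apply, if_neg (Finset.ne_of_mem_erase hj).symm, add_zero]
    rw [this]
    have h1 : (a i : ℝ) + 1 ≠ 0 := by positivity
    have h2 : ∏ j, ((a j).factorial : ℝ) ≠ 0 :=
      Finset.prod_ne_zero_iff.2 fun j _ => by positivity
    field_simp
  · rw [if_neg h, if_neg (by omega), zero_mul]

theorem iteratedFDeriv_sub_taylorPoly {n m k : ℕ} (hm : m ≤ k) (f : SmoothFn n) :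
    iteratedFDeriv ℝ m (fun x => f.1 x - eval x (taylorPoly k f)) 0 = 0 := by
  induction m generalizing k f with
  | zero =>
    ext v
    have : eval 0 (taylorPoly k f) = f.1 0 := by
      have := coeff_taylorPoly k f 0
      rw [← constantCoeff_eq, ] at this
      rw [eval_zero, this]
      simp [SmoothFn.mixed]
    rw [iteratedFDeriv_zero_apply, this]
    simp
  | succ m ih =>
    obtain ⟨k, rfl⟩ : ∃ k', k = k' + 1 := ⟨k - 1, by omega⟩
    refine iteratedFDeriv_succ_eq_zero (f.2.sub (contDiff_eval _)) fun i => ?_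
    have : pd i (fun x => f.1 x - eval x (taylorPoly (k + 1) f))
        = fun x => (SmoothFn.pd i f).1 x - eval x (taylorPoly k (SmoothFn.pd i f)) := by
      funext x
      have h1 : DifferentiableAt ℝ f.1 x := f.2.differentiable (by simp) x
      have h2 : DifferentiableAt ℝ (fun x => eval x (taylorPoly (k + 1) f)) x :=
        (contDiff_eval (k := 1) _).differentiable (by simp) x
      have h3 := congrFun (pd_eval i (taylorPoly (k + 1) f)) x
      rw [pd] at h3
      rw [pd, fderiv_fun_sub h1 h2, _root_.sub_apply, h3, pderiv_taylorPoly]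
      rfl
    rw [this]
    exact ih (by omega) _

/-- A function which is smooth near the origin has the same derivatives up to order `k` there as
some polynomial. -/
theorem exists_poly_iteratedFDeriv_eq {n : ℕ} {f : (Fin n → ℝ) → ℝ} {Ω : Set (Fin n → ℝ)}
    (hΩ : IsOpen Ω) (h0 : (0 : Fin n → ℝ) ∈ Ω) (hf : ContDiffOn ℝ ∞ f Ω) (k : ℕ) :
    ∃ p : MvPolynomial (Fin n) ℝ, ∀ m ≤ k,
      iteratedFDeriv ℝ m f 0 = iteratedFDeriv ℝ m (fun x => eval x p) 0 := by
  obtain ⟨F, hF, hFf⟩ : ∃ F : (Fin n → ℝ) → ℝ, ContDiff ℝ ∞ F ∧ F =ᶠ[nhds 0] f := by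
    -- Multiplication by a bump function supported in Ω gives a globally smooth function with the
    -- same germ at 0.
    obtain ⟨ε, hε, hb⟩ := Metric.nhds_basis_closedBall.mem_iff.1 (hΩ.mem_nhds h0)
    let φ : ContDiffBump (0 : Fin n → ℝ) := ⟨ε / 2, ε, by positivity, by linarith⟩
    refine ⟨fun x => φ x * f x, ?_, ?_⟩
    · rw [contDiff_iff_contDiffAt]
      intro x
      by_cases hx : x ∈ Ω
      · exact φ.contDiffAt.mul (hf.contDiffAt (hΩ.mem_nhds hx))
      · have hx' : x ∉ tsupport φ := fun h => hx (hb (by rwa [φ.tsupport_eq] at h))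
        refine (contDiffAt_const (c := (0 : ℝ))).congr_of_eventuallyEq ?_
        filter_upwards [notMem_tsupport_iff_eventuallyEq.1 hx'] with y hy
        simp [hy]
    · filter_upwards [φ.eventuallyEq_one] with y hy
      simp [hy]
  refine ⟨taylorPoly k ⟨F, hF⟩, fun m hm => ?_⟩
  have h := iteratedFDeriv_sub_taylorPoly hm ⟨F, hF⟩
  rw [← (Filter.EventuallyEq.iteratedFDeriv ℝ hFf m).eq_of_nhds]
  have h2 : (fun x => F x - eval x (taylorPoly k ⟨F, hF⟩))
      = F - fun x => eval x (taylorPoly k ⟨F, hF⟩) := rfl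
  simp only [h2] at h
  rw [iteratedFDeriv_sub_apply (hF.of_le (by exact_mod_cast le_top)).contDiffAt
    (contDiff_eval _).contDiffAt, sub_eq_zero] at h
  exact h

/-! ## First order systems with constant coefficients on polynomials -/

/-- The operator `v ↦ ∑ A^i ∂_i v` on vectors of polynomials, with constant matrices `A^i`. -/
def polyOp {n s : ℕ} (A : Fin n → Matrix (Fin s) (Fin s) ℝ)
    (v : Fin s → MvPolynomial (Fin n) ℝ) (k : Fin s) : MvPolynomial (Fin n) ℝ :=
  ∑ i, ∑ j, C (A i k j) * pderiv i (v j)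

theorem polyOp_mem_orderIdeal {n s d : ℕ} (A : Fin n → Matrix (Fin s) (Fin s) ℝ)
    {v : Fin s → MvPolynomial (Fin n) ℝ} (hv : ∀ j, v j ∈ orderIdeal n d) (k : Fin s) :
    polyOp A v k ∈ orderIdeal n (d - 1) :=
  Submodule.sum_mem _ fun i _ => Submodule.sum_mem _ fun j _ =>
    Ideal.mul_mem_left _ _ (pderiv_mem_orderIdeal_pred i (hv j))

theorem polyOp_iterate_mem {n s d : ℕ} (A : Fin n → Matrix (Fin s) (Fin s) ℝ) (k : ℕ)
    {v : Fin s → MvPolynomial (Fin n) ℝ} (hv : ∀ j, v j ∈ orderIdeal n d) :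
    ∀ j, (polyOp A)^[k] v j ∈ orderIdeal n (d - k) := by
  induction k with
  | zero => simpa using hv
  | succ k ih =>
    intro j
    rw [Function.iterate_succ_apply', ← Nat.sub_sub]
    exact polyOp_mem_orderIdeal A ih j

/-- Each application lowers the degree, so the operator is locally nilpotent and the series that
inverts it is a finite sum. -/
theorem polyOp_iterate_eq_zero {n s : ℕ} (A : Fin n → Matrix (Fin s) (Fin s) ℝ)
    (v : Fin s → MvPolynomial (Fin n) ℝ) : ∃ K, (polyOp A)^[K] v = 0 := by
  have key : ∀ K (v : Fin s → MvPolynomial (Fin n) ℝ),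
      (∀ j x, K ≤ Finsupp.degree x → coeff x (v j) = 0) → (polyOp A)^[K] v = 0 := by
    intro K
    induction K with
    | zero =>
      intro v hv
      funext j; ext x
      simpa using hv j x
    | succ K ih =>
      intro v hv
      rw [Function.iterate_succ_apply]
      refine ih _ fun j x hx => ?_
      simp only [polyOp, coeff_sum, coeff_C_mul, coeff_pderiv]
      refine Finset.sum_eq_zero fun i _ => Finset.sum_eq_zero fun k _ => ?_
      rw [hv k _ (by simpa [Finsupp.degree_single] using hx)]
      simp
  refine ⟨Finset.univ.sup (fun j => (v j).totalDegree) + 1, key _ v fun j x hx => ?_⟩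
  by_contra h
  have h1 := le_totalDegree (mem_support_iff.2 h)
  have h2 : (v j).totalDegree ≤ Finset.univ.sup (fun j => (v j).totalDegree) :=
    Finset.le_sup (f := fun j => (v j).totalDegree) (Finset.mem_univ j)
  have h3 : Finsupp.degree x = x.sum fun _ e => e := rfl
  omega

theorem polyOp_add {n s : ℕ} (A : Fin n → Matrix (Fin s) (Fin s) ℝ)
    (v w : Fin s → MvPolynomial (Fin n) ℝ) : polyOp A (v + w) = polyOp A v + polyOp A w := by
  funext k
  simp [polyOp, mul_add, Finset.sum_add_distrib]

/-- Leibniz rule for powers of S = ∑ ξ_i x_i. Differentiating S produces ∑ ξ_i A^i = 1, so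
multiplication by S acts like an integration. -/
theorem polyOp_linear_mul {n s : ℕ} (A : Fin n → Matrix (Fin s) (Fin s) ℝ) (ξ : Fin n → ℝ)
    (hA : ∑ i, ξ i • A i = 1) (c : ℝ) (r : ℕ) (v : Fin s → MvPolynomial (Fin n) ℝ) :
    polyOp A (fun j => C c * (∑ i, C (ξ i) * X i) ^ (r + 1) * v j) =
      fun k => C (c * (r + 1)) * (∑ i, C (ξ i) * X i) ^ r * v k
        + C c * (∑ i, C (ξ i) * X i) ^ (r + 1) * polyOp A v k := by
  set S : MvPolynomial (Fin n) ℝ := ∑ i, C (ξ i) * X i with hS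
  have hdS : ∀ i, pderiv i S = C (ξ i) := fun i => by
    simp [hS, pderiv_X, Pi.single_apply]
  funext k
  have hk : ∑ i, ∑ j, C (A i k j) * (C (ξ i) * v j) = v k := by
    rw [Finset.sum_comm]
    have : ∀ j, ∑ i, C (A i k j) * (C (ξ i) * v j) = C ((1 : Matrix (Fin s) (Fin s) ℝ) k j) * v j := by
      intro j
      rw [← hA, Matrix.sum_apply, map_sum, Finset.sum_mul]
      refine Finset.sum_congr rfl fun i _ => ?_
      rw [Matrix.smul_apply, smul_eq_mul, map_mul]; ring
    simp only [this, Matrix.one_apply]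
    simp
  calc polyOp A (fun j => C c * S ^ (r + 1) * v j) k
      = ∑ i, ∑ j, (C (c * (r + 1)) * S ^ r * (C (A i k j) * (C (ξ i) * v j))
          + C c * S ^ (r + 1) * (C (A i k j) * pderiv i (v j))) := by
        rw [polyOp]
        refine Finset.sum_congr rfl fun i _ => Finset.sum_congr rfl fun j _ => ?_
        rw [pderiv_mul, pderiv_mul, pderiv_C, pderiv_pow, hdS]
        simp only [map_mul, map_add, map_natCast, map_one]
        rw [Nat.add_sub_cancel, Nat.cast_add, Nat.cast_one]
        ring
    _ = _ := by
        simp only [Finset.sum_add_distrib, ← Finset.mul_sum]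
        rw [hk]; rfl

/-- Writing P for the operator, the solution is v = ∑_r (-1)^r / (r+1)! · S^(r+1) P^r f. Applying P
telescopes the sum, and nilpotency removes the remainder. Each factor S restores the order lost to
one application of P, with one factor to spare. -/
theorem exists_polyOp_eq_of_sum_eq_one {n s d : ℕ} (A : Fin n → Matrix (Fin s) (Fin s) ℝ)
    (ξ : Fin n → ℝ) (hA : ∑ i, ξ i • A i = 1) (f : Fin s → MvPolynomial (Fin n) ℝ)
    (hf : ∀ k, f k ∈ orderIdeal n d) :
    ∃ v : Fin s → MvPolynomial (Fin n) ℝ, (∀ j, v j ∈ orderIdeal n (d + 1)) ∧ polyOp A v = f := by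
  obtain ⟨K, hK⟩ := polyOp_iterate_eq_zero A f
  set S : MvPolynomial (Fin n) ℝ := ∑ i, C (ξ i) * X i with hS
  let c : ℕ → ℝ := fun r => (-1) ^ r / (r.factorial : ℝ)
  have hc : ∀ r, c (r + 1) * (r + 1) = -c r := fun r => by
    simp only [c, Nat.factorial_succ, pow_succ]; push_cast; field_simp
  have hS1 : S ∈ orderIdeal n 1 :=
    Submodule.sum_mem _ fun i _ => Ideal.mul_mem_left _ _ (X_mem_orderIdeal i)
  have hSr : ∀ r, S ^ r ∈ orderIdeal n r := fun r => by
    rw [orderIdeal, pow_one] at hS1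
    exact Ideal.pow_mem_pow hS1 r
  have key : ∀ r, ∃ v : Fin s → MvPolynomial (Fin n) ℝ, (∀ j, v j ∈ orderIdeal n (d + 1)) ∧
      polyOp A v = fun k => f k - C (c r) * S ^ r * (polyOp A)^[r] f k := by
    intro r
    induction r with
    | zero => exact ⟨0, fun j => Submodule.zero_mem _, by funext k; simp [polyOp, c]⟩
    | succ r ih =>
      obtain ⟨v, hv, hv'⟩ := ih
      refine ⟨v + fun j => C (-c (r + 1)) * S ^ (r + 1) * (polyOp A)^[r] f j, fun j => ?_, ?_⟩
      · refine Submodule.add_mem _ (hv j) ?_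
        simp only [mul_assoc]
        refine Ideal.mul_mem_left _ _ (orderIdeal_anti ?_
          (mul_mem_orderIdeal (hSr (r + 1)) (polyOp_iterate_mem A r hf j)))
        omega
      · rw [polyOp_add, hv', polyOp_linear_mul A ξ hA]
        funext k
        simp only [Pi.add_apply]
        rw [Function.iterate_succ_apply', neg_mul, hc, neg_neg]
        simp only [map_neg]
        ring
  obtain ⟨v, hv, hv'⟩ := key K
  exact ⟨v, hv, by rw [hv', hK]; simp⟩

/-- If some combination `∑ ξ_i A^i` is invertible, then `∑ A^i ∂_i` is surjective on polynomials,
with a gain of one order. -/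
theorem exists_polyOp_eq {n s d : ℕ} (A : Fin n → Matrix (Fin s) (Fin s) ℝ)
    (ξ : Fin n → ℝ) (hA : IsUnit (∑ i, ξ i • A i).det) (f : Fin s → MvPolynomial (Fin n) ℝ)
    (hf : ∀ k, f k ∈ orderIdeal n d) :
    ∃ v : Fin s → MvPolynomial (Fin n) ℝ, (∀ j, v j ∈ orderIdeal n (d + 1)) ∧ polyOp A v = f := by
  set M := ∑ i, ξ i • A i with hM
  obtain ⟨v, hv, hv'⟩ := exists_polyOp_eq_of_sum_eq_one (fun i => M⁻¹ * A i) ξ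
    (by rw [← Matrix.nonsing_inv_mul M hA, hM, Finset.mul_sum]; simp)
    (fun k => ∑ l, C (M⁻¹ k l) * f l)
    (fun k => Submodule.sum_mem _ fun l _ => Ideal.mul_mem_left _ _ (hf l))
  refine ⟨v, hv, ?_⟩
  have h1 : ∀ k, polyOp (fun i => M⁻¹ * A i) v k = ∑ l, C (M⁻¹ k l) * polyOp A v l := by
    intro k
    simp only [polyOp, Matrix.mul_apply, map_sum, Finset.sum_mul, Finset.mul_sum, map_mul]
    rw [Finset.sum_congr rfl fun i _ => Finset.sum_comm, Finset.sum_comm]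
    exact Finset.sum_congr rfl fun _ _ => Finset.sum_congr rfl fun _ _ =>
      Finset.sum_congr rfl fun _ _ => mul_assoc _ _ _
  have h2 : ∀ g : Fin s → MvPolynomial (Fin n) ℝ, ∀ k,
      ∑ l, C (M k l) * ∑ m, C (M⁻¹ l m) * g m = g k := by
    intro g k
    simp only [Finset.mul_sum, ← mul_assoc, ← map_mul]
    rw [Finset.sum_comm]
    simp only [← Finset.sum_mul, ← map_sum, ← Matrix.mul_apply, Matrix.mul_nonsing_inv M hA,
      Matrix.one_apply]
    simp
  funext k
  rw [← h2 (polyOp A v) k, ← h2 f k]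
  simp only [← h1, hv']

/-! ## Symmetric matrices and symmetric cubic tensors -/

/-- The contraction `∑ M^{ij} N_{ij}` of two matrices. -/
def pair {n : ℕ} (M N : Matrix (Fin n) (Fin n) ℝ) : ℝ := ∑ i, ∑ j, M i j * N i j

theorem pair_comm {n : ℕ} (M N : Matrix (Fin n) (Fin n) ℝ) : pair M N = pair N M := by
  simp [pair, mul_comm]

theorem pair_add_left {n : ℕ} (M N K : Matrix (Fin n) (Fin n) ℝ) :
    pair (M + N) K = pair M K + pair N K := by
  simp [pair, add_mul, Finset.sum_add_distrib]

theorem pair_smul_left {n : ℕ} (c : ℝ) (M K : Matrix (Fin n) (Fin n) ℝ) :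
    pair (c • M) K = c * pair M K := by
  simp [pair, Finset.mul_sum, mul_assoc]

theorem pair_sum_left {n : ℕ} {ι : Type*} (s : Finset ι) (M : ι → Matrix (Fin n) (Fin n) ℝ)
    (K : Matrix (Fin n) (Fin n) ℝ) : pair (∑ a ∈ s, M a) K = ∑ a ∈ s, pair (M a) K := by
  classical
  induction s using Finset.induction_on with
  | empty => simp [pair]
  | insert a s ha ih => rw [Finset.sum_insert ha, Finset.sum_insert ha, pair_add_left, ih]

theorem pair_add_right {n : ℕ} (M N K : Matrix (Fin n) (Fin n) ℝ) :
    pair M (N + K) = pair M N + pair M K := by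
  rw [pair_comm, pair_add_left, pair_comm N, pair_comm K]

theorem pair_smul_right {n : ℕ} (c : ℝ) (M K : Matrix (Fin n) (Fin n) ℝ) :
    pair M (c • K) = c * pair M K := by
  rw [pair_comm, pair_smul_left, pair_comm]

theorem pair_sum_right {n : ℕ} {ι : Type*} (s : Finset ι) (M : ι → Matrix (Fin n) (Fin n) ℝ)
    (K : Matrix (Fin n) (Fin n) ℝ) : pair K (∑ a ∈ s, M a) = ∑ a ∈ s, pair K (M a) := by
  rw [pair_comm, pair_sum_left]; simp [pair_comm]

theorem pair_self_eq_zero {n : ℕ} {M : Matrix (Fin n) (Fin n) ℝ} (h : pair M M = 0) : M = 0 := by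
  ext i j
  have h1 : ∀ i ∈ Finset.univ, 0 ≤ ∑ j, M i j * M i j := fun i _ =>
    Finset.sum_nonneg fun j _ => mul_self_nonneg _
  have h2 := (Finset.sum_eq_zero_iff_of_nonneg h1).1 h i (Finset.mem_univ i)
  have h3 := (Finset.sum_eq_zero_iff_of_nonneg fun j _ => mul_self_nonneg (M i j)).1 h2 j
    (Finset.mem_univ j)
  simpa using h3

/-- The space of symmetric matrices. -/
def symmSubmodule (n : ℕ) : Submodule ℝ (Matrix (Fin n) (Fin n) ℝ) where
  carrier := {A | A.IsSymm}
  zero_mem' := Matrix.isSymm_zero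
  add_mem' := fun hA hB => hA.add hB
  smul_mem' := fun c _ hA => hA.smul c

/-- A symmetric matrix is a function on unordered pairs of indices. -/
theorem finrank_symmSubmodule_le (n : ℕ) :
    Module.finrank ℝ (symmSubmodule n) ≤ n * (n + 1) / 2 := by
  let Φ : symmSubmodule n →ₗ[ℝ] (Sym2 (Fin n) → ℝ) :=
    { toFun := fun E s => Sym2.lift ⟨fun i j => E.1 i j, fun i j => (E.2.apply j i)⟩ s
      map_add' := fun E F => by
        funext s
        induction s using Sym2.ind with
        | _ i j => simp
      map_smul' := fun c E => by
        funext s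
        induction s using Sym2.ind with
        | _ i j => simp }
  have hΦ : Function.Injective Φ := by
    intro E F h
    ext i j
    simpa [Φ] using congrFun h s(i, j)
  have := LinearMap.finrank_le_finrank_of_injective hΦ
  rw [Module.finrank_fintype_fun_eq_card, Sym2.card, Fintype.card_fin, Nat.choose_two_right] at this
  simpa [mul_comm] using this

/-- `pair` is an inner product, so the spans of A and h are orthogonal, hence independent, and the
dimension count makes them fill the symmetric matrices. The A component of a matrix orthogonal to
every A vanishes. -/
theorem exists_combination_of_pair_eq_zero {n : ℕ} {ι κ : Type*} [Fintype ι] [Fintype κ]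
    (hcard : Fintype.card ι + Fintype.card κ = n * (n + 1) / 2)
    {A : ι → Matrix (Fin n) (Fin n) ℝ} {h : κ → Matrix (Fin n) (Fin n) ℝ}
    (hA : LinearIndependent ℝ A) (hh : LinearIndependent ℝ h)
    (hAs : ∀ k, (A k).IsSymm) (hhs : ∀ a, (h a).IsSymm) (hAh : ∀ k a, pair (A k) (h a) = 0)
    {E : Matrix (Fin n) (Fin n) ℝ} (hE : E.IsSymm) (hAE : ∀ k, pair (A k) E = 0) :
    ∃ t : κ → ℝ, E = ∑ a, t a • h a := by
  classical
  let b : ι ⊕ κ → symmSubmodule n := Sum.elim (fun k => ⟨A k, hAs k⟩) (fun a => ⟨h a, hhs a⟩)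
  have hzero : ∀ (c : ι → ℝ) (t : κ → ℝ), pair (∑ k, c k • A k) (∑ a, t a • h a) = 0 := by
    intro c t
    simp [pair_sum_left, pair_sum_right, pair_smul_left, pair_smul_right, hAh]
  have hb : LinearIndependent ℝ b := by
    rw [Fintype.linearIndependent_iff]
    intro g hg
    have hg' := congrArg Subtype.val hg
    simp only [Fintype.sum_sum_type, b, Sum.elim_inl, Sum.elim_inr, Submodule.coe_add,
      Submodule.coe_sum, Submodule.coe_smul, Submodule.coe_zero] at hg'
    have hz := hzero (fun k => g (Sum.inl k)) (fun a => g (Sum.inr a))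
    have h1 : ∑ k, g (Sum.inl k) • A k = 0 := by
      refine pair_self_eq_zero ?_
      have := hz
      rw [eq_neg_of_add_eq_zero_right hg', ← neg_one_smul ℝ, pair_smul_right] at this
      linarith
    have h2 : ∑ a, g (Sum.inr a) • h a = 0 := by simpa [h1] using hg'
    rintro (k | a)
    · exact Fintype.linearIndependent_iff.1 hA _ h1 k
    · exact Fintype.linearIndependent_iff.1 hh _ h2 a
  have hfr : Fintype.card (ι ⊕ κ) = Module.finrank ℝ (symmSubmodule n) := by
    refine le_antisymm hb.fintype_card_le_finrank ?_
    rw [Fintype.card_sum, hcard]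
    exact finrank_symmSubmodule_le n
  have hspan := hb.span_eq_top_of_card_eq_finrank' hfr
  have hmem : (⟨E, hE⟩ : symmSubmodule n) ∈ Submodule.span ℝ (Set.range b) := by
    rw [hspan]; trivial
  obtain ⟨g, hg⟩ := (Submodule.mem_span_range_iff_exists_fun ℝ).1 hmem
  have hg' := congrArg Subtype.val hg
  simp only [Fintype.sum_sum_type, b, Sum.elim_inl, Sum.elim_inr, Submodule.coe_add,
    Submodule.coe_sum, Submodule.coe_smul] at hg'
  have h1 : ∑ k, g (Sum.inl k) • A k = 0 := by
    refine pair_self_eq_zero ?_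
    have e : pair (∑ k, g (Sum.inl k) • A k) E = 0 := by
      simp [pair_sum_left, pair_smul_left, hAE]
    rw [← hg', pair_add_right, hzero (fun k => g (Sum.inl k)) (fun a => g (Sum.inr a))] at e
    simpa using e
  exact ⟨fun a => g (Sum.inr a), by rw [← hg', h1, zero_add]⟩

/-- A family of matrices `A^{kij}` symmetric in all three indices. -/
structure IsSymmCubic {n : ℕ} (A : Fin n → Matrix (Fin n) (Fin n) ℝ) : Prop where
  right : ∀ k i j, A k i j = A k j i
  left : ∀ k i j, A k i j = A j i k

/-- The hypotheses on second fundamental forms `h` with a basis `A` of their annihilator under which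
the equations for a local isometric embedding can be solved formally. -/
structure IsRegularPair {n m : ℕ} (A : Fin n → Matrix (Fin n) (Fin n) ℝ)
    (h : Fin m → Matrix (Fin n) (Fin n) ℝ) : Prop where
  card : n + m = n * (n + 1) / 2
  h_symm : ∀ a, (h a).IsSymm
  A_symm : IsSymmCubic A
  A_li : LinearIndependent ℝ A
  h_li : LinearIndependent ℝ h
  pair_eq_zero : ∀ k a, pair (A k) (h a) = 0
  noncharacteristic : ∃ ξ : Fin n → ℝ, IsUnit (∑ i, ξ i • A i).det
  surjective : ∀ τ : Fin n → Fin m → ℝ, ∃ N : Fin n → Matrix (Fin n) (Fin n) ℝ,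
    IsSymmCubic N ∧ ∀ k a, pair (N k) (h a) = τ k a

theorem IsSymmCubic.isSymm {n : ℕ} {A : Fin n → Matrix (Fin n) (Fin n) ℝ} (hA : IsSymmCubic A)
    (k : Fin n) : (A k).IsSymm :=
  Matrix.IsSymm.ext fun i j => hA.right k j i

/-- The coefficients are fixed contractions, linear in E, so that the expansion applies to each
coefficient of a tensor with polynomial entries. -/
theorem IsRegularPair.exists_combination {n m : ℕ} {A : Fin n → Matrix (Fin n) (Fin n) ℝ}
    {h : Fin m → Matrix (Fin n) (Fin n) ℝ} (H : IsRegularPair A h) :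
    ∃ U : Fin m → Matrix (Fin n) (Fin n) ℝ, ∀ E : Matrix (Fin n) (Fin n) ℝ, E.IsSymm →
      (∀ k, pair (A k) E = 0) → E = ∑ a, pair (U a) E • h a := by
  classical
  obtain ⟨φ, hφ⟩ := (Fintype.linearCombination ℝ h).exists_leftInverse_of_injective
    (LinearMap.ker_eq_bot.2 H.h_li.fintypeLinearCombination_injective)
  refine ⟨fun a => Matrix.of fun i j => φ (Matrix.single i j 1) a, fun E hE hAE => ?_⟩
  have hp : ∀ a, pair (Matrix.of fun i j => φ (Matrix.single i j 1) a) E = φ E a := by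
    intro a
    conv_rhs => rw [Matrix.matrix_eq_sum_single E]
    simp only [map_sum, Finset.sum_apply, pair, Matrix.of_apply]
    refine Finset.sum_congr rfl fun i _ => Finset.sum_congr rfl fun j _ => ?_
    rw [show Matrix.single i j (E i j) = E i j • Matrix.single i j (1 : ℝ) by simp, map_smul]
    simp [mul_comm]
  simp only [hp]
  obtain ⟨t, ht⟩ := exists_combination_of_pair_eq_zero (by simpa using H.card) H.A_li H.h_li
    H.A_symm.isSymm H.h_symm H.pair_eq_zero hE hAE
  have := LinearMap.congr_fun hφ t
  simp only [LinearMap.comp_apply, Fintype.linearCombination_apply, LinearMap.id_apply] at this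
  rw [ht, this]

/-- A symmetric tensor with polynomial entries of order `d` is the sum of a symmetrized gradient and
of a combination of the second fundamental forms. -/
theorem IsRegularPair.exists_strain {n m d : ℕ} {A : Fin n → Matrix (Fin n) (Fin n) ℝ}
    {h : Fin m → Matrix (Fin n) (Fin n) ℝ} (H : IsRegularPair A h)
    (E : Fin n → Fin n → MvPolynomial (Fin n) ℝ) (hEs : ∀ i j, E i j = E j i)
    (hE : ∀ i j, E i j ∈ orderIdeal n d) :
    ∃ (v : Fin n → MvPolynomial (Fin n) ℝ) (u : Fin m → MvPolynomial (Fin n) ℝ),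
      (∀ j, v j ∈ orderIdeal n (d + 1)) ∧ (∀ a, u a ∈ orderIdeal n d) ∧
      ∀ i j, E i j = pderiv i (v j) + pderiv j (v i) + ∑ a, C (h a i j) * u a := by
  obtain ⟨ξ, hξ⟩ := H.noncharacteristic
  obtain ⟨U, hU⟩ := H.exists_combination
  -- Contracting ∂_i v_j + ∂_j v_i with A^k gives 2 A^{kij} ∂_i v_j, which by full symmetry is twice
  -- `polyOp A v k`; hence the factor ½ on the right side. The remainder F is then annihilated by
  -- every A^k and lies in the span of the h^a.
  obtain ⟨v, hv, hv'⟩ := exists_polyOp_eq (d := d) A ξ hξ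
    (fun k => ∑ i, ∑ j, C (A k i j / 2) * E i j)
    (fun k => Submodule.sum_mem _ fun i _ => Submodule.sum_mem _ fun j _ =>
      Ideal.mul_mem_left _ _ (hE i j))
  let F : Fin n → Fin n → MvPolynomial (Fin n) ℝ := fun i j =>
    E i j - (pderiv i (v j) + pderiv j (v i))
  have hF : ∀ i j, F i j ∈ orderIdeal n d := fun i j =>
    Submodule.sub_mem _ (hE i j) (Submodule.add_mem _ (pderiv_mem_orderIdeal i (hv j))
      (pderiv_mem_orderIdeal j (hv i)))
  have hAF : ∀ k, ∑ i, ∑ j, C (A k i j) * F i j = 0 := by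
    intro k
    have h1 := congrFun hv' k
    simp only [polyOp] at h1
    have h2 : ∑ i, ∑ j, C (A k i j) * pderiv i (v j) = ∑ i, ∑ j, C (A k i j / 2) * E i j := by
      rw [← h1]
      refine Finset.sum_congr rfl fun i _ => Finset.sum_congr rfl fun j _ => ?_
      rw [H.A_symm.left k i j, H.A_symm.right j i k, H.A_symm.left j k i]
    have h3 : ∑ i, ∑ j, C (A k i j) * pderiv j (v i) = ∑ i, ∑ j, C (A k i j / 2) * E i j := by
      rw [← h2, Finset.sum_comm]
      refine Finset.sum_congr rfl fun i _ => Finset.sum_congr rfl fun j _ => ?_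
      rw [H.A_symm.right k j i]
    simp only [F, mul_sub, mul_add, Finset.sum_sub_distrib, Finset.sum_add_distrib, h2, h3]
    rw [← Finset.sum_add_distrib, ← Finset.sum_sub_distrib]
    refine Finset.sum_eq_zero fun i _ => ?_
    rw [← Finset.sum_add_distrib, ← Finset.sum_sub_distrib]
    refine Finset.sum_eq_zero fun j _ => ?_
    rw [← add_mul, ← map_add, add_halves, sub_self]
  refine ⟨v, fun a => ∑ i, ∑ j, C (U a i j) * F i j, hv, fun a =>
    Submodule.sum_mem _ fun i _ => Submodule.sum_mem _ fun j _ =>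
      Ideal.mul_mem_left _ _ (hF i j), fun i j => ?_⟩
  have key : F i j = ∑ a, C (h a i j) * ∑ i, ∑ j, C (U a i j) * F i j := by
    ext x
    have hx := hU (Matrix.of fun i j => coeff x (F i j))
      (Matrix.IsSymm.ext fun i j => by simp [F, hEs i j, add_comm]) (fun k => by
        have := congrArg (coeff x) (hAF k)
        simpa [pair, coeff_sum, coeff_C_mul] using this)
    have hx' := congrFun (congrFun hx i) j
    simp only [Matrix.of_apply, Matrix.sum_apply, Matrix.smul_apply, smul_eq_mul] at hx'
    rw [hx']
    simp only [coeff_sum, coeff_C_mul, pair, Matrix.of_apply]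
    exact Finset.sum_congr rfl fun a _ => mul_comm _ _
  rw [← key]
  simp only [F]
  ring

/-! ## Formal solution of the isometric embedding equations -/

/-- The metric induced by a polynomial map with components `Y` and `Z`. -/
def polyMetric {n m : ℕ} (Y : Fin n → MvPolynomial (Fin n) ℝ) (Z : Fin m → MvPolynomial (Fin n) ℝ)
    (i j : Fin n) : MvPolynomial (Fin n) ℝ :=
  ∑ k, pderiv i (Y k) * pderiv j (Y k) + ∑ a, pderiv i (Z a) * pderiv j (Z a)

/-- The linear forms `∑ h_{ij} x_j`. -/
def linForm {n : ℕ} (h : Matrix (Fin n) (Fin n) ℝ) (i : Fin n) : MvPolynomial (Fin n) ℝ :=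
  ∑ j, C (h i j) * X j

theorem linForm_mem {n : ℕ} (h : Matrix (Fin n) (Fin n) ℝ) (i : Fin n) :
    linForm h i ∈ orderIdeal n 1 :=
  Submodule.sum_mem _ fun j _ => Ideal.mul_mem_left _ _ (X_mem_orderIdeal j)

theorem pderiv_linForm {n : ℕ} (h : Matrix (Fin n) (Fin n) ℝ) (i j : Fin n) :
    pderiv j (linForm h i) = C (h i j) := by
  simp [linForm, pderiv_X, Pi.single_apply]

theorem sum_C_mul_pderiv_of_transpose_mul_eq_one {n : ℕ} {L M : Matrix (Fin n) (Fin n) ℝ}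
    (hLM : Lᵀ * M = 1) (v : Fin n → MvPolynomial (Fin n) ℝ) (i j : Fin n) :
    ∑ k, C (L k i) * pderiv j (∑ l, C (M k l) * v l) = pderiv j (v i) := by
  have h1 : ∀ l, ∑ k, C (L k i) * (C (M k l) * pderiv j (v l))
      = C ((1 : Matrix (Fin n) (Fin n) ℝ) i l) * pderiv j (v l) := by
    intro l
    rw [← hLM, Matrix.mul_apply, map_sum, Finset.sum_mul]
    exact Finset.sum_congr rfl fun k _ => by rw [Matrix.transpose_apply, map_mul]; ring
  simp only [map_sum, pderiv_C_mul, Finset.mul_sum]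
  rw [Finset.sum_comm]
  simp only [h1, Matrix.one_apply]
  simp

/-- To leading order ∂Y = L and ∂_i Z_a = h^a_{ik} x_k. With z = -u/2, the product rule writes the
change due to z as the symmetrized gradient of h^a_{ik} x_k z_a plus h^a_{ij} u_a. Subtracting the
former from w before applying M leaves exactly the required strain. The quadratic term ∂z ∂z has
order 2(d - 1), which reaches d + 1 only when d ≥ 3. -/
theorem polyMetric_perturb {n m d : ℕ} (hd : 3 ≤ d) {L M : Matrix (Fin n) (Fin n) ℝ}
    (hLM : Lᵀ * M = 1) {h : Fin m → Matrix (Fin n) (Fin n) ℝ} (hs : ∀ a, (h a).IsSymm)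
    {Y : Fin n → MvPolynomial (Fin n) ℝ} {Z : Fin m → MvPolynomial (Fin n) ℝ}
    (hY : ∀ k i, pderiv i (Y k) - C (L k i) ∈ orderIdeal n 1)
    (hZ : ∀ a i, pderiv i (Z a) - linForm (h a) i ∈ orderIdeal n 2)
    {w : Fin n → MvPolynomial (Fin n) ℝ} {u : Fin m → MvPolynomial (Fin n) ℝ}
    (hw : ∀ j, w j ∈ orderIdeal n (d + 1)) (hu : ∀ a, u a ∈ orderIdeal n d) :
    ∃ T : Fin n → MvPolynomial (Fin n) ℝ, (∀ k, T k ∈ orderIdeal n (d + 1)) ∧ ∀ i j,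
      polyMetric (Y + T) (fun a => Z a - C (1 / 2) * u a) i j - polyMetric Y Z i j
        - (pderiv i (w j) + pderiv j (w i) + ∑ a, C (h a i j) * u a) ∈ orderIdeal n (d + 1) := by
  let z : Fin m → MvPolynomial (Fin n) ℝ := fun a => -(C (1 / 2) * u a)
  let v : Fin n → MvPolynomial (Fin n) ℝ := fun i => w i - ∑ a, linForm (h a) i * z a
  let T : Fin n → MvPolynomial (Fin n) ℝ := fun k => ∑ l, C (M k l) * v l
  have hz : ∀ a, z a ∈ orderIdeal n d := fun a => by
    exact Submodule.neg_mem _ (Ideal.mul_mem_left _ _ (hu a))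
  have hv : ∀ i, v i ∈ orderIdeal n (d + 1) := fun i =>
    Submodule.sub_mem _ (hw i) (Submodule.sum_mem _ fun a _ => by
      rw [add_comm d 1]; exact mul_mem_orderIdeal (linForm_mem _ i) (hz a))
  have hT : ∀ k, T k ∈ orderIdeal n (d + 1) := fun k =>
    Submodule.sum_mem _ fun l _ => Ideal.mul_mem_left _ _ (hv l)
  have hdT : ∀ k i, pderiv i (T k) ∈ orderIdeal n d := fun k i => pderiv_mem_orderIdeal i (hT k)
  have hdz : ∀ a i, pderiv i (z a) ∈ orderIdeal n (d - 1) := fun a i =>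
    pderiv_mem_orderIdeal_pred i (hz a)
  have hvd : ∀ i j, pderiv j (v i) = pderiv j (w i)
      - ∑ a, (C (h a i j) * z a + linForm (h a) i * pderiv j (z a)) := by
    intro i j
    simp only [v, map_sub, map_sum, pderiv_mul, pderiv_linForm]
  refine ⟨T, hT, fun i j => ?_⟩
  have e1 := sum_C_mul_pderiv_of_transpose_mul_eq_one hLM v i j
  have e2 := sum_C_mul_pderiv_of_transpose_mul_eq_one hLM v j i
  have key : polyMetric (Y + T) (fun a => Z a - C (1 / 2) * u a) i j - polyMetric Y Z i j
        - (pderiv i (w j) + pderiv j (w i) + ∑ a, C (h a i j) * u a)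
      = ∑ k, ((pderiv i (Y k) - C (L k i)) * pderiv j (T k)
          + pderiv i (T k) * (pderiv j (Y k) - C (L k j)) + pderiv i (T k) * pderiv j (T k))
        + ∑ a, ((pderiv i (Z a) - linForm (h a) i) * pderiv j (z a)
          + pderiv i (z a) * (pderiv j (Z a) - linForm (h a) j)
          + pderiv i (z a) * pderiv j (z a)) := by
    have e3 : ∑ k, (pderiv i (Y k + T k) * pderiv j (Y k + T k)
          - pderiv i (Y k) * pderiv j (Y k))
        = ∑ k, ((pderiv i (Y k) - C (L k i)) * pderiv j (T k)
          + pderiv i (T k) * (pderiv j (Y k) - C (L k j)) + pderiv i (T k) * pderiv j (T k))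
          + (∑ k, C (L k i) * pderiv j (T k) + ∑ k, C (L k j) * pderiv i (T k)) := by
      rw [← Finset.sum_add_distrib, ← Finset.sum_add_distrib]
      refine Finset.sum_congr rfl fun k _ => ?_
      simp only [map_add]; ring
    have e4 : ∑ a, (pderiv i (Z a + z a) * pderiv j (Z a + z a)
          - pderiv i (Z a) * pderiv j (Z a))
        = ∑ a, ((pderiv i (Z a) - linForm (h a) i) * pderiv j (z a)
          + pderiv i (z a) * (pderiv j (Z a) - linForm (h a) j)
          + pderiv i (z a) * pderiv j (z a))
          + (∑ a, (C (h a i j) * z a + linForm (h a) i * pderiv j (z a))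
            + ∑ a, (C (h a j i) * z a + linForm (h a) j * pderiv i (z a))
            + ∑ a, C (h a i j) * u a) := by
      rw [← Finset.sum_add_distrib, ← Finset.sum_add_distrib, ← Finset.sum_add_distrib]
      refine Finset.sum_congr rfl fun a _ => ?_
      have hzu : u a = -(2 * z a) := by
        have : (2 : MvPolynomial (Fin n) ℝ) * C (1 / 2) = 1 := by
          rw [← map_ofNat (C : ℝ →+* MvPolynomial (Fin n) ℝ) 2, ← map_mul]; norm_num
        simp only [z]
        rw [mul_neg, neg_neg, ← mul_assoc, this, one_mul]
      rw [(hs a).apply i j, hzu]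
      simp only [map_add]; ring
    have e5 : ∀ a, Z a - C (1 / 2) * u a = Z a + z a := fun a => by simp only [z]; ring
    simp only [polyMetric, Pi.add_apply, e5]
    rw [Finset.sum_sub_distrib] at e3 e4
    have e1' := e1.trans (hvd i j)
    have e2' := e2.trans (hvd j i)
    change ∑ k, C (L k i) * pderiv j (T k) = _ at e1'
    change ∑ k, C (L k j) * pderiv i (T k) = _ at e2'
    rw [e1', e2'] at e3
    linear_combination e3 + e4
  rw [key]
  have h1 : d + 1 ≤ d - 1 + 2 := by omega
  have h2 : d + 1 ≤ d - 1 + (d - 1) := by omega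
  refine Submodule.add_mem _ (Submodule.sum_mem _ fun k _ => ?_) (Submodule.sum_mem _ fun a _ => ?_)
  · refine Submodule.add_mem _ (Submodule.add_mem _ ?_ ?_) ?_
    · rw [add_comm d 1]; exact mul_mem_orderIdeal (hY k i) (hdT k j)
    · exact mul_mem_orderIdeal (hdT k i) (hY k j)
    · exact orderIdeal_anti (by omega) (mul_mem_orderIdeal (hdT k i) (hdT k j))
  · refine Submodule.add_mem _ (Submodule.add_mem _ ?_ ?_) ?_
    · exact orderIdeal_anti (by omega) (mul_mem_orderIdeal (hZ a i) (hdz a j))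
    · exact orderIdeal_anti h1 (mul_mem_orderIdeal (hdz a i) (hZ a j))
    · exact orderIdeal_anti h2 (mul_mem_orderIdeal (hdz a i) (hdz a j))

theorem mem_orderIdeal_succ_iff {n d : ℕ} {p : MvPolynomial (Fin n) ℝ} :
    p ∈ orderIdeal n (d + 1) ↔ constantCoeff p = 0 ∧ ∀ i, pderiv i p ∈ orderIdeal n d := by
  refine ⟨fun h => ⟨?_, fun i => pderiv_mem_orderIdeal i h⟩, fun ⟨h0, h⟩ => ?_⟩
  · rw [← eval_zero]; exact eval_zero_of_mem_orderIdeal h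
  · rw [orderIdeal, mem_pow_idealOfVars_iff']
    intro x hx
    by_cases hx0 : x = 0
    · rw [hx0, ← constantCoeff_eq, h0]
    · obtain ⟨i, hi⟩ : ∃ i, x i ≠ 0 := by
        by_contra hc; push Not at hc; exact hx0 (Finsupp.ext hc)
      have hxi : x - Finsupp.single i 1 + Finsupp.single i 1 = x := by
        ext j
        by_cases hj : i = j
        · subst hj; simp; omega
        · simp [hj]
      have h1 := h i
      rw [orderIdeal, mem_pow_idealOfVars_iff'] at h1
      have hdeg : x.degree = (x - Finsupp.single i 1).degree + 1 := by
        conv_lhs => rw [← hxi]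
        simp [Finsupp.degree_single]
      have h2 := h1 (x - Finsupp.single i 1) (by omega)
      rw [coeff_pderiv, hxi] at h2
      exact (mul_eq_zero.1 h2).resolve_right (by positivity)

theorem mem_orderIdeal_one_iff {n : ℕ} {p : MvPolynomial (Fin n) ℝ} :
    p ∈ orderIdeal n 1 ↔ constantCoeff p = 0 := by
  rw [show (1 : ℕ) = 0 + 1 from rfl, mem_orderIdeal_succ_iff]
  simp [orderIdeal]

theorem constantCoeff_pderiv_cubic {n : ℕ} (c : Fin n → Fin n → Fin n → ℝ) (r s t : Fin n) :
    constantCoeff (pderiv r (pderiv s (pderiv t (∑ j, ∑ k, ∑ l, C (c j k l) * (X j * X k * X l)))))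
      = c r s t + c r t s + c s r t + c s t r + c t r s + c t s r := by
  have e : ∀ j k l, constantCoeff (pderiv r (pderiv s (pderiv t
      (C (c j k l) * (X j * X k * X l : MvPolynomial (Fin n) ℝ))))) = c j k l *
      ((Pi.single j 1 : Fin n → ℝ) t * (Pi.single k 1 : Fin n → ℝ) s * (Pi.single l 1 : Fin n → ℝ) r
      + (Pi.single j 1 : Fin n → ℝ) t * (Pi.single k 1 : Fin n → ℝ) r * (Pi.single l 1 : Fin n → ℝ) s
      + (Pi.single j 1 : Fin n → ℝ) s * (Pi.single k 1 : Fin n → ℝ) t * (Pi.single l 1 : Fin n → ℝ) r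
      + (Pi.single j 1 : Fin n → ℝ) r * (Pi.single k 1 : Fin n → ℝ) t * (Pi.single l 1 : Fin n → ℝ) s
      + (Pi.single j 1 : Fin n → ℝ) s * (Pi.single k 1 : Fin n → ℝ) r * (Pi.single l 1 : Fin n → ℝ) t
      + (Pi.single j 1 : Fin n → ℝ) r * (Pi.single k 1 : Fin n → ℝ) s * (Pi.single l 1 : Fin n → ℝ) t)
      := by
    intro j k l
    have hX : ∀ a b : Fin n, pderiv a (X b : MvPolynomial (Fin n) ℝ)
        = C ((Pi.single b 1 : Fin n → ℝ) a) := by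
      intro a b
      rw [pderiv_X]
      by_cases h : a = b
      · subst h; simp
      · simp [h, Ne.symm h]
    simp only [pderiv_mul, hX, map_add, map_mul, constantCoeff_C, pderiv_C,
      zero_mul, mul_zero, add_zero, zero_add]
    ring
  simp only [map_sum, e, mul_add, Finset.sum_add_distrib]
  simp [Pi.single_apply]
  ring

/-- The quadratic form `½ ∑ h_{ij} x_i x_j`. -/
def quadForm {n : ℕ} (h : Matrix (Fin n) (Fin n) ℝ) : MvPolynomial (Fin n) ℝ :=
  C (1 / 2) * ∑ i, X i * linForm h i

theorem pderiv_quadForm {n : ℕ} {h : Matrix (Fin n) (Fin n) ℝ} (hs : h.IsSymm) (i : Fin n) :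
    pderiv i (quadForm h) = linForm h i := by
  have h1 : ∑ j, (X j * C (h j i) : MvPolynomial (Fin n) ℝ) = linForm h i :=
    Finset.sum_congr rfl fun j _ => by rw [hs.apply i j, mul_comm]
  have h2 : (C (1 / 2) : MvPolynomial (Fin n) ℝ) * 2 = 1 := by
    rw [← map_ofNat (C : ℝ →+* MvPolynomial (Fin n) ℝ) 2, ← map_mul]; norm_num
  simp only [quadForm, map_sum, pderiv_mul, pderiv_C, zero_mul, zero_add, pderiv_linForm,
    Finset.sum_add_distrib, pderiv_X, Pi.single_apply, h1]
  simp only [ite_mul, one_mul, zero_mul, Finset.sum_ite_eq', Finset.mem_univ, if_true]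
  linear_combination linForm h i * h2

/-- A metric with vanishing first derivatives whose second derivatives satisfy the Gauss equations
is induced up to second order by a quadratic map. -/
theorem exists_polyMetric_order_two {n m : ℕ} {L M : Matrix (Fin n) (Fin n) ℝ}
    (hLM : Lᵀ * M = 1) {h : Fin m → Matrix (Fin n) (Fin n) ℝ} (hs : ∀ a, (h a).IsSymm)
    {p : Fin n → Fin n → MvPolynomial (Fin n) ℝ} (hp : ∀ i j, p i j = p j i)
    (hp0 : ∀ i j, constantCoeff (p i j) = (Lᵀ * L) i j)
    (hp1 : ∀ i j k, constantCoeff (pderiv k (p i j)) = 0)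
    (hp2 : ∀ i j k l, constantCoeff (pderiv i (pderiv k (p j l)))
        + constantCoeff (pderiv j (pderiv l (p i k))) - constantCoeff (pderiv i (pderiv l (p j k)))
        - constantCoeff (pderiv j (pderiv k (p i l)))
      = -2 * ∑ a, (h a i k * h a j l - h a i l * h a j k)) :
    ∃ Y : Fin n → MvPolynomial (Fin n) ℝ, (∀ k, Y k - linForm L k ∈ orderIdeal n 3) ∧
      ∀ i j, p i j - polyMetric Y (fun a => quadForm (h a)) i j ∈ orderIdeal n 3 := by
  -- e is the Hessian of p minus that of the metric contributed by the quadratic forms; the cubic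
  -- part of Y must have a strain with these second derivatives.
  let e : Fin n → Fin n → Fin n → Fin n → ℝ := fun i j k l =>
    constantCoeff (pderiv k (pderiv l (p i j))) - ∑ a, (h a i k * h a j l + h a i l * h a j k)
  have esym1 : ∀ i j k l, e i j k l = e j i k l := fun i j k l => by
    simp only [e, hp i j]
    congr 1
    exact Finset.sum_congr rfl fun a _ => by ring
  have esym2 : ∀ i j k l, e i j k l = e i j l k := fun i j k l => by
    simp only [e, pderiv_pderiv_comm k l]
    congr 1
    exact Finset.sum_congr rfl fun a _ => by ring
  -- Saint-Venant compatibility of e. By the Gauss equations the products of h account for the whole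
  -- incompatibility of the Hessian of p.
  have esv : ∀ i j k l, e i j k l + e k l i j = e i l k j + e k j i l := by
    intro i j k l
    have h1 := hp2 k i l j
    have h2 : ∀ a, h a k l = h a l k := fun a => (hs a).apply l k
    have h3 : ∀ a, h a k i = h a i k := fun a => (hs a).apply i k
    have h4 : ∀ a, h a l i = h a i l := fun a => (hs a).apply i l
    have h5 : ∀ a, h a l j = h a j l := fun a => (hs a).apply j l
    have h6 : ∀ a, h a j i = h a i j := fun a => (hs a).apply i j
    have h7 : ∀ a, h a k j = h a j k := fun a => (hs a).apply j k
    have key : ∑ a, (h a i k * h a j l + h a i l * h a j k) + ∑ a, (h a k i * h a l j + h a k j * h a l i)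
        - ∑ a, (h a i k * h a l j + h a i j * h a l k) - ∑ a, (h a k i * h a j l + h a k l * h a j i)
        = -2 * ∑ a, (h a k l * h a i j - h a k j * h a i l) := by
      rw [← Finset.sum_add_distrib, ← Finset.sum_sub_distrib, ← Finset.sum_sub_distrib,
        Finset.mul_sum]
      refine Finset.sum_congr rfl fun a _ => ?_
      rw [h3, h4, h5, h6, h7, h2]; ring
    simp only [e]
    rw [pderiv_pderiv_comm i l] at h1
    rw [pderiv_pderiv_comm i j] at h1 ⊢
    rw [hp k j, pderiv_pderiv_comm i l]
    rw [hp k j] at h1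
    linarith
  -- A field with strain e has ∂_j ∂_k ∂_l v_i = ½ (e_{ijkl} + e_{ikjl} - e_{jkil}). Contraction
  -- with x_j x_k x_l / 6 merges the first two terms, giving the weights 1/6 and 1/12.
  let v : Fin n → MvPolynomial (Fin n) ℝ := fun i =>
    ∑ j, ∑ k, ∑ l, C (e i j k l / 6 - e j k i l / 12) * (X j * X k * X l)
  have hvm : ∀ i, v i ∈ orderIdeal n 3 := fun i =>
    Submodule.sum_mem _ fun j _ => Submodule.sum_mem _ fun k _ => Submodule.sum_mem _ fun l _ =>
      Ideal.mul_mem_left _ _ (mul_mem_orderIdeal (d := 2) (mul_mem_orderIdeal (d := 1)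
        (X_mem_orderIdeal j) (X_mem_orderIdeal k)) (X_mem_orderIdeal l))
  let T : Fin n → MvPolynomial (Fin n) ℝ := fun k => ∑ l, C (M k l) * v l
  have hT : ∀ k, T k ∈ orderIdeal n 3 := fun k =>
    Submodule.sum_mem _ fun l _ => Ideal.mul_mem_left _ _ (hvm l)
  have hdT : ∀ k i, pderiv i (T k) ∈ orderIdeal n 2 := fun k i => pderiv_mem_orderIdeal i (hT k)
  refine ⟨fun k => linForm L k + T k, fun k => by rw [add_sub_cancel_left]; exact hT k,
    fun i j => ?_⟩
  let r : MvPolynomial (Fin n) ℝ := p i j - C ((Lᵀ * L) i j)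
    - (pderiv i (v j) + pderiv j (v i)) - ∑ a, linForm (h a) i * linForm (h a) j
  have hr : r ∈ orderIdeal n 3 := by
    have hvi : ∀ i j, pderiv i (v j) ∈ orderIdeal n 2 := fun i j =>
      pderiv_mem_orderIdeal i (hvm j)
    rw [show (3 : ℕ) = 2 + 1 from rfl, mem_orderIdeal_succ_iff]
    refine ⟨?_, fun s => ?_⟩
    · have h1 : ∀ i j, constantCoeff (pderiv i (v j)) = 0 := fun i j =>
        (mem_orderIdeal_succ_iff.1 (hvi i j)).1
      simp [r, hp0, h1, linForm]
    rw [show (2 : ℕ) = 1 + 1 from rfl, mem_orderIdeal_succ_iff]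
    refine ⟨?_, fun t => ?_⟩
    · have h1 : ∀ i j s, constantCoeff (pderiv s (pderiv i (v j))) = 0 := fun i j s =>
        (mem_orderIdeal_succ_iff.1 (pderiv_mem_orderIdeal s (hvi i j))).1
      simp [r, hp1, h1, linForm]
    rw [mem_orderIdeal_one_iff]
    have hq : constantCoeff (pderiv t (pderiv s (∑ a, linForm (h a) i * linForm (h a) j)))
        = ∑ a, (h a i s * h a j t + h a i t * h a j s) := by
      simp only [map_sum, pderiv_mul, pderiv_linForm, map_add, map_mul, pderiv_C, constantCoeff_C,
        zero_mul, mul_zero, zero_add, add_zero]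
    have hv3 : constantCoeff (pderiv t (pderiv s (pderiv i (v j))))
          + constantCoeff (pderiv t (pderiv s (pderiv j (v i)))) = e i j t s := by
      simp only [v, constantCoeff_pderiv_cubic]
      linarith [esv i j s t, esv i j t s, esym1 i j s t, esym1 i j t s, esym2 i j s t,
        esym1 s t i j, esym2 s t i j, esym1 t s i j, esym2 t s i j,
        esym1 i s j t, esym2 i s j t, esym1 s i t j, esym1 s i j t,
        esym1 i t j s, esym2 i t j s, esym1 t i s j, esym1 t i j s,
        esym1 j s i t, esym2 j s i t, esym1 s j t i, esym1 s j i t,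
        esym1 j t i s, esym2 j t i s, esym1 t j s i, esym1 t j i s,
        esym1 j i t s, esym1 j i s t, esym2 j i s t]
    have hr' : constantCoeff (pderiv t (pderiv s r)) = constantCoeff (pderiv t (pderiv s (p i j)))
        - e i j t s - ∑ a, (h a i s * h a j t + h a i t * h a j s) := by
      rw [← hq, ← hv3]
      simp only [r, map_sub, map_add, pderiv_C, map_zero]
      ring
    rw [hr']
    simp only [e]
    have hc : ∑ a, (h a i t * h a j s + h a i s * h a j t)
        = ∑ a, (h a i s * h a j t + h a i t * h a j s) :=
      Finset.sum_congr rfl fun a _ => add_comm _ _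
    rw [hc]
    ring
  have key : p i j - polyMetric (fun k => linForm L k + T k) (fun a => quadForm (h a)) i j
      = r - ∑ k, pderiv i (T k) * pderiv j (T k) := by
    have e1 : ∑ k, C (L k i) * pderiv j (T k) = pderiv j (v i) :=
      sum_C_mul_pderiv_of_transpose_mul_eq_one hLM v i j
    have e2 : ∑ k, C (L k j) * pderiv i (T k) = pderiv i (v j) :=
      sum_C_mul_pderiv_of_transpose_mul_eq_one hLM v j i
    have e3 : ∑ k, (C (L k i) * C (L k j) : MvPolynomial (Fin n) ℝ) = C ((Lᵀ * L) i j) := by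
      simp [Matrix.mul_apply, map_sum]
    have e4 : ∑ k, (pderiv i (linForm L k + T k) * pderiv j (linForm L k + T k))
        = ∑ k, (C (L k i) * C (L k j) : MvPolynomial (Fin n) ℝ) + ∑ k, C (L k i) * pderiv j (T k)
          + ∑ k, C (L k j) * pderiv i (T k) + ∑ k, pderiv i (T k) * pderiv j (T k) := by
      simp only [← Finset.sum_add_distrib]
      refine Finset.sum_congr rfl fun k _ => ?_
      rw [map_add, map_add, pderiv_linForm, pderiv_linForm]; ring
    simp only [polyMetric, pderiv_quadForm (hs _), r]
    rw [e4, e1, e2, e3]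
    ring
  rw [key]
  refine Submodule.sub_mem _ hr (Submodule.sum_mem _ fun k _ => ?_)
  exact orderIdeal_anti (by omega) (mul_mem_orderIdeal (hdT k i) (hdT k j))

theorem polyMetric_comm {n m : ℕ} (Y : Fin n → MvPolynomial (Fin n) ℝ)
    (Z : Fin m → MvPolynomial (Fin n) ℝ) (i j : Fin n) :
    polyMetric Y Z i j = polyMetric Y Z j i := by
  simp [polyMetric, mul_comm]

theorem pderiv_sub_C_mem {n : ℕ} {L : Matrix (Fin n) (Fin n) ℝ}
    {Y : Fin n → MvPolynomial (Fin n) ℝ} (hY : ∀ k, Y k - linForm L k ∈ orderIdeal n 2)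
    (k i : Fin n) : pderiv i (Y k) - C (L k i) ∈ orderIdeal n 1 := by
  have := pderiv_mem_orderIdeal (d := 1) i (hY k)
  rwa [map_sub, pderiv_linForm] at this

theorem pderiv_sub_linForm_mem {n m : ℕ} {h : Fin m → Matrix (Fin n) (Fin n) ℝ}
    (hs : ∀ a, (h a).IsSymm) {Z : Fin m → MvPolynomial (Fin n) ℝ}
    (hZ : ∀ a, Z a - quadForm (h a) ∈ orderIdeal n 3)
    (a : Fin m) (i : Fin n) : pderiv i (Z a) - linForm (h a) i ∈ orderIdeal n 2 := by
  have := pderiv_mem_orderIdeal (d := 2) i (hZ a)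
  rwa [map_sub, pderiv_quadForm (hs a)] at this

/-- One correction step: the residual is split by `exists_strain` and cancelled to leading order by
`polyMetric_perturb`. The change of Z has order d, so the terms of Z below order d are never
touched. -/
theorem IsRegularPair.exists_improve {n m d : ℕ} (hd : 3 ≤ d)
    {A : Fin n → Matrix (Fin n) (Fin n) ℝ} {h : Fin m → Matrix (Fin n) (Fin n) ℝ}
    (H : IsRegularPair A h) {L M : Matrix (Fin n) (Fin n) ℝ} (hLM : Lᵀ * M = 1)
    {p : Fin n → Fin n → MvPolynomial (Fin n) ℝ} (hp : ∀ i j, p i j = p j i)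
    {Y : Fin n → MvPolynomial (Fin n) ℝ} {Z : Fin m → MvPolynomial (Fin n) ℝ}
    (hY : ∀ k, Y k - linForm L k ∈ orderIdeal n 2)
    (hZ : ∀ a, Z a - quadForm (h a) ∈ orderIdeal n 3)
    (hE : ∀ i j, p i j - polyMetric Y Z i j ∈ orderIdeal n d) :
    ∃ (Y' : Fin n → MvPolynomial (Fin n) ℝ) (Z' : Fin m → MvPolynomial (Fin n) ℝ),
      (∀ k, Y' k - linForm L k ∈ orderIdeal n 2) ∧ (∀ a, Z' a - Z a ∈ orderIdeal n d) ∧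
      ∀ i j, p i j - polyMetric Y' Z' i j ∈ orderIdeal n (d + 1) := by
  obtain ⟨w, u, hw, hu, hwu⟩ := H.exists_strain (d := d) (fun i j => p i j - polyMetric Y Z i j)
    (fun i j => by rw [hp i j, polyMetric_comm]) hE
  obtain ⟨T, hT, hG⟩ := polyMetric_perturb hd hLM H.h_symm (pderiv_sub_C_mem hY)
    (pderiv_sub_linForm_mem H.h_symm hZ) hw hu
  refine ⟨Y + T, fun a => Z a - C (1 / 2) * u a, fun k => ?_, fun a => ?_, fun i j => ?_⟩
  · rw [Pi.add_apply, add_sub_right_comm]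
    exact Submodule.add_mem _ (hY k) (orderIdeal_anti (by omega) (hT k))
  · rw [sub_sub_cancel_left]
    exact Submodule.neg_mem _ (Ideal.mul_mem_left _ _ (hu a))
  · have := Submodule.neg_mem _ (hG i j)
    rw [← hwu i j] at this
    convert this using 1
    ring

/-- Formal solution of the isometric embedding equations to any order, with a one-parameter family
of third order terms. -/
theorem IsRegularPair.exists_polyMetric_agree {n m : ℕ} {A : Fin n → Matrix (Fin n) (Fin n) ℝ}
    {h : Fin m → Matrix (Fin n) (Fin n) ℝ} (H : IsRegularPair A h)
    {v : Fin n → MvPolynomial (Fin n) ℝ} {u : Fin m → MvPolynomial (Fin n) ℝ}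
    (hv : ∀ j, v j ∈ orderIdeal n 4) (hu : ∀ a, u a ∈ orderIdeal n 3)
    (hvu : ∀ i j, pderiv i (v j) + pderiv j (v i) = ∑ a, C (h a i j) * u a)
    {L M : Matrix (Fin n) (Fin n) ℝ} (hLM : Lᵀ * M = 1)
    {p : Fin n → Fin n → MvPolynomial (Fin n) ℝ} (hp : ∀ i j, p i j = p j i)
    (hp0 : ∀ i j, constantCoeff (p i j) = (Lᵀ * L) i j)
    (hp1 : ∀ i j k, constantCoeff (pderiv k (p i j)) = 0)
    (hp2 : ∀ i j k l, constantCoeff (pderiv i (pderiv k (p j l)))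
        + constantCoeff (pderiv j (pderiv l (p i k))) - constantCoeff (pderiv i (pderiv l (p j k)))
        - constantCoeff (pderiv j (pderiv k (p i l)))
      = -2 * ∑ a, (h a i k * h a j l - h a i l * h a j k)) :
    ∃ Z₃ : Fin m → MvPolynomial (Fin n) ℝ, (∀ a, Z₃ a ∈ orderIdeal n 3) ∧ ∀ (t : ℝ) (β : ℕ),
      ∃ (Y : Fin n → MvPolynomial (Fin n) ℝ) (Z : Fin m → MvPolynomial (Fin n) ℝ),
        (∀ k, Y k - linForm L k ∈ orderIdeal n 2) ∧
        (∀ a, Z a - (quadForm (h a) + Z₃ a + C t * u a) ∈ orderIdeal n 4) ∧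
        ∀ i j, p i j - polyMetric Y Z i j ∈ orderIdeal n (β + 4) := by
  obtain ⟨Y₀, hY₀, hE₀⟩ := exists_polyMetric_order_two hLM H.h_symm hp hp0 hp1 hp2
  have hY₀' : ∀ k, Y₀ k - linForm L k ∈ orderIdeal n 2 := fun k =>
    orderIdeal_anti (by omega) (hY₀ k)
  -- The step of order three is taken before t enters, so that the cubic terms `Z₃` depend neither
  -- on t nor on β.
  obtain ⟨Y₁, Z₁, hY₁, hZ₁, hE₁⟩ := H.exists_improve le_rfl hLM hp hY₀'
    (fun a => by rw [sub_self]; exact Submodule.zero_mem _) hE₀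
  refine ⟨fun a => Z₁ a - quadForm (h a), hZ₁, fun t β => ?_⟩
  have hmul : ∀ (c : ℝ) {d : ℕ} {q : MvPolynomial (Fin n) ℝ}, q ∈ orderIdeal n d →
      C c * q ∈ orderIdeal n d := fun c d q hq => Ideal.mul_mem_left _ _ hq
  -- The strain of v equals h^a u_a, so the pair (2 t v, -2 t u) has no effect on the metric to
  -- leading order. It shifts Z by t u at the cost of an error of order four, and later corrections
  -- change Z only from order four on.
  obtain ⟨T, hT, hG⟩ := polyMetric_perturb le_rfl hLM H.h_symm (pderiv_sub_C_mem hY₁)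
    (pderiv_sub_linForm_mem H.h_symm hZ₁) (w := fun j => C (2 * t) * v j)
    (u := fun a => C (-2 * t) * u a) (fun j => hmul _ (hv j)) (fun a => hmul _ (hu a))
  have hC : ∀ a, Z₁ a - C (1 / 2) * (C (-2 * t) * u a) = Z₁ a + C t * u a := fun a => by
    rw [← mul_assoc, ← map_mul, show (1 / 2 : ℝ) * (-2 * t) = -t by ring, map_neg]; ring
  simp only [hC] at hG
  induction β with
  | zero =>
    refine ⟨Y₁ + T, fun a => Z₁ a + C t * u a, fun k => ?_, fun a => ?_, fun i j => ?_⟩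
    · rw [Pi.add_apply, add_sub_right_comm]
      exact Submodule.add_mem _ (hY₁ k) (orderIdeal_anti (by omega) (hT k))
    · simp
    · have h1 := hG i j
      have h2 : pderiv i (C (2 * t) * v j) + pderiv j (C (2 * t) * v i)
          + ∑ a, C (h a i j) * (C (-2 * t) * u a) = 0 := by
        rw [pderiv_C_mul, pderiv_C_mul, ← mul_add, hvu, Finset.mul_sum, ← Finset.sum_add_distrib]
        refine Finset.sum_eq_zero fun a _ => ?_
        rw [neg_mul, map_neg]; ring
      rw [h2, sub_zero] at h1
      have := Submodule.sub_mem _ (hE₁ i j) h1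
      convert this using 1
      ring
  | succ β ih =>
    obtain ⟨Y, Z, hY, hZ, hE⟩ := ih
    obtain ⟨Y', Z', hY', hZ', hE'⟩ := H.exists_improve (d := β + 4) (by omega) hLM hp hY
      (fun a => by
        have h1 := Submodule.add_mem _ (Submodule.add_mem _ (orderIdeal_anti (d := 3) (by omega)
          (hZ a)) (hZ₁ a)) (hmul t (hu a))
        convert h1 using 1
        ring) hE
    refine ⟨Y', Z', hY', fun a => ?_, fun i j => ?_⟩
    · have := Submodule.add_mem _ (orderIdeal_anti (d := 4) (by omega) (hZ' a)) (hZ a)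
      convert this using 1
      ring
    · rw [show β + 1 + 4 = β + 4 + 1 by ring]; exact hE' i j

/-! ## Smooth families of matrices and annihilators -/

theorem contDiffOn_det {E ι : Type*} [NormedAddCommGroup E] [NormedSpace ℝ E] [Fintype ι]
    [DecidableEq ι] {k : WithTop ℕ∞} {M : E → Matrix ι ι ℝ} {Ω : Set E}
    (h : ∀ i j, ContDiffOn ℝ k (fun x => M x i j) Ω) : ContDiffOn ℝ k (fun x => (M x).det) Ω := by
  simp only [Matrix.det_apply]
  exact ContDiffOn.sum fun σ _ => (contDiffOn_prod fun i _ => h (σ i) i).const_smul _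

theorem contDiffOn_inv_apply {E ι : Type*} [NormedAddCommGroup E] [NormedSpace ℝ E] [Fintype ι]
    [DecidableEq ι] {k : WithTop ℕ∞} {M : E → Matrix ι ι ℝ} {Ω : Set E}
    (h : ∀ i j, ContDiffOn ℝ k (fun x => M x i j) Ω) (hd : ∀ x ∈ Ω, (M x).det ≠ 0) (i j : ι) :
    ContDiffOn ℝ k (fun x => (M x)⁻¹ i j) Ω := by
  simp only [Matrix.inv_def, Ring.inverse_eq_inv, Matrix.smul_apply, smul_eq_mul,
    Matrix.adjugate_apply]
  refine ((contDiffOn_det h).inv hd).mul (contDiffOn_det fun a b => ?_)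
  by_cases hab : a = j
  · subst hab
    simp only [Matrix.updateRow_self]
    exact contDiffOn_const
  · simp only [Matrix.updateRow_ne hab]
    exact h a b

theorem contDiffOn_pair {n : ℕ} {E : Type*} [NormedAddCommGroup E] [NormedSpace ℝ E]
    {k : WithTop ℕ∞} {M N : E → Matrix (Fin n) (Fin n) ℝ} {Ω : Set E}
    (hM : ∀ i j, ContDiffOn ℝ k (fun x => M x i j) Ω)
    (hN : ∀ i j, ContDiffOn ℝ k (fun x => N x i j) Ω) :
    ContDiffOn ℝ k (fun x => pair (M x) (N x)) Ω :=
  ContDiffOn.sum fun i _ => ContDiffOn.sum fun j _ => (hM i j).mul (hN i j)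

/-! ### Rules of calculus for coordinate derivatives -/

theorem pd_add {n : ℕ} {f g : (Fin n → ℝ) → ℝ} {x : Fin n → ℝ} (i : Fin n)
    (hf : DifferentiableAt ℝ f x) (hg : DifferentiableAt ℝ g x) :
    pd i (fun y => f y + g y) x = pd i f x + pd i g x := by
  rw [pd, fderiv_fun_add hf hg]; rfl

theorem pd_sub {n : ℕ} {f g : (Fin n → ℝ) → ℝ} {x : Fin n → ℝ} (i : Fin n)
    (hf : DifferentiableAt ℝ f x) (hg : DifferentiableAt ℝ g x) :
    pd i (fun y => f y - g y) x = pd i f x - pd i g x := by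
  rw [pd, fderiv_fun_sub hf hg]; rfl

theorem pd_mul {n : ℕ} {f g : (Fin n → ℝ) → ℝ} {x : Fin n → ℝ} (i : Fin n)
    (hf : DifferentiableAt ℝ f x) (hg : DifferentiableAt ℝ g x) :
    pd i (fun y => f y * g y) x = f x * pd i g x + pd i f x * g x := by
  rw [pd, fderiv_fun_mul hf hg]
  simp [pd, mul_comm]

theorem pd_sum {n : ℕ} {ι : Type*} {s : Finset ι} {f : ι → (Fin n → ℝ) → ℝ} {x : Fin n → ℝ}
    (i : Fin n) (hf : ∀ a ∈ s, DifferentiableAt ℝ (f a) x) :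
    pd i (fun y => ∑ a ∈ s, f a y) x = ∑ a ∈ s, pd i (f a) x := by
  rw [pd, fderiv_fun_sum hf]
  simp [pd]

@[simp] theorem pd_const {n : ℕ} (c : ℝ) (x : Fin n → ℝ) (i : Fin n) :
    pd i (fun _ => c) x = 0 := by
  simp [pd]

theorem pd_coord {n : ℕ} (x : Fin n → ℝ) (i j : Fin n) :
    pd i (fun y => y j) x = if j = i then 1 else 0 := by
  rw [pd, (hasFDerivAt_apply (𝕜 := ℝ) j x).fderiv]
  simp [Pi.single_apply]

theorem pd_congr {n : ℕ} {F : Type*} [NormedAddCommGroup F] [NormedSpace ℝ F]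
    {f g : (Fin n → ℝ) → F} {x : Fin n → ℝ} (h : f =ᶠ[𝓝 x] g) (i : Fin n) :
    pd i f x = pd i g x := by
  rw [pd, pd, h.fderiv_eq]

/-! ### Smooth extension of a basis of the annihilator -/

theorem eventually_linearIndependent {n : ℕ} {ι X : Type*} [Finite ι] [TopologicalSpace X]
    {M : X → ι → Matrix (Fin n) (Fin n) ℝ} {x₀ : X}
    (hM : ∀ k i j, ContinuousAt (fun x => M x k i j) x₀) (h : LinearIndependent ℝ (M x₀)) :
    ∀ᶠ x in 𝓝 x₀, LinearIndependent ℝ (M x) := by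
  have ho : IsOpen {f : ι → Fin n → Fin n → ℝ | LinearIndependent ℝ f} :=
    isOpen_setOfPred_linearIndependent
  have hc : ContinuousAt (fun x => (M x : ι → Fin n → Fin n → ℝ)) x₀ :=
    continuousAt_pi.2 fun k => continuousAt_pi.2 fun i => continuousAt_pi.2 fun j => hM k i j
  exact hc (ho.mem_nhds h)

/-- A basis of the annihilator at one point extends smoothly, with prescribed compatible first
derivatives and with full symmetry. -/
theorem IsRegularPair.exists_extension {n m : ℕ} {A : Fin n → Matrix (Fin n) (Fin n) ℝ}
    {h : Fin m → Matrix (Fin n) (Fin n) ℝ} (H : IsRegularPair A h)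
    {B : Fin n → Fin n → Matrix (Fin n) (Fin n) ℝ} (hB : ∀ l, IsSymmCubic (B l))
    {Ω : Set (Fin n → ℝ)} (hΩ : IsOpen Ω) (h0 : (0 : Fin n → ℝ) ∈ Ω)
    {F : Fin m → (Fin n → ℝ) → Matrix (Fin n) (Fin n) ℝ} (hF : ∀ a, SmoothMatOn (F a) Ω)
    (hF0 : ∀ a, F a 0 = h a)
    (hBF : ∀ l k a, pair (B l k) (h a) + pair (A k) (pdMat l (F a) 0) = 0) :
    ∃ (Ω' : Set (Fin n → ℝ)) (𝒜 : Fin n → (Fin n → ℝ) → Matrix (Fin n) (Fin n) ℝ),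
      IsOpen Ω' ∧ (0 : Fin n → ℝ) ∈ Ω' ∧ Ω' ⊆ Ω ∧ (∀ k, SmoothMatOn (𝒜 k) Ω') ∧
      (∀ k, 𝒜 k 0 = A k) ∧ (∀ l k, pdMat l (𝒜 k) 0 = B l k) ∧
      (∀ x, IsSymmCubic fun k => 𝒜 k x) ∧ (∀ x ∈ Ω', ∀ k a, pair (𝒜 k x) (F a x) = 0) ∧
      (∀ x ∈ Ω', LinearIndependent ℝ fun k => 𝒜 k x) ∧
      ∀ x ∈ Ω', LinearIndependent ℝ fun a => F a x := by
  classical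
  -- Symmetric cubic forms dual to the constraints: `N (k, a)` pairs to 1 with `h a` in slot k, and
  -- every other pairing is 0.
  choose N hNs hN using fun q : Fin n × Fin m => H.surjective (Pi.single q.1 (Pi.single q.2 1))
  -- The affine family α has the prescribed one-jet, and its defect ρ vanishes to first order at 0
  -- by `hBF`. As W 0 = 1, the solution s of W s = ρ also vanishes to first order, so correcting α
  -- by the forms N restores the constraints near 0 without disturbing the one-jet or the symmetry.
  let α : Fin n → (Fin n → ℝ) → Matrix (Fin n) (Fin n) ℝ := fun k x => A k + ∑ l, x l • B l k
  let W : (Fin n → ℝ) → Matrix (Fin n × Fin m) (Fin n × Fin m) ℝ := fun x =>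
    Matrix.of fun q r => pair (N r q.1) (F q.2 x)
  let ρ : (Fin n → ℝ) → Fin n × Fin m → ℝ := fun x q => pair (α q.1 x) (F q.2 x)
  let s : (Fin n → ℝ) → Fin n × Fin m → ℝ := fun x => (W x)⁻¹ *ᵥ ρ x
  let 𝒜 : Fin n → (Fin n → ℝ) → Matrix (Fin n) (Fin n) ℝ := fun k x =>
    α k x - ∑ r, s x r • N r k
  have hW0 : W 0 = 1 := by
    ext q r
    simp only [W, Matrix.of_apply, hF0, hN, Matrix.one_apply]
    by_cases h1 : q.1 = r.1
    · rw [h1, Pi.single_eq_same]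
      by_cases h2 : q.2 = r.2
      · rw [h2, Pi.single_eq_same, if_pos (Prod.ext h1 h2)]
      · rw [Pi.single_eq_of_ne h2, if_neg fun e => h2 (congrArg Prod.snd e)]
    · rw [Pi.single_eq_of_ne h1, Pi.zero_apply, if_neg fun e => h1 (congrArg Prod.fst e)]
  have hα : ∀ k, SmoothMatOn (α k) Ω := fun k i j => by
    have : (fun x => α k x i j) = fun x => A k i j + ∑ l, x l * B l k i j := by
      funext x; simp [α, Matrix.sum_apply]
    rw [this]
    exact contDiffOn_const.add (ContDiffOn.sum fun l _ =>
      ((contDiff_apply ℝ ℝ l).contDiffOn).mul contDiffOn_const)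
  have hWs : ∀ q r, ContDiffOn ℝ ∞ (fun x => W x q r) Ω := fun q r =>
    contDiffOn_pair (fun _ _ => contDiffOn_const) (hF q.2)
  have hρs : ∀ q, ContDiffOn ℝ ∞ (fun x => ρ x q) Ω := fun q => contDiffOn_pair (hα q.1) (hF q.2)
  let Ω₁ : Set (Fin n → ℝ) := Ω ∩ {x | (W x).det ≠ 0}
  have hΩ₁ : IsOpen Ω₁ :=
    (contDiffOn_det hWs).continuousOn.isOpen_inter_preimage hΩ isOpen_ne
  have h01 : (0 : Fin n → ℝ) ∈ Ω₁ := ⟨h0, by simp [hW0]⟩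
  have hs : ∀ r, ContDiffOn ℝ ∞ (fun x => s x r) Ω₁ := fun r =>
    ContDiffOn.sum fun q _ => (contDiffOn_inv_apply (fun q r => (hWs q r).mono inter_subset_left)
      (fun x hx => hx.2) r q).mul ((hρs q).mono inter_subset_left)
  have h𝒜s : ∀ k, SmoothMatOn (𝒜 k) Ω₁ := fun k i j => by
    have : (fun x => 𝒜 k x i j) = fun x => α k x i j - ∑ r, s x r * N r k i j := by
      funext x; simp [𝒜, Matrix.sum_apply]
    rw [this]
    exact ((hα k i j).mono inter_subset_left).sub (ContDiffOn.sum fun r _ =>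
      (hs r).mul contDiffOn_const)
  have hρ0 : ∀ q, ρ 0 q = 0 := fun q => by simp [ρ, α, hF0, H.pair_eq_zero]
  have hs0 : ∀ r, s 0 r = 0 := fun r => by
    simp only [s, Matrix.mulVec, dotProduct, hρ0, mul_zero, Finset.sum_const_zero]
  have hα0 : ∀ k, α k 0 = A k := fun k => by simp [α]
  have h𝒜0 : ∀ k, 𝒜 k 0 = A k := fun k => by simp [𝒜, hα0, hs0]
  have hdα : ∀ l k i j, pd l (fun x => α k x i j) 0 = B l k i j := by
    intro l k i j
    have : (fun x => α k x i j) = fun x => A k i j + ∑ l, x l * B l k i j := by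
      funext x; simp [α, Matrix.sum_apply]
    rw [this, pd_add _ (by fun_prop) (by fun_prop), pd_sum _ (fun _ _ => by fun_prop)]
    simp only [pd_const, zero_add]
    rw [Finset.sum_congr rfl fun a _ => pd_mul (f := fun y => y a) l (by fun_prop) (by fun_prop)]
    simp [pd_coord]
  have hdif : ∀ {f : (Fin n → ℝ) → ℝ} {Ω : Set (Fin n → ℝ)}, IsOpen Ω → (0 : Fin n → ℝ) ∈ Ω →
      ContDiffOn ℝ ∞ f Ω → DifferentiableAt ℝ f 0 := fun hΩ h0 hf =>
    (hf.contDiffAt (hΩ.mem_nhds h0)).differentiableAt (by simp)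
  have hdρ : ∀ l q, pd l (fun x => ρ x q) 0 = 0 := by
    intro l q
    have h1 : ∀ i j, DifferentiableAt ℝ (fun x => α q.1 x i j) 0 := fun i j =>
      hdif hΩ h0 (hα q.1 i j)
    have h2 : ∀ i j, DifferentiableAt ℝ (fun x => F q.2 x i j) 0 := fun i j =>
      hdif hΩ h0 (hF q.2 i j)
    simp only [ρ, pair]
    rw [pd_sum _ (fun i _ => DifferentiableAt.fun_sum fun j _ => (h1 i j).fun_mul (h2 i j))]
    rw [Finset.sum_congr rfl fun i _ => pd_sum _ (fun j _ => (h1 i j).fun_mul (h2 i j))]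
    rw [Finset.sum_congr rfl fun i _ => Finset.sum_congr rfl fun j _ => pd_mul l (h1 i j) (h2 i j)]
    have := hBF l q.1 q.2
    simp only [hdα, hα0, hF0]
    simp only [pair, pdMat, Matrix.of_apply] at this
    rw [← this]
    simp only [Finset.sum_add_distrib]
    ring
  have hds : ∀ l r, pd l (fun x => s x r) 0 = 0 := by
    intro l r
    have h1 : ∀ q, DifferentiableAt ℝ (fun x => (W x)⁻¹ r q) 0 := fun q =>
      hdif hΩ₁ h01 (contDiffOn_inv_apply (fun q r => (hWs q r).mono inter_subset_left)
        (fun x hx => hx.2) r q)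
    have h2 : ∀ q, DifferentiableAt ℝ (fun x => ρ x q) 0 := fun q => hdif hΩ h0 (hρs q)
    simp only [s, Matrix.mulVec, dotProduct]
    rw [pd_sum _ fun q _ => (h1 q).fun_mul (h2 q),
      Finset.sum_congr rfl fun q _ => pd_mul l (h1 q) (h2 q)]
    simp [hdρ, hρ0]
  have hd𝒜 : ∀ l k, pdMat l (𝒜 k) 0 = B l k := by
    intro l k
    ext i j
    have : (fun x => 𝒜 k x i j) = fun x => α k x i j - ∑ r, s x r * N r k i j := by
      funext x; simp [𝒜, Matrix.sum_apply]
    have h1 : ∀ r, DifferentiableAt ℝ (fun x => s x r) 0 := fun r => hdif hΩ₁ h01 (hs r)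
    rw [pdMat, Matrix.of_apply, this, pd_sub _ (hdif hΩ h0 (hα k i j))
      (DifferentiableAt.fun_sum fun r _ => (h1 r).mul_const _),
      pd_sum _ fun r _ => (h1 r).mul_const _,
      Finset.sum_congr rfl fun r _ => pd_mul l (h1 r) (differentiableAt_const _), hdα]
    simp [hds]
  have hsymm : ∀ x, IsSymmCubic fun k => 𝒜 k x := by
    intro x
    constructor
    · intro k i j
      simp only [𝒜, α, Matrix.sub_apply, Matrix.add_apply, Matrix.sum_apply, Matrix.smul_apply]
      exact congrArg₂ _ (congrArg₂ _ (H.A_symm.right k i j) (Finset.sum_congr rfl fun l _ =>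
        congrArg _ ((hB l).right k i j))) (Finset.sum_congr rfl fun r _ =>
        congrArg _ ((hNs r).right k i j))
    · intro k i j
      simp only [𝒜, α, Matrix.sub_apply, Matrix.add_apply, Matrix.sum_apply, Matrix.smul_apply]
      exact congrArg₂ _ (congrArg₂ _ (H.A_symm.left k i j) (Finset.sum_congr rfl fun l _ =>
        congrArg _ ((hB l).left k i j))) (Finset.sum_congr rfl fun r _ =>
        congrArg _ ((hNs r).left k i j))
  have hpair : ∀ x ∈ Ω₁, ∀ k a, pair (𝒜 k x) (F a x) = 0 := by
    intro x hx k a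
    have h1 : (W x *ᵥ s x) (k, a) = ρ x (k, a) := by
      simp only [s]
      rw [Matrix.mulVec_mulVec, Matrix.mul_nonsing_inv _ (isUnit_iff_ne_zero.2 hx.2),
        Matrix.one_mulVec]
    simp only [Matrix.mulVec, dotProduct, W, ρ, Matrix.of_apply] at h1
    have h2 : pair (𝒜 k x) (F a x) = pair (α k x) (F a x)
        - ∑ r, pair (N r k) (F a x) * s x r := by
      have : 𝒜 k x = α k x + ∑ r, (-s x r) • N r k := by
        simp only [𝒜, neg_smul, Finset.sum_neg_distrib, sub_eq_add_neg]
      rw [this, pair_add_left, pair_sum_left, sub_eq_add_neg, ← Finset.sum_neg_distrib]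
      congr 1
      exact Finset.sum_congr rfl fun r _ => by rw [pair_smul_left]; ring
    rw [h2, h1, sub_self]
  have hc : ∀ {f : (Fin n → ℝ) → ℝ} {Ω : Set (Fin n → ℝ)}, IsOpen Ω → (0 : Fin n → ℝ) ∈ Ω →
      ContDiffOn ℝ ∞ f Ω → ContinuousAt f 0 := fun hΩ h0 hf =>
    hf.continuousOn.continuousAt (hΩ.mem_nhds h0)
  have hev1 := eventually_linearIndependent (M := fun x k => 𝒜 k x) (x₀ := (0 : Fin n → ℝ))
    (fun k i j => hc hΩ₁ h01 (h𝒜s k i j)) (by simpa only [h𝒜0] using H.A_li)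
  have hev2 := eventually_linearIndependent (M := fun x a => F a x) (x₀ := (0 : Fin n → ℝ))
    (fun k i j => hc hΩ h0 (hF k i j)) (by simpa only [hF0] using H.h_li)
  obtain ⟨Ω₂, hsub, hΩ₂, h02⟩ := eventually_nhds_iff.1 (hev1.and hev2)
  exact ⟨Ω₁ ∩ Ω₂, 𝒜, hΩ₁.inter hΩ₂, ⟨h01, h02⟩, fun x hx => hx.1.1,
    fun k i j => (h𝒜s k i j).mono inter_subset_left, h𝒜0, hd𝒜, hsymm, fun x hx => hpair x hx.1,
    fun x hx => (hsub x hx.2).1, fun x hx => (hsub x hx.2).2⟩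

/-! ## Geometry of polynomial maps -/

/-- The polynomial map with coordinates `Y` and `Z`. -/
def polyMap {n m N : ℕ} (σ : Fin n ⊕ Fin m ≃ Fin N) (Y : Fin n → MvPolynomial (Fin n) ℝ)
    (Z : Fin m → MvPolynomial (Fin n) ℝ) (x : Fin n → ℝ) : Fin N → ℝ :=
  fun I => eval x (Sum.elim Y Z (σ.symm I))

section PolyMap

variable {n m N : ℕ} (σ : Fin n ⊕ Fin m ≃ Fin N) (Y : Fin n → MvPolynomial (Fin n) ℝ)
  (Z : Fin m → MvPolynomial (Fin n) ℝ)

@[simp] theorem polyMap_inl (x : Fin n → ℝ) (k : Fin n) :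
    polyMap σ Y Z x (σ (Sum.inl k)) = eval x (Y k) := by
  simp [polyMap]

@[simp] theorem polyMap_inr (x : Fin n → ℝ) (a : Fin m) :
    polyMap σ Y Z x (σ (Sum.inr a)) = eval x (Z a) := by
  simp [polyMap]

theorem contDiff_polyMap {k : WithTop ℕ∞} : ContDiff ℝ k (polyMap σ Y Z) :=
  contDiff_pi.2 fun _ => contDiff_eval _

theorem pd_polyMap (i : Fin n) : pd i (polyMap σ Y Z) =
    polyMap σ (fun k => pderiv i (Y k)) fun a => pderiv i (Z a) := by
  funext x I
  have hd : ∀ I, DifferentiableAt ℝ (fun x => polyMap σ Y Z x I) x := fun I =>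
    (contDiff_eval (k := 1) _).contDiffAt.differentiableAt one_ne_zero
  have h : pd i (polyMap σ Y Z) x I = pd i (fun x => polyMap σ Y Z x I) x := by
    rw [pd, pd, fderiv_pi hd]; rfl
  rw [h]
  unfold polyMap
  rw [pd_eval]
  rcases σ.symm I with k | a <;> rfl

theorem dotProduct_sum_equiv (f g : Fin N → ℝ) : f ⬝ᵥ g =
    ∑ k, f (σ (Sum.inl k)) * g (σ (Sum.inl k)) + ∑ a, f (σ (Sum.inr a)) * g (σ (Sum.inr a)) := by
  rw [dotProduct, ← σ.sum_comp, Fintype.sum_sum_type]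

theorem inducedMetric_polyMap (x : Fin n → ℝ) (i j : Fin n) :
    inducedMetric (polyMap σ Y Z) x i j = eval x (polyMetric Y Z i j) := by
  simp [inducedMetric, pd_polyMap, dotProduct_sum_equiv σ, polyMetric]

end PolyMap

/-! ### Christoffel symbols and second fundamental forms of polynomial maps -/

theorem contDiffOn_pd {n : ℕ} {f : (Fin n → ℝ) → ℝ} {Ω : Set (Fin n → ℝ)} (hΩ : IsOpen Ω)
    (hf : ContDiffOn ℝ ∞ f Ω) (i : Fin n) : ContDiffOn ℝ ∞ (pd i f) Ω :=
  (hf.fderiv_of_isOpen hΩ (by simp)).clm_apply contDiffOn_const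

theorem contDiffOn_christoffel {n : ℕ} {G : (Fin n → ℝ) → Matrix (Fin n) (Fin n) ℝ}
    {Ω : Set (Fin n → ℝ)} (hΩ : IsOpen Ω) (hG : SmoothMatOn G Ω)
    (hd : ∀ x ∈ Ω, (G x).det ≠ 0) (k i j : Fin n) : ContDiffOn ℝ ∞ (christoffel G k i j) Ω :=
  contDiffOn_const.mul (ContDiffOn.sum fun l _ => (contDiffOn_inv_apply hG hd k l).mul
    (((contDiffOn_pd hΩ (hG j l) i).add (contDiffOn_pd hΩ (hG i l) j)).sub
      (contDiffOn_pd hΩ (hG i j) l)))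

/-- Lowering the index removes the inverse metric, so the identity can be differentiated without
differentiating `(G x)⁻¹`. -/
theorem sum_christoffel_mul {n : ℕ} {G : (Fin n → ℝ) → Matrix (Fin n) (Fin n) ℝ}
    {x : Fin n → ℝ} (hd : (G x).det ≠ 0) (hs : (G x).IsSymm) (i j l : Fin n) :
    ∑ k, christoffel G k i j x * G x k l = (1 / 2) *
      (pd i (fun y => G y j l) x + pd j (fun y => G y i l) x - pd l (fun y => G y i j) x) := by
  simp only [christoffel, mul_assoc, ← Finset.mul_sum, Finset.sum_mul]
  rw [Finset.sum_comm]
  congr 1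
  have h1 : ∀ r, ∑ k, (G x)⁻¹ k r * G x k l = (1 : Matrix (Fin n) (Fin n) ℝ) r l := by
    intro r
    rw [← Matrix.nonsing_inv_mul (G x) (isUnit_iff_ne_zero.2 hd), Matrix.mul_apply]
    refine Finset.sum_congr rfl fun k _ => ?_
    have : ((G x)⁻¹)ᵀ = (G x)⁻¹ := by rw [Matrix.transpose_nonsing_inv, hs]
    rw [← this, Matrix.transpose_apply, this]
  rw [Finset.sum_eq_single l]
  · simp only [mul_comm _ (G x _ _), ← mul_assoc]
    rw [← Finset.sum_mul]
    simp only [mul_comm (G x _ _), h1]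
    simp
  · intro r _ hr
    simp only [mul_comm _ (G x _ _), ← mul_assoc]
    rw [← Finset.sum_mul]
    simp only [mul_comm (G x _ _), h1]
    simp [hr]
  · simp

theorem inducedMetric_isSymm {n N : ℕ} (y : (Fin n → ℝ) → (Fin N → ℝ)) (x : Fin n → ℝ) :
    (inducedMetric y x).IsSymm :=
  Matrix.IsSymm.ext fun i j => dotProduct_comm (pd j y x) (pd i y x)

/-- The matrices of normal components of the second fundamental form. -/
def normalFF {n m N : ℕ} (σ : Fin n ⊕ Fin m ≃ Fin N) (y : (Fin n → ℝ) → (Fin N → ℝ)) (a : Fin m)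
    (x : Fin n → ℝ) : Matrix (Fin n) (Fin n) ℝ :=
  Matrix.of fun i j => secondFF y i j x (σ (Sum.inr a))

section Normal

variable {n m N : ℕ} (σ : Fin n ⊕ Fin m ≃ Fin N) (Y : Fin n → MvPolynomial (Fin n) ℝ)
  (Z : Fin m → MvPolynomial (Fin n) ℝ)

/-- By the product rule, the combination of metric derivatives in the lowered Christoffel symbol is
exactly ∂²_{ij} y · ∂_l y. -/
theorem secondFF_dotProduct_pd {x : Fin n → ℝ}
    (hd : (inducedMetric (polyMap σ Y Z) x).det ≠ 0) (i j l : Fin n) :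
    secondFF (polyMap σ Y Z) i j x ⬝ᵥ pd l (polyMap σ Y Z) x = 0 := by
  have h1 := sum_christoffel_mul hd (inducedMetric_isSymm _ x) i j l
  have h2 : ∀ i j l, pd i (fun y => inducedMetric (polyMap σ Y Z) y j l) x =
      eval x (pderiv i (polyMetric Y Z j l)) := by
    intro i j l
    simp only [inducedMetric_polyMap, pd_eval]
  have h3 : secondFF (polyMap σ Y Z) i j x ⬝ᵥ pd l (polyMap σ Y Z) x =
      pd i (pd j (polyMap σ Y Z)) x ⬝ᵥ pd l (polyMap σ Y Z) x
      - ∑ k, christoffel (inducedMetric (polyMap σ Y Z)) k i j x *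
        inducedMetric (polyMap σ Y Z) x k l := by
    simp only [secondFF, sub_dotProduct, sum_dotProduct, smul_dotProduct, inducedMetric,
      Matrix.of_apply, smul_eq_mul]
  rw [h3, h1, h2, h2, h2]
  simp only [pd_polyMap, dotProduct_sum_equiv σ, polyMap_inl, polyMap_inr, polyMetric, map_add,
    map_sum, Derivation.leibniz, smul_eq_mul, map_mul, Finset.sum_add_distrib]
  simp only [pderiv_pderiv_comm j i, pderiv_pderiv_comm l i, pderiv_pderiv_comm l j]
  simp only [mul_comm]
  ring

theorem normalFF_apply (a : Fin m) (x : Fin n → ℝ) (i j : Fin n) :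
    normalFF σ (polyMap σ Y Z) a x i j = eval x (pderiv i (pderiv j (Z a)))
      - ∑ k, christoffel (inducedMetric (polyMap σ Y Z)) k i j x * eval x (pderiv k (Z a)) := by
  simp [normalFF, secondFF, pd_polyMap, Finset.sum_apply]

theorem smoothMatOn_inducedMetric (Ω : Set (Fin n → ℝ)) :
    SmoothMatOn (inducedMetric (polyMap σ Y Z)) Ω := fun i j => by
  simp only [inducedMetric_polyMap]
  exact (contDiff_eval _).contDiffOn

theorem smoothMatOn_normalFF {Ω : Set (Fin n → ℝ)} (hΩ : IsOpen Ω)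
    (hd : ∀ x ∈ Ω, (inducedMetric (polyMap σ Y Z) x).det ≠ 0) (a : Fin m) :
    SmoothMatOn (normalFF σ (polyMap σ Y Z) a) Ω := fun i j => by
  simp only [normalFF_apply]
  exact (contDiff_eval _).contDiffOn.sub (ContDiffOn.sum fun k _ =>
    (contDiffOn_christoffel hΩ (smoothMatOn_inducedMetric σ Y Z Ω) hd k i j).mul
      (contDiff_eval _).contDiffOn)

theorem normalFF_zero (hZ : ∀ a i, constantCoeff (pderiv i (Z a)) = 0) (a : Fin m) (i j : Fin n) :
    normalFF σ (polyMap σ Y Z) a 0 i j = constantCoeff (pderiv i (pderiv j (Z a))) := by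
  simp [normalFF_apply, hZ]

/-- The correction Γ^k_{ij} ∂_k Z_a is a sum of products of two factors vanishing at 0, so it drops
out of the first derivatives. This is the link between the one-jet of the annihilator and the cubic
terms of Z. -/
theorem pdMat_normalFF_zero {Ω : Set (Fin n → ℝ)} (hΩ : IsOpen Ω) (h0 : (0 : Fin n → ℝ) ∈ Ω)
    (hd : ∀ x ∈ Ω, (inducedMetric (polyMap σ Y Z) x).det ≠ 0)
    (hZ : ∀ a i, constantCoeff (pderiv i (Z a)) = 0)
    (hΓ : ∀ k i j, christoffel (inducedMetric (polyMap σ Y Z)) k i j 0 = 0)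
    (a : Fin m) (l i j : Fin n) :
    pdMat l (normalFF σ (polyMap σ Y Z) a) 0 i j =
      constantCoeff (pderiv l (pderiv i (pderiv j (Z a)))) := by
  have h1 : ∀ k, DifferentiableAt ℝ (christoffel (inducedMetric (polyMap σ Y Z)) k i j) 0 :=
    fun k => ((contDiffOn_christoffel hΩ (smoothMatOn_inducedMetric σ Y Z Ω) hd k i j).contDiffAt
      (hΩ.mem_nhds h0)).differentiableAt (by simp)
  have h2 : ∀ p : MvPolynomial (Fin n) ℝ, DifferentiableAt ℝ (fun x => eval x p) 0 := fun p =>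
    (contDiff_eval (k := 1) p).contDiffAt.differentiableAt one_ne_zero
  simp only [pdMat, Matrix.of_apply, normalFF_apply]
  rw [pd_sub _ (h2 _) (DifferentiableAt.fun_sum fun k _ => (h1 k).fun_mul (h2 _)),
    pd_sum _ fun k _ => (h1 k).fun_mul (h2 _),
    Finset.sum_congr rfl fun k _ => pd_mul l (h1 k) (h2 _), pd_eval]
  simp [hZ, hΓ]

/-- Tangent vectors lie in the kernel of `secondFFMap`, and since ∂Y is invertible every vector can
be altered by a tangent one until only its last m coordinates remain. Those coordinate directions
need not be normal away from 0. -/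
theorem spaceII_polyMap {x : Fin n → ℝ} (hd : (inducedMetric (polyMap σ Y Z) x).det ≠ 0)
    (hY : (Matrix.of fun k l => eval x (pderiv l (Y k))).det ≠ 0) :
    spaceII (polyMap σ Y Z) x =
      Submodule.span ℝ (range fun a => normalFF σ (polyMap σ Y Z) a x) := by
  apply le_antisymm
  · rintro _ ⟨v, rfl⟩
    set D : Matrix (Fin n) (Fin n) ℝ := Matrix.of fun k l => eval x (pderiv l (Y k)) with hD
    let s : Fin n → ℝ := D⁻¹ *ᵥ fun k => v (σ (Sum.inl k))
    have hs : D *ᵥ s = fun k => v (σ (Sum.inl k)) := by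
      simp only [s]
      rw [Matrix.mulVec_mulVec, Matrix.mul_nonsing_inv _ (isUnit_iff_ne_zero.2 hY),
        Matrix.one_mulVec]
    have h1 : ∀ l, secondFFMap (polyMap σ Y Z) x (pd l (polyMap σ Y Z) x) = 0 := by
      intro l
      ext i j
      exact secondFF_dotProduct_pd σ Y Z hd i j l
    set w : Fin N → ℝ := v - ∑ l, s l • pd l (polyMap σ Y Z) x with hw
    have h2 : secondFFMap (polyMap σ Y Z) x v = secondFFMap (polyMap σ Y Z) x w := by
      rw [hw, map_sub, map_sum]
      simp [h1]
    have h3 : ∀ k, w (σ (Sum.inl k)) = 0 := by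
      intro k
      have := congrFun hs k
      simp only [Matrix.mulVec, dotProduct, hD, Matrix.of_apply] at this
      simp only [hw, Pi.sub_apply, Finset.sum_apply, Pi.smul_apply, pd_polyMap, polyMap_inl,
        smul_eq_mul, ← this, mul_comm, sub_self]
    have h4 : secondFFMap (polyMap σ Y Z) x w =
        ∑ a, w (σ (Sum.inr a)) • normalFF σ (polyMap σ Y Z) a x := by
      ext i j
      simp [secondFFMap, dotProduct_sum_equiv σ, h3, normalFF, Matrix.sum_apply, mul_comm]
    rw [h2, h4]
    exact Submodule.sum_mem _ fun a _ => Submodule.smul_mem _ _ (Submodule.subset_span ⟨a, rfl⟩)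
  · rw [Submodule.span_le]
    rintro _ ⟨a, rfl⟩
    refine ⟨Pi.single (σ (Sum.inr a)) 1, ?_⟩
    ext i j
    simp [secondFFMap, normalFF]

end Normal

theorem span_eq_annihilator {n m : ℕ} {A : Fin n → Matrix (Fin n) (Fin n) ℝ}
    {h : Fin m → Matrix (Fin n) (Fin n) ℝ} (hcard : n + m = n * (n + 1) / 2)
    (hA : LinearIndependent ℝ A) (hh : LinearIndependent ℝ h) (hAs : ∀ k, (A k).IsSymm)
    (hhs : ∀ a, (h a).IsSymm) (hAh : ∀ k a, pair (A k) (h a) = 0) :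
    Submodule.span ℝ (range A) = annihilator (Submodule.span ℝ (range h)) := by
  apply le_antisymm
  · rw [Submodule.span_le]
    rintro _ ⟨k, rfl⟩
    refine ⟨hAs k, fun H hH => ?_⟩
    change pair (A k) H = 0
    induction hH using Submodule.span_induction with
    | mem x hx => obtain ⟨a, rfl⟩ := hx; exact hAh k a
    | zero => simp [pair]
    | add x y _ _ hx hy => rw [pair_add_right, hx, hy, add_zero]
    | smul c x _ hx => rw [pair_smul_right, hx, mul_zero]
  · rintro M ⟨hMs, hM⟩
    obtain ⟨t, rfl⟩ := exists_combination_of_pair_eq_zero (ι := Fin m) (κ := Fin n)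
      (by simpa [add_comm] using hcard) hh hA hhs hAs (fun a k => by rw [pair_comm, hAh]) hMs
      fun a => by rw [pair_comm]; exact hM _ (Submodule.subset_span ⟨a, rfl⟩)
    exact Submodule.sum_mem _ fun a _ => Submodule.smul_mem _ _ (Submodule.subset_span ⟨a, rfl⟩)

/-- Inverse function theorem. It serves for the first n components of the embedding and for the
injectivity of the quadratic change of variables. -/
theorem exists_isEmbedding_restrict {n : ℕ} {f : (Fin n → ℝ) → (Fin n → ℝ)}
    (hf : ContDiff ℝ 1 f) (hd : (Matrix.of fun k l => pd l (fun x => f x k) 0).det ≠ 0) :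
    ∃ Ω : Set (Fin n → ℝ), IsOpen Ω ∧ (0 : Fin n → ℝ) ∈ Ω ∧
      ∀ Ω' ⊆ Ω, Topology.IsEmbedding fun x : Ω' => f x := by
  set D : Matrix (Fin n) (Fin n) ℝ := Matrix.of fun k l => pd l (fun x => f x k) 0 with hD
  have hfd : DifferentiableAt ℝ f 0 := hf.contDiffAt.differentiableAt one_ne_zero
  have h1 : ∀ v, fderiv ℝ f 0 v = D *ᵥ v := by
    intro v
    funext k
    have hk : ∀ l, pd l (fun x => f x k) 0 = fderiv ℝ f 0 (Pi.single l 1) k := by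
      intro l
      rw [pd, fderiv_apply hfd k]
      rfl
    conv_lhs => rw [pi_eq_sum_univ' v]
    rw [map_sum, Finset.sum_apply]
    simp only [Matrix.mulVec, dotProduct, hD, Matrix.of_apply]
    refine Finset.sum_congr rfl fun l _ => ?_
    rw [hk l, map_smul, Pi.smul_apply, smul_eq_mul, mul_comm]
  let e : (Fin n → ℝ) ≃L[ℝ] (Fin n → ℝ) :=
    (D.toLinearEquiv' (Matrix.invertibleOfIsUnitDet D (isUnit_iff_ne_zero.2 hd))).toContinuousLinearEquiv
  have he : HasStrictFDerivAt f (e : (Fin n → ℝ) →L[ℝ] (Fin n → ℝ)) 0 := by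
    have := hf.contDiffAt.hasStrictFDerivAt (x := 0) one_ne_zero
    rwa [show fderiv ℝ f 0 = e from ContinuousLinearMap.ext h1] at this
  let Φ := he.toOpenPartialHomeomorph f
  refine ⟨Φ.source, Φ.open_source, he.mem_toOpenPartialHomeomorph_source, fun Ω' hΩ' => ?_⟩
  have h2 : Topology.IsEmbedding (Φ.source.domRestrict Φ) := Φ.isOpenEmbedding_restrict.isEmbedding
  exact h2.comp (Topology.IsEmbedding.inclusion hΩ')

/-! ## Positive definiteness is an open condition -/

/-- Homogeneity reduces positivity to the unit sphere, whose compactness makes the neighborhood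
uniform in ξ. -/
theorem eventually_pos_of_homogeneous {X E : Type*} [TopologicalSpace X] [NormedAddCommGroup E]
    [NormedSpace ℝ E] [ProperSpace E] {F : X → E → ℝ} (hF : Continuous (Function.uncurry F))
    (hom : ∀ x (c : ℝ) ξ, F x (c • ξ) = c ^ 2 * F x ξ) {x₀ : X} (pos : ∀ ξ, ξ ≠ 0 → 0 < F x₀ ξ) :
    ∀ᶠ x in 𝓝 x₀, ∀ ξ, ξ ≠ 0 → 0 < F x ξ := by
  have h : ∀ᶠ x in 𝓝 x₀, ∀ ξ ∈ Metric.sphere (0 : E) 1, 0 < F x ξ := by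
    refine (isCompact_sphere (0 : E) 1).eventually_forall_of_forall_eventually fun ξ hξ => ?_
    exact hF.continuousAt.eventually
      (lt_mem_nhds (pos ξ (ne_zero_of_mem_unit_sphere (⟨ξ, hξ⟩ : Metric.sphere (0 : E) 1))))
  filter_upwards [h] with x hx ξ hξ
  have hn : ‖ξ‖ ≠ 0 := norm_ne_zero_iff.2 hξ
  have h1 := hx (‖ξ‖⁻¹ • ξ) (by simp [norm_smul, hn])
  rw [hom] at h1
  exact pos_of_mul_pos_right h1 (by positivity)

/-- Positive definiteness of the quadratic form of a matrix that need not be symmetric. -/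
def IsPosForm {n : ℕ} (M : Matrix (Fin n) (Fin n) ℝ) : Prop :=
  ∀ ξ : Fin n → ℝ, ξ ≠ 0 → 0 < ξ ⬝ᵥ (M *ᵥ ξ)

/-- Positive definiteness of `∑ ξ_jᵀ (D_{ji} + D_{ij}) ξ_i`. -/
def IsPosBlockForm {n : ℕ} (D : Fin n → Fin n → Matrix (Fin n) (Fin n) ℝ) : Prop :=
  ∀ ξ : Fin n → Fin n → ℝ, ξ ≠ 0 → 0 < ∑ i, ∑ j, ξ j ⬝ᵥ ((D j i + D i j) *ᵥ ξ i)

theorem IsPosForm.eventually {n : ℕ} {M : Matrix (Fin n) (Fin n) ℝ} (h : IsPosForm M) :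
    ∀ᶠ M' in 𝓝 M, IsPosForm M' := by
  refine eventually_pos_of_homogeneous (F := fun M (ξ : Fin n → ℝ) => ξ ⬝ᵥ (M *ᵥ ξ)) ?_ ?_ h
  · unfold Function.uncurry; fun_prop
  · intro M c ξ
    simp [Matrix.mulVec_smul]
    ring

theorem IsPosBlockForm.eventually {n : ℕ} {D : Fin n → Fin n → Matrix (Fin n) (Fin n) ℝ}
    (h : IsPosBlockForm D) : ∀ᶠ D' in 𝓝 D, IsPosBlockForm D' := by
  refine eventually_pos_of_homogeneous (F := fun (D : Fin n → Fin n → Matrix (Fin n) (Fin n) ℝ)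
    (ξ : Fin n → Fin n → ℝ) => ∑ i, ∑ j, ξ j ⬝ᵥ ((D j i + D i j) *ᵥ ξ i)) ?_ ?_ h
  · unfold Function.uncurry; fun_prop
  · intro D c ξ
    simp only [Pi.smul_apply, Matrix.mulVec_smul, smul_dotProduct, dotProduct_smul, smul_eq_mul,
      Finset.mul_sum]
    refine Finset.sum_congr rfl fun i _ => Finset.sum_congr rfl fun j _ => ?_
    ring

/-! ## Calculus of matrix-valued functions -/

/-- Entrywise differentiability. -/
def DiffMatAt {n s : ℕ} (M : (Fin n → ℝ) → Matrix (Fin s) (Fin s) ℝ) (x : Fin n → ℝ) : Prop :=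
  ∀ a b, DifferentiableAt ℝ (fun y => M y a b) x

theorem DiffMatAt.mul {n s : ℕ} {M N : (Fin n → ℝ) → Matrix (Fin s) (Fin s) ℝ} {x : Fin n → ℝ}
    (hM : DiffMatAt M x) (hN : DiffMatAt N x) : DiffMatAt (fun y => M y * N y) x := fun a b => by
  simp only [Matrix.mul_apply]
  exact DifferentiableAt.fun_sum fun c _ => (hM a c).fun_mul (hN c b)

theorem DiffMatAt.transpose {n s : ℕ} {M : (Fin n → ℝ) → Matrix (Fin s) (Fin s) ℝ} {x : Fin n → ℝ}
    (hM : DiffMatAt M x) : DiffMatAt (fun y => (M y)ᵀ) x := fun a b => hM b a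

theorem pdMat_mul {n s : ℕ} {M N : (Fin n → ℝ) → Matrix (Fin s) (Fin s) ℝ} {x : Fin n → ℝ}
    (l : Fin n) (hM : DiffMatAt M x) (hN : DiffMatAt N x) :
    pdMat l (fun y => M y * N y) x = M x * pdMat l N x + pdMat l M x * N x := by
  ext a b
  simp only [pdMat, Matrix.of_apply, Matrix.mul_apply, Matrix.add_apply]
  rw [pd_sum _ fun c _ => (hM a c).fun_mul (hN c b),
    Finset.sum_congr rfl fun c _ => pd_mul l (hM a c) (hN c b), Finset.sum_add_distrib]

theorem pdMat_transpose {n s : ℕ} (M : (Fin n → ℝ) → Matrix (Fin s) (Fin s) ℝ) (x : Fin n → ℝ)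
    (l : Fin n) : pdMat l (fun y => (M y)ᵀ) x = (pdMat l M x)ᵀ := rfl

theorem pdMat_congr {n s : ℕ} {M N : (Fin n → ℝ) → Matrix (Fin s) (Fin s) ℝ} {x : Fin n → ℝ}
    (h : M =ᶠ[𝓝 x] N) (l : Fin n) : pdMat l M x = pdMat l N x := by
  ext a b
  exact pd_congr (h.fun_comp fun M => M a b) l

theorem SmoothMatOn.mul {n s : ℕ} {M N : (Fin n → ℝ) → Matrix (Fin s) (Fin s) ℝ}
    {Ω : Set (Fin n → ℝ)} (hM : SmoothMatOn M Ω) (hN : SmoothMatOn N Ω) :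
    SmoothMatOn (fun y => M y * N y) Ω := fun a b => by
  simp only [Matrix.mul_apply]
  exact ContDiffOn.sum fun c _ => (hM a c).mul (hN c b)

theorem SmoothMatOn.diffMatAt {n s : ℕ} {M : (Fin n → ℝ) → Matrix (Fin s) (Fin s) ℝ}
    {Ω : Set (Fin n → ℝ)} (hM : SmoothMatOn M Ω) {x : Fin n → ℝ} (hΩ : Ω ∈ 𝓝 x) :
    DiffMatAt M x := fun a b => ((hM a b).contDiffAt hΩ).differentiableAt (by simp)

theorem SmoothMatOn.pdMat {n s : ℕ} {M : (Fin n → ℝ) → Matrix (Fin s) (Fin s) ℝ}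
    {Ω : Set (Fin n → ℝ)} (hM : SmoothMatOn M Ω) (hΩ : IsOpen Ω) (l : Fin n) :
    SmoothMatOn (pdMat l M) Ω := fun a b => contDiffOn_pd hΩ (hM a b) l

theorem SmoothMatOn.continuousAt {n s : ℕ} {M : (Fin n → ℝ) → Matrix (Fin s) (Fin s) ℝ}
    {Ω : Set (Fin n → ℝ)} (hM : SmoothMatOn M Ω) {x : Fin n → ℝ} (hΩ : Ω ∈ 𝓝 x) :
    ContinuousAt M x :=
  continuousAt_pi.2 fun a => continuousAt_pi.2 fun b => ((hM a b).contDiffAt hΩ).continuousAt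

theorem affineMat_apply {n : ℕ} (S : Fin n → Matrix (Fin n) (Fin n) ℝ) (x : Fin n → ℝ)
    (a b : Fin n) : affineMat S x a b = (1 : Matrix (Fin n) (Fin n) ℝ) a b + ∑ i, x i * S i a b := by
  simp [affineMat, Matrix.sum_apply]

theorem smoothMatOn_affineMat {n : ℕ} (S : Fin n → Matrix (Fin n) (Fin n) ℝ)
    (Ω : Set (Fin n → ℝ)) : SmoothMatOn (affineMat S) Ω := fun a b => by
  simp only [affineMat_apply]
  exact contDiffOn_const.add (ContDiffOn.sum fun l _ =>
    ((contDiff_apply ℝ ℝ l).contDiffOn).mul contDiffOn_const)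

theorem affineMat_zero {n : ℕ} (S : Fin n → Matrix (Fin n) (Fin n) ℝ) : affineMat S 0 = 1 := by
  simp [affineMat]

theorem pdMat_affineMat {n : ℕ} (S : Fin n → Matrix (Fin n) (Fin n) ℝ) (x : Fin n → ℝ)
    (l : Fin n) : pdMat l (affineMat S) x = S l := by
  ext a b
  simp only [pdMat, Matrix.of_apply, affineMat_apply]
  rw [pd_add _ (by fun_prop) (by fun_prop), pd_sum _ (fun _ _ => by fun_prop), pd_const, zero_add]
  rw [Finset.sum_congr rfl fun a _ => pd_mul (f := fun y => y a) l (by fun_prop) (by fun_prop)]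
  simp [pd_coord]

/-! ## Quadratic changes of variables -/

theorem quadMap_zero {n : ℕ} (c : Fin n → Fin n → Fin n → ℝ) : quadMap c 0 = 0 := by
  funext i; simp [quadMap]

theorem contDiff_quadMap {n : ℕ} (c : Fin n → Fin n → Fin n → ℝ) {k : WithTop ℕ∞} :
    ContDiff ℝ k (quadMap c) := by
  refine contDiff_pi.2 fun i => ?_
  unfold quadMap
  fun_prop

theorem jacobian_quadMap {n : ℕ} {c : Fin n → Fin n → Fin n → ℝ} (hc : ∀ i j k, c i j k = c i k j) :
    jacobian (quadMap c) = affineMat fun k => Matrix.of fun i j => c i j k := by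
  funext x
  ext i l
  rw [affineMat_apply]
  simp only [jacobian, quadMap, Matrix.of_apply]
  rw [pd_add _ (by fun_prop) (by fun_prop), pd_mul _ (by fun_prop) (by fun_prop), pd_coord,
    pd_sum _ (fun _ _ => by fun_prop), Finset.sum_congr rfl fun j _ => pd_sum l
      (f := fun k y => c i j k * y j * y k) (fun _ _ => by fun_prop)]
  rw [Finset.sum_congr rfl fun j _ => Finset.sum_congr rfl fun k _ =>
    pd_mul (f := fun y => c i j k * y j) l (by fun_prop) (by fun_prop)]
  rw [Finset.sum_congr rfl fun j _ => Finset.sum_congr rfl fun k _ => by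
    rw [pd_mul (f := fun _ => c i j k) (g := fun y => y j) l (by fun_prop) (by fun_prop)]]
  simp only [pd_coord, pd_const, zero_mul, add_zero, Finset.sum_add_distrib]
  simp [Matrix.one_apply, mul_comm]
  have : ∀ k, c i l k = c i k l := fun k => hc i l k
  simp only [this]
  ring

theorem fderiv_quadMap_zero {n : ℕ} (c : Fin n → Fin n → Fin n → ℝ)
    (hc : ∀ i j k, c i j k = c i k j) :
    HasFDerivAt (quadMap c) (ContinuousLinearMap.id ℝ (Fin n → ℝ)) 0 := by
  have hd : DifferentiableAt ℝ (quadMap c) 0 :=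
    (contDiff_quadMap (k := 1) c).contDiffAt.differentiableAt one_ne_zero
  convert hd.hasFDerivAt
  refine ContinuousLinearMap.coe_injective (LinearMap.pi_ext' fun l => ?_)
  ext i
  have h := congrFun (congrFun (congrFun (jacobian_quadMap hc) 0) i) l
  rw [affineMat_zero, jacobian, Matrix.of_apply, pd, fderiv_apply hd] at h
  simp [Matrix.one_apply, Pi.single_apply] at h ⊢
  exact h.symm

theorem pdMat_comp_quadMap {n : ℕ} {c : Fin n → Fin n → Fin n → ℝ}
    (hc : ∀ i j k, c i j k = c i k j) {M : (Fin n → ℝ) → Matrix (Fin n) (Fin n) ℝ}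
    (hM : DiffMatAt M 0) (l : Fin n) : pdMat l (fun x => M (quadMap c x)) 0 = pdMat l M 0 := by
  ext a b
  have h1 : HasFDerivAt (fun y => M y a b) (fderiv ℝ (fun y => M y a b) 0) (quadMap c 0) := by
    rw [quadMap_zero]; exact (hM a b).hasFDerivAt
  have := (h1.comp 0 (fderiv_quadMap_zero c hc)).fderiv
  simp only [pdMat, Matrix.of_apply, pd]
  change fderiv ℝ ((fun y => M y a b) ∘ quadMap c) 0 _ = _
  rw [this]
  rfl

/-! ## Strong symmetric positivity from the one-jet at a point -/

/-- The first derivatives at `0` of the principal coefficients `A` with one-jet `(A, B)` after the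
change of variables with parameters `c` and `S`. -/
def symbolDeriv {n : ℕ} (A : Fin n → Matrix (Fin n) (Fin n) ℝ)
    (B : Fin n → Fin n → Matrix (Fin n) (Fin n) ℝ) (S : Fin n → Matrix (Fin n) (Fin n) ℝ)
    (c : Fin n → Fin n → Fin n → ℝ) (j i : Fin n) : Matrix (Fin n) (Fin n) ℝ :=
  B j i + (S j)ᵀ * A i + A i * S j - ∑ m, c i m j • A m

/-- The zeroth order form at `0` after the change of variables. -/
def zerothForm {n : ℕ} (A : Fin n → Matrix (Fin n) (Fin n) ℝ)
    (B : Fin n → Fin n → Matrix (Fin n) (Fin n) ℝ) (c : Fin n → Fin n → Fin n → ℝ) :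
    Matrix (Fin n) (Fin n) ℝ :=
  ∑ i, (∑ m, c i m i • A m - B i i)

section Transform

variable {n : ℕ} {P : FirstOrderOp n n} {Ω : Set (Fin n → ℝ)} {c : Fin n → Fin n → Fin n → ℝ}
  (S : Fin n → Matrix (Fin n) (Fin n) ℝ)

/-- The principal coefficients after the change of variables `x = φ(x̄)`. -/
def FirstOrderOp.pullback (P : FirstOrderOp n n) (φ : (Fin n → ℝ) → (Fin n → ℝ)) (j : Fin n)
    (x : Fin n → ℝ) : Matrix (Fin n) (Fin n) ℝ :=
  ∑ i, (jacobian φ x)⁻¹ j i • P.A i (φ x)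

theorem smoothMatOn_comp_quadMap {U : Set (Fin n → ℝ)} {M : (Fin n → ℝ) → Matrix (Fin n) (Fin n) ℝ}
    (hM : SmoothMatOn M Ω) (hU : MapsTo (quadMap c) U Ω) :
    SmoothMatOn (fun x => M (quadMap c x)) U := fun a b =>
  (hM a b).comp (contDiff_quadMap c).contDiffOn hU

theorem smoothMatOn_pullback {U : Set (Fin n → ℝ)} (hc : ∀ i j k, c i j k = c i k j)
    (hA : ∀ i, SmoothMatOn (P.A i) Ω) (hU : MapsTo (quadMap c) U Ω)
    (hd : ∀ x ∈ U, (jacobian (quadMap c) x).det ≠ 0) (j : Fin n) :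
    SmoothMatOn (P.pullback (quadMap c) j) U := fun a b => by
  have h : (fun x => P.pullback (quadMap c) j x a b) = fun x =>
      ∑ i, (jacobian (quadMap c) x)⁻¹ j i * P.A i (quadMap c x) a b := by
    funext x
    simp [FirstOrderOp.pullback, Matrix.sum_apply]
  rw [h]
  refine ContDiffOn.sum fun i _ => ContDiffOn.mul ?_ (smoothMatOn_comp_quadMap (hA i) hU a b)
  rw [jacobian_quadMap hc] at hd ⊢
  exact contDiffOn_inv_apply (smoothMatOn_affineMat _ U) hd j i

/-- Differentiate T⁻¹ T = 1 at 0, where T = 1. -/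
theorem pdMat_inv_affineMat (T : Fin n → Matrix (Fin n) (Fin n) ℝ) (l : Fin n) :
    DiffMatAt (fun x => (affineMat T x)⁻¹) 0 ∧ pdMat l (fun x => (affineMat T x)⁻¹) 0 = -T l := by
  have hcont : ContinuousAt (fun x => (affineMat T x).det) 0 :=
    ((contDiffOn_det (smoothMatOn_affineMat T univ)).contDiffAt Filter.univ_mem).continuousAt
  have hev : ∀ᶠ x in 𝓝 (0 : Fin n → ℝ), (affineMat T x).det ≠ 0 :=
    hcont.eventually_ne (by simp [affineMat_zero])
  obtain ⟨V, hV, hVo, h0⟩ := eventually_nhds_iff.1 hev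
  have hs : SmoothMatOn (fun x => (affineMat T x)⁻¹) V := fun a b =>
    contDiffOn_inv_apply (smoothMatOn_affineMat T V) hV a b
  have hd := hs.diffMatAt (hVo.mem_nhds h0)
  refine ⟨hd, ?_⟩
  have h1 := pdMat_mul l hd ((smoothMatOn_affineMat T V).diffMatAt (hVo.mem_nhds h0))
  have h2 : (fun x => (affineMat T x)⁻¹ * affineMat T x) =ᶠ[𝓝 0] fun _ => 1 := by
    filter_upwards [hev] with x hx
    exact Matrix.nonsing_inv_mul _ (isUnit_iff_ne_zero.2 hx)
  rw [pdMat_congr h2, pdMat_affineMat, affineMat_zero] at h1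
  have h3 : pdMat l (fun _ : Fin n → ℝ => (1 : Matrix (Fin n) (Fin n) ℝ)) 0 = 0 := by
    ext a b; simp [pdMat]
  rw [h3] at h1
  simp only [inv_one, one_mul, mul_one] at h1
  exact eq_neg_of_add_eq_zero_right h1.symm

/-- The map is tangent to the identity at 0, so composition with it leaves first derivatives
unchanged; the inverse Jacobian contributes -c. -/
theorem pdMat_pullback (hc : ∀ i j k, c i j k = c i k j) (hA : ∀ i, DiffMatAt (P.A i) 0)
    (l j : Fin n) : DiffMatAt (P.pullback (quadMap c) j) 0 ∧
      pdMat l (P.pullback (quadMap c) j) 0 = pdMat l (P.A j) 0 - ∑ m, c j m l • P.A m 0 := by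
  have hJ := pdMat_inv_affineMat (fun k => Matrix.of fun i j => c i j k) l
  rw [← jacobian_quadMap hc] at hJ
  have hAc : ∀ i, DiffMatAt (fun x => P.A i (quadMap c x)) 0 := fun i a b => by
    have h1 : DifferentiableAt ℝ (fun y => P.A i y a b) (quadMap c 0) := by
      rw [quadMap_zero]; exact hA i a b
    exact h1.comp 0 (fderiv_quadMap_zero c hc).differentiableAt
  have h : ∀ a b, (fun x => P.pullback (quadMap c) j x a b) = fun x =>
      ∑ i, (jacobian (quadMap c) x)⁻¹ j i * P.A i (quadMap c x) a b := by
    intro a b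
    funext x
    simp [FirstOrderOp.pullback, Matrix.sum_apply]
  constructor
  · intro a b
    rw [h]
    exact DifferentiableAt.fun_sum fun i _ => (hJ.1 j i).fun_mul (hAc i a b)
  · ext a b
    rw [pdMat, Matrix.of_apply, h, pd_sum _ fun i _ => (hJ.1 j i).fun_mul (hAc i a b),
      Finset.sum_congr rfl fun i _ => pd_mul l (hJ.1 j i) (hAc i a b)]
    have h1 : ∀ i, pd l (fun x => (jacobian (quadMap c) x)⁻¹ j i) 0 = - c j i l := fun i =>
      congrFun (congrFun hJ.2 j) i
    have h2 : ∀ i, pd l (fun x => P.A i (quadMap c x) a b) 0 = pdMat l (P.A i) 0 a b := fun i =>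
      congrFun (congrFun (pdMat_comp_quadMap hc (hA i) l) a) b
    simp only [h1, h2]
    simp only [jacobian_quadMap hc, affineMat_zero, inv_one, quadMap_zero]
    simp [Matrix.one_apply, Matrix.sum_apply, Finset.sum_add_distrib, sub_eq_add_neg]

theorem pdMat_transform (hc : ∀ i j k, c i j k = c i k j) (hA : ∀ i, DiffMatAt (P.A i) 0)
    (l j : Fin n) : pdMat l ((P.transform (quadMap c) (affineMat S)).A j) 0 =
      symbolDeriv (fun i => P.A i 0) (fun l i => pdMat l (P.A i) 0) S c l j := by
  have hS : DiffMatAt (affineMat S) 0 := (smoothMatOn_affineMat S univ).diffMatAt Filter.univ_mem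
  obtain ⟨h1, h2⟩ := pdMat_pullback hc hA l j
  have h3 : P.pullback (quadMap c) j 0 = P.A j 0 := by
    simp [FirstOrderOp.pullback, jacobian_quadMap hc, affineMat_zero, quadMap_zero,
      Matrix.one_apply]
  change pdMat l (fun x => (affineMat S x)ᵀ * P.pullback (quadMap c) j x * affineMat S x) 0 = _
  rw [pdMat_mul l (hS.transpose.mul h1) hS, pdMat_mul l hS.transpose h1, pdMat_transpose, h2, h3,
    pdMat_affineMat, affineMat_zero, symbolDeriv]
  simp only [Matrix.transpose_one, one_mul, mul_one]
  abel

/-- The coefficient matrices of Q₀ and Q₁ are continuous, so positivity at 0 suffices. As P.B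
vanishes at 0, the transformed zeroth order coefficient there is ∑ A^j S_j. In Q₀ it cancels the S
terms of ∑ ∂_i Ã^i, which is why `zerothForm` does not involve S. -/
theorem exists_stronglySymmetricPositiveOn (hc : ∀ i j k, c i j k = c i k j) (hΩ : IsOpen Ω)
    (h0 : (0 : Fin n → ℝ) ∈ Ω) (hA : ∀ i, SmoothMatOn (P.A i) Ω) (hB : SmoothMatOn P.B Ω)
    (hs : ∀ x ∈ Ω, ∀ i, (P.A i x).IsSymm) (hB0 : P.B 0 = 0)
    (h1 : IsPosBlockForm (symbolDeriv (fun i => P.A i 0) (fun l i => pdMat l (P.A i) 0) S c))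
    (h2 : IsPosForm (zerothForm (fun i => P.A i 0) (fun l i => pdMat l (P.A i) 0) c)) :
    ∃ U, IsChangeOfVariables (quadMap c) (affineMat S) U Ω ∧
      StronglySymmetricPositiveOn (P.transform (quadMap c) (affineMat S)) U := by
  obtain ⟨V₁, hV₁, h01, hinj⟩ := exists_isEmbedding_restrict (f := quadMap c) (contDiff_quadMap c) (by
    change (jacobian (quadMap c) 0).det ≠ 0
    rw [jacobian_quadMap hc, affineMat_zero]
    simp)
  have hdet : ∀ T : Fin n → Matrix (Fin n) (Fin n) ℝ, IsOpen {x | (affineMat T x).det ≠ 0} ∧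
      (0 : Fin n → ℝ) ∈ {x | (affineMat T x).det ≠ 0} := fun T =>
    ⟨isOpen_ne.preimage (continuousOn_univ.1
      (contDiffOn_det (smoothMatOn_affineMat T univ)).continuousOn), by simp [affineMat_zero]⟩
  obtain ⟨hdS, hdS0⟩ := hdet S
  obtain ⟨hdJ, hdJ0⟩ := hdet fun k => Matrix.of fun i j => c i j k
  rw [← jacobian_quadMap hc] at hdJ hdJ0
  set V : Set (Fin n → ℝ) := V₁ ∩ {x | (affineMat S x).det ≠ 0} ∩
    {x | (jacobian (quadMap c) x).det ≠ 0} ∩ quadMap c ⁻¹' Ω with hVdef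
  have hV : IsOpen V := ((hV₁.inter hdS).inter hdJ).inter
    (hΩ.preimage (contDiff_quadMap (k := 0) c).continuous)
  have h0V : (0 : Fin n → ℝ) ∈ V := ⟨⟨⟨h01, hdS0⟩, hdJ0⟩, by simpa [quadMap_zero] using h0⟩
  have hmaps : MapsTo (quadMap c) V Ω := fun x hx => hx.2
  have hTs := smoothMatOn_affineMat S V
  have hpb : ∀ j, SmoothMatOn (P.pullback (quadMap c) j) V := fun j =>
    smoothMatOn_pullback hc hA hmaps (fun x hx => hx.1.2) j
  set R := P.transform (quadMap c) (affineMat S) with hR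
  have hRA : ∀ j, SmoothMatOn (R.A j) V := fun j =>
    SmoothMatOn.mul (SmoothMatOn.mul (fun a b => hTs b a) (hpb j)) hTs
  have hRBeq : R.B = fun x => (affineMat S x)ᵀ * (P.B (quadMap c x) * affineMat S x
      + ∑ j, P.pullback (quadMap c) j x * S j) := by
    funext x
    simp only [hR, FirstOrderOp.transform, pdMat_affineMat]
    rfl
  have hRB : SmoothMatOn R.B V := by
    rw [hRBeq]
    refine SmoothMatOn.mul (fun a b => hTs b a) fun a b => ?_
    simp only [Matrix.add_apply, Matrix.sum_apply]
    exact (SmoothMatOn.mul (smoothMatOn_comp_quadMap hB hmaps) hTs a b).add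
      (ContDiffOn.sum fun j _ =>
        SmoothMatOn.mul (hpb j) (N := fun _ => S j) (fun a b => contDiffOn_const) a b)
  have hRsymm : ∀ x ∈ V, ∀ i, (R.A i x).IsSymm := by
    intro x hx i
    have h3 : (P.pullback (quadMap c) i x)ᵀ = P.pullback (quadMap c) i x := by
      simp only [FirstOrderOp.pullback, Matrix.transpose_sum, Matrix.transpose_smul]
      exact Finset.sum_congr rfl fun k _ => by rw [hs _ (hmaps hx) k]
    change ((affineMat S x)ᵀ * P.pullback (quadMap c) i x * affineMat S x)ᵀ =
      (affineMat S x)ᵀ * P.pullback (quadMap c) i x * affineMat S x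
    rw [Matrix.transpose_mul, Matrix.transpose_mul, Matrix.transpose_transpose, h3, mul_assoc]
  have hAd : ∀ i, DiffMatAt (P.A i) 0 := fun i => (hA i).diffMatAt (hΩ.mem_nhds h0)
  have hpd : ∀ j i, ContinuousAt (fun x => pdMat j (R.A i) x) 0 := fun j i =>
    ((hRA i).pdMat hV j).continuousAt (hV.mem_nhds h0V)
  have hdR : (fun j i => pdMat j (R.A i) 0) =
      symbolDeriv (fun i => P.A i 0) (fun l i => pdMat l (P.A i) 0) S c := by
    funext j i
    exact pdMat_transform S hc hAd j i
  have hev1 : ∀ᶠ x in 𝓝 (0 : Fin n → ℝ), IsPosBlockForm fun j i => pdMat j (R.A i) x := by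
    have hcont : ContinuousAt (fun x => fun j i => pdMat j (R.A i) x) (0 : Fin n → ℝ) :=
      continuousAt_pi.2 fun j => continuousAt_pi.2 fun i => hpd j i
    refine hcont.eventually (p := fun D => IsPosBlockForm D) ?_
    exact IsPosBlockForm.eventually (show IsPosBlockForm fun j i => pdMat j (R.A i) 0 by
      rw [hdR]; exact h1)
  have hev2 : ∀ᶠ x in 𝓝 (0 : Fin n → ℝ),
      IsPosForm (R.B x + (R.B x)ᵀ - ∑ i, pdMat i (R.A i) x) := by
    have hcB : ContinuousAt R.B 0 := hRB.continuousAt (hV.mem_nhds h0V)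
    have hcont : ContinuousAt (fun x => R.B x + (R.B x)ᵀ - ∑ i, pdMat i (R.A i) x) 0 := by
      refine (hcB.add ?_).sub (tendsto_finsetSum _ fun i _ => hpd i i)
      exact (continuous_id.matrix_transpose.continuousAt).comp hcB
    refine hcont.eventually (p := fun D => IsPosForm D) (IsPosForm.eventually ?_)
    have hR0 : R.B 0 = ∑ j, P.A j 0 * S j := by
      rw [hRBeq]
      simp only [quadMap_zero, hB0, affineMat_zero, zero_mul, zero_add, Matrix.transpose_one,
        one_mul]
      refine Finset.sum_congr rfl fun j _ => ?_
      simp [FirstOrderOp.pullback, jacobian_quadMap hc, affineMat_zero, quadMap_zero,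
        Matrix.one_apply]
    have h4 : ∑ i, pdMat i (R.A i) 0 = ∑ i, symbolDeriv (fun i => P.A i 0)
        (fun l i => pdMat l (P.A i) 0) S c i i :=
      Finset.sum_congr rfl fun i _ => pdMat_transform S hc hAd i i
    have h5 : R.B 0 + (R.B 0)ᵀ - ∑ i, pdMat i (R.A i) 0 =
        zerothForm (fun i => P.A i 0) (fun l i => pdMat l (P.A i) 0) c := by
      rw [h4, hR0, Matrix.transpose_sum, ← Finset.sum_add_distrib, ← Finset.sum_sub_distrib,
        zerothForm]
      refine Finset.sum_congr rfl fun i _ => ?_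
      rw [Matrix.transpose_mul, hs 0 h0 i, symbolDeriv]
      abel
    change IsPosForm (R.B 0 + (R.B 0)ᵀ - ∑ i, pdMat i (R.A i) 0)
    rw [h5]
    exact h2
  obtain ⟨U, hU, hUo, h0U⟩ := eventually_nhds_iff.1 ((hev1.and hev2).and (hV.eventually_mem h0V))
  have hUV : U ⊆ V := fun x hx => (hU x hx).2
  refine ⟨U, ⟨hUo, h0U, quadMap_zero c, fun x hx => hmaps (hUV hx), fun x hx y hy hxy => ?_,
    fun x hx => (hUV hx).1.2, fun x hx => (hUV hx).1.1.2⟩, ⟨fun i a b => (hRA i a b).mono hUV,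
    fun a b => (hRB a b).mono hUV, fun x hx => hRsymm x (hUV hx), fun x hx => (hU x hx).1.2,
    fun x hx => (hU x hx).1.1⟩⟩
  have := (hinj V₁ Subset.rfl).injective (a₁ := ⟨x, (hUV hx).1.1.1⟩) (a₂ := ⟨y, (hUV hy).1.1.1⟩) hxy
  exact congrArg Subtype.val this

end Transform

/-! ## The metric to second order -/

theorem pd_eq_zero_of_christoffel_eq_zero {n : ℕ} {g : (Fin n → ℝ) → Matrix (Fin n) (Fin n) ℝ}
    {x : Fin n → ℝ} (hd : (g x).det ≠ 0) (hs : ∀ᶠ y in 𝓝 x, (g y).IsSymm)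
    (hΓ : ∀ k i j, christoffel g k i j x = 0) (k i j : Fin n) :
    pd k (fun y => g y i j) x = 0 := by
  have h1 : ∀ i j l, pd i (fun y => g y j l) x + pd j (fun y => g y i l) x
      - pd l (fun y => g y i j) x = 0 := by
    intro i j l
    have := sum_christoffel_mul hd hs.self_of_nhds i j l
    simp only [hΓ, zero_mul, Finset.sum_const_zero] at this
    linarith
  have hsym : ∀ k i j, pd k (fun y => g y i j) x = pd k (fun y => g y j i) x := fun k i j =>
    pd_congr (hs.mono fun y hy => hy.apply j i) k
  have := h1 k i j
  have h2 := h1 k j i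
  rw [hsym k j i] at h2
  linarith

theorem riemann_eq_of_christoffel_eq_zero {n : ℕ} {g : (Fin n → ℝ) → Matrix (Fin n) (Fin n) ℝ}
    {Ω : Set (Fin n → ℝ)} (hΩ : IsOpen Ω) {x : Fin n → ℝ} (hx : x ∈ Ω) (hg : IsSmoothMetricOn g Ω)
    (hΓ : ∀ k i j, christoffel g k i j x = 0) (i j k l : Fin n) :
    riemann g i j k l x = -(1 / 2) * (pd i (pd k fun y => g y j l) x + pd j (pd l fun y => g y i k) x
      - pd i (pd l fun y => g y j k) x - pd j (pd k fun y => g y i l) x) := by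
  have hdet : ∀ y ∈ Ω, (g y).det ≠ 0 := fun y hy => (hg.2 y hy).det_pos.ne'
  have hsymm : ∀ y ∈ Ω, (g y).IsSymm := fun y hy => by
    have := (hg.2 y hy).isHermitian
    rwa [Matrix.IsHermitian, Matrix.conjTranspose_eq_transpose_of_trivial] at this
  have hev : ∀ᶠ y in 𝓝 x, y ∈ Ω := hΩ.mem_nhds hx
  have hdiff : ∀ {f : (Fin n → ℝ) → ℝ}, ContDiffOn ℝ ∞ f Ω → DifferentiableAt ℝ f x := fun hf =>
    (hf.contDiffAt hev).differentiableAt (by simp)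
  have hpp : ∀ i j l, DifferentiableAt ℝ (pd i fun y => g y j l) x := fun i j l =>
    hdiff (contDiffOn_pd hΩ (hg.1 j l) i)
  have hdg := pd_eq_zero_of_christoffel_eq_zero (hdet x hx) (hev.mono hsymm) hΓ
  have hΓd : ∀ m j l, DifferentiableAt ℝ (christoffel g m j l) x := fun m j l =>
    hdiff (contDiffOn_christoffel hΩ hg.1 hdet m j l)
  have hgd : ∀ m k, DifferentiableAt ℝ (fun y => g y m k) x := fun m k => hdiff (hg.1 m k)
  -- Differentiate the lowered symbols. Since Γ vanishes at x, the derivative of the metric factor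
  -- does not contribute.
  have key : ∀ i j l k, ∑ m, g x k m * pd i (christoffel g m j l) x = (1 / 2) *
      (pd i (pd j fun y => g y l k) x + pd i (pd l fun y => g y j k) x
        - pd i (pd k fun y => g y j l) x) := by
    intro i j l k
    have h1 : (fun y => ∑ m, christoffel g m j l y * g y m k) =ᶠ[𝓝 x] fun y => (1 / 2) *
        (pd j (fun y => g y l k) y + pd l (fun y => g y j k) y - pd k (fun y => g y j l) y) :=
      hev.mono fun y hy => sum_christoffel_mul (hdet y hy) (hsymm y hy) j l k
    have h2 := pd_congr h1 i
    rw [pd_sum _ fun m _ => (hΓd m j l).fun_mul (hgd m k),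
      Finset.sum_congr rfl fun m _ => pd_mul i (hΓd m j l) (hgd m k),
      pd_mul _ (by fun_prop) (((hpp _ _ _).fun_add (hpp _ _ _)).fun_sub (hpp _ _ _)),
      pd_sub _ ((hpp _ _ _).fun_add (hpp _ _ _)) (hpp _ _ _), pd_add _ (hpp _ _ _) (hpp _ _ _)]
      at h2
    simp only [hΓ, zero_mul, zero_add, pd_const, add_zero] at h2
    rw [← h2]
    exact Finset.sum_congr rfl fun m _ => by rw [(hsymm x hx).apply, mul_comm]
  have hc : ∀ a b, pd i (pd j fun y => g y a b) x = pd j (pd i fun y => g y a b) x := fun a b =>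
    pd_pd_comm (((hg.1 a b).contDiffAt hev).of_le (WithTop.coe_le_coe.2 le_top)) i j
  have h3 : riemann g i j k l x = ∑ m, g x k m * pd i (christoffel g m j l) x
      - ∑ m, g x k m * pd j (christoffel g m i l) x := by
    rw [riemann, ← Finset.sum_sub_distrib]
    refine Finset.sum_congr rfl fun m _ => ?_
    simp only [hΓ, zero_mul, sub_self, Finset.sum_const_zero, add_zero]
    ring
  rw [h3, key, key, hc]
  ring

theorem pd_pd_eq_iteratedFDeriv {n : ℕ} {f : (Fin n → ℝ) → ℝ} {x : Fin n → ℝ}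
    (hf : ContDiffAt ℝ 2 f x) (i j : Fin n) :
    pd i (pd j f) x = iteratedFDeriv ℝ 2 f x ![Pi.single i 1, Pi.single j 1] := by
  rw [iteratedFDeriv_two_apply]
  have h1 : DifferentiableAt ℝ (fderiv ℝ f) x :=
    (hf.fderiv_right (m := 1) (by norm_num)).differentiableAt one_ne_zero
  unfold pd
  rw [fderiv_clm_apply h1 (differentiableAt_const _)]
  simp

/-- Symmetric polynomial Taylor approximation of a metric whose Christoffel symbols vanish. -/
theorem exists_poly_metric {n : ℕ} {g : (Fin n → ℝ) → Matrix (Fin n) (Fin n) ℝ}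
    {Ω : Set (Fin n → ℝ)} (hΩ : IsOpen Ω) (h0 : (0 : Fin n → ℝ) ∈ Ω) (hg : IsSmoothMetricOn g Ω)
    (hΓ : ∀ k i j, christoffel g k i j 0 = 0) (β : ℕ) :
    ∃ p : Fin n → Fin n → MvPolynomial (Fin n) ℝ, (∀ i j, p i j = p j i) ∧
      (∀ m ≤ β, ∀ i j, iteratedFDeriv ℝ m (fun y => g y i j) 0 =
        iteratedFDeriv ℝ m (fun y => eval y (p i j)) 0) ∧
      (∀ i j, constantCoeff (p i j) = g 0 i j) ∧ (∀ i j k, constantCoeff (pderiv k (p i j)) = 0) ∧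
      ∀ i j k l, constantCoeff (pderiv i (pderiv k (p j l)))
        + constantCoeff (pderiv j (pderiv l (p i k))) - constantCoeff (pderiv i (pderiv l (p j k)))
        - constantCoeff (pderiv j (pderiv k (p i l))) = -2 * riemann g i j k l 0 := by
  have hsymm : ∀ y ∈ Ω, (g y).IsSymm := fun y hy => by
    have := (hg.2 y hy).isHermitian
    rwa [Matrix.IsHermitian, Matrix.conjTranspose_eq_transpose_of_trivial] at this
  have hev : ∀ᶠ y in 𝓝 (0 : Fin n → ℝ), y ∈ Ω := hΩ.mem_nhds h0
  -- The order β + 2 guarantees second derivatives even when β = 0. Using one Taylor polynomial per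
  -- unordered pair of indices keeps p symmetric.
  choose q hq using fun i j => exists_poly_iteratedFDeriv_eq hΩ h0 (hg.1 i j) (β + 2)
  let p : Fin n → Fin n → MvPolynomial (Fin n) ℝ := fun i j => q (min i j) (max i j)
  have hp : ∀ m ≤ β + 2, ∀ i j, iteratedFDeriv ℝ m (fun y => g y i j) 0 =
      iteratedFDeriv ℝ m (fun y => eval y (p i j)) 0 := by
    intro m hm i j
    rcases le_total i j with h | h
    · simp only [p, min_eq_left h, max_eq_right h, hq i j m hm]
    · have he : (fun y => g y i j) =ᶠ[𝓝 0] fun y => g y j i :=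
        hev.mono fun y hy => (hsymm y hy).apply j i
      simp only [p, min_eq_right h, max_eq_left h]
      rw [← hq j i m hm, (he.iteratedFDeriv ℝ m).self_of_nhds]
  have hgc : ∀ i j, ContDiffAt ℝ 2 (fun y => g y i j) 0 := fun i j =>
    ((hg.1 i j).contDiffAt hev).of_le (WithTop.coe_le_coe.2 le_top)
  have e0 : ∀ i j, constantCoeff (p i j) = g 0 i j := by
    intro i j
    have := congrArg (fun f => f ![]) (hp 0 (by omega) i j)
    simpa using this.symm
  have e1 : ∀ i j k, constantCoeff (pderiv k (p i j)) = pd k (fun y => g y i j) 0 := by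
    intro i j k
    have := congrArg (fun f => f ![Pi.single k 1]) (hp 1 (by omega) i j)
    simp only [iteratedFDeriv_one_apply, Matrix.cons_val_zero] at this
    rw [pd, this]
    have := congrFun (pd_eval k (p i j)) 0
    rw [pd] at this
    rw [this]
    simp
  have e2 : ∀ i j k l, constantCoeff (pderiv l (pderiv k (p i j))) =
      pd l (pd k fun y => g y i j) 0 := by
    intro i j k l
    rw [pd_pd_eq_iteratedFDeriv (hgc i j), hp 2 (by omega) i j,
      ← pd_pd_eq_iteratedFDeriv (contDiff_eval _).contDiffAt, pd_eval, pd_eval]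
    simp
  refine ⟨p, fun i j => by simp only [p, min_comm, max_comm], fun m hm => hp m (by omega), e0,
    fun i j k => ?_, fun i j k l => ?_⟩
  · rw [e1]
    exact pd_eq_zero_of_christoffel_eq_zero (hg.2 0 h0).det_pos.ne' (hev.mono hsymm) hΓ k i j
  · rw [riemann_eq_of_christoffel_eq_zero hΩ h0 hg hΓ]
    simp only [e2]
    ring

open scoped MatrixOrder Matrix.Norms.L2Operator in
theorem exists_transpose_mul_self_eq {n : ℕ} {G : Matrix (Fin n) (Fin n) ℝ} (hG : G.PosDef) :
    ∃ L M : Matrix (Fin n) (Fin n) ℝ, Lᵀ * L = G ∧ Lᵀ * M = 1 ∧ L.det ≠ 0 := by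
  obtain ⟨L, rfl⟩ := CStarAlgebra.nonneg_iff_eq_star_mul_self.mp hG.posSemidef.nonneg
  rw [Matrix.star_eq_conjTranspose, Matrix.conjTranspose_eq_transpose_of_trivial] at hG
  have hd : L.det ≠ 0 := fun h => hG.det_pos.ne' (by rw [Matrix.det_mul, h, mul_zero])
  refine ⟨L, Lᵀ⁻¹, ?_, Matrix.mul_nonsing_inv _ ?_, hd⟩
  · rw [Matrix.star_eq_conjTranspose, Matrix.conjTranspose_eq_transpose_of_trivial]
  · rwa [Matrix.det_transpose, isUnit_iff_ne_zero]

/-! ## From algebraic data at a point to approximate isometric embeddings -/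

/-- The third derivatives `∂_l ∂_i ∂_j p` at the origin. -/
def thirdDeriv {n : ℕ} (p : MvPolynomial (Fin n) ℝ) (l : Fin n) : Matrix (Fin n) (Fin n) ℝ :=
  Matrix.of fun i j => constantCoeff (pderiv l (pderiv i (pderiv j p)))

/-- Algebraic data at a point: a regular pair `(A, h)`, a third order deformation `(v, u)` with
the induced first derivatives `B` of `A`, and a change of variables given by `c` and `S`. -/
structure DeformationJet {n m : ℕ} (h : Fin m → Matrix (Fin n) (Fin n) ℝ) where
  /-- The basis of the annihilator. -/
  A : Fin n → Matrix (Fin n) (Fin n) ℝ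
  /-- The tangential deformation. -/
  v : Fin n → MvPolynomial (Fin n) ℝ
  /-- The normal deformation. -/
  u : Fin m → MvPolynomial (Fin n) ℝ
  /-- The first derivatives of the basis of the annihilator. -/
  B : Fin n → Fin n → Matrix (Fin n) (Fin n) ℝ
  /-- The linear change of unknowns. -/
  S : Fin n → Matrix (Fin n) (Fin n) ℝ
  /-- The quadratic change of variables. -/
  c : Fin n → Fin n → Fin n → ℝ
  regular : IsRegularPair A h
  v_mem : ∀ j, v j ∈ orderIdeal n 4
  u_mem : ∀ a, u a ∈ orderIdeal n 3
  strain : ∀ i j, pderiv i (v j) + pderiv j (v i) = ∑ a, C (h a i j) * u a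
  B_symm : ∀ l, IsSymmCubic (B l)
  pair_deriv : ∀ l k a, pair (B l k) (h a) + pair (A k) (thirdDeriv (u a) l) = 0
  c_symm : ∀ i j k, c i j k = c i k j

/-- Divide by t and let s = 1/t tend to 0+: positivity is an open condition. -/
theorem IsPosForm.exists_add_smul {n : ℕ} {M M' : Matrix (Fin n) (Fin n) ℝ}
    {D D' : Fin n → Fin n → Matrix (Fin n) (Fin n) ℝ} (hM : IsPosForm M) (hD : IsPosBlockForm D) :
    ∃ t : ℝ, IsPosForm (M' + t • M) ∧ IsPosBlockForm (D' + t • D) := by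
  have h1 : ∀ᶠ s in 𝓝 (0 : ℝ), IsPosForm (M + s • M') := by
    have hc : ContinuousAt (fun s : ℝ => M + s • M') 0 := by fun_prop
    exact hc.eventually (p := fun M => IsPosForm M)
      (IsPosForm.eventually (show IsPosForm (M + (0 : ℝ) • M') by simpa using hM))
  have h2 : ∀ᶠ s in 𝓝 (0 : ℝ), IsPosBlockForm (D + s • D') := by
    have hc : ContinuousAt (fun s : ℝ => D + s • D') 0 := by fun_prop
    exact hc.eventually (p := fun M => IsPosBlockForm M)
      (IsPosBlockForm.eventually (show IsPosBlockForm (D + (0 : ℝ) • D') by simpa using hD))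
  obtain ⟨s, ⟨hs1, hs2⟩, hs⟩ := (((h1.and h2).filter_mono nhdsWithin_le_nhds).and
    (self_mem_nhdsWithin (s := Ioi (0 : ℝ)))).exists
  have hs : 0 < s := hs
  refine ⟨s⁻¹, fun ξ hξ => ?_, fun ξ hξ => ?_⟩
  · have := hs1 ξ hξ
    have e : M' + s⁻¹ • M = s⁻¹ • (M + s • M') := by
      rw [smul_add, smul_smul, inv_mul_cancel₀ hs.ne', one_smul, add_comm]
    rw [e, Matrix.smul_mulVec, dotProduct_smul, smul_eq_mul]
    positivity
  · have := hs2 ξ hξ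
    have e : D' + s⁻¹ • D = s⁻¹ • (D + s • D') := by
      rw [smul_add, smul_smul, inv_mul_cancel₀ hs.ne', one_smul, add_comm]
    rw [e]
    simp only [Pi.smul_apply, ← smul_add, Matrix.smul_mulVec, dotProduct_smul, ← Finset.smul_sum]
    simp only [Pi.add_apply, Pi.smul_apply] at this ⊢
    rw [smul_eq_mul]
    positivity

/-- For fixed A the expression is linear in (B, S, c), so a jet scaled by t adds t times its own
form to whatever B' contributes. -/
theorem symbolDeriv_add_smul {n : ℕ} (A : Fin n → Matrix (Fin n) (Fin n) ℝ)
    (B' B : Fin n → Fin n → Matrix (Fin n) (Fin n) ℝ) (S : Fin n → Matrix (Fin n) (Fin n) ℝ)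
    (c : Fin n → Fin n → Fin n → ℝ) (t : ℝ) :
    symbolDeriv A (B' + t • B) (t • S) (t • c) = B' + t • symbolDeriv A B S c := by
  funext j i
  simp only [symbolDeriv, Pi.add_apply, Pi.smul_apply, Matrix.transpose_smul, Matrix.smul_mul,
    Matrix.mul_smul, smul_add, smul_sub, Finset.smul_sum, smul_assoc]
  abel

theorem zerothForm_add_smul {n : ℕ} (A : Fin n → Matrix (Fin n) (Fin n) ℝ)
    (B' B : Fin n → Fin n → Matrix (Fin n) (Fin n) ℝ) (c : Fin n → Fin n → Fin n → ℝ) (t : ℝ) :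
    zerothForm A (B' + t • B) (t • c) = -∑ i, B' i i + t • zerothForm A B c := by
  simp only [zerothForm, Pi.add_apply, Pi.smul_apply, Finset.smul_sum, smul_sub, smul_assoc,
    ← Finset.sum_neg_distrib, ← Finset.sum_add_distrib]
  refine Finset.sum_congr rfl fun i _ => ?_
  abel

theorem constantCoeff_eq_of_sub_mem {n d : ℕ} {p q : MvPolynomial (Fin n) ℝ}
    (h : p - q ∈ orderIdeal n (d + 1)) : constantCoeff p = constantCoeff q := by
  have := mem_orderIdeal_one_iff.1 (orderIdeal_anti (by omega) h)
  rwa [map_sub, sub_eq_zero] at this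

theorem pderiv_sub_mem {n d : ℕ} {p q : MvPolynomial (Fin n) ℝ}
    (h : p - q ∈ orderIdeal n (d + 1)) (i : Fin n) : pderiv i p - pderiv i q ∈ orderIdeal n d := by
  rw [← map_sub]; exact pderiv_mem_orderIdeal i h

/-- The metric imposes cubic terms Z₃ that cannot be controlled, but t u may be added to them with t
at will. If B' compensates Z₃, the basis of the annihilator can be given the first derivatives B' +
t B. Scaling S and c by t turns each form into a fixed one plus t times a positive one. The value of
t depends only on Z₃ and the jet, so it is fixed before the formal solution is carried to order β.
-/
theorem hasSSPApproxEmbeddings_of_deformationJet {n m : ℕ} {h : Fin m → Matrix (Fin n) (Fin n) ℝ}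
    (K : DeformationJet h) (hK : IsPosBlockForm (symbolDeriv K.A K.B K.S K.c))
    (hK' : IsPosForm (zerothForm K.A K.B K.c)) {g : (Fin n → ℝ) → Matrix (Fin n) (Fin n) ℝ} {Ω₀ : Set (Fin n → ℝ)}
    (hΩ₀ : IsOpen Ω₀) (h0 : (0 : Fin n → ℝ) ∈ Ω₀) (hg : IsSmoothMetricOn g Ω₀)
    (hΓ : ∀ k i j, christoffel g k i j 0 = 0)
    (hgauss : ∀ i j k l, riemann g i j k l 0 = ∑ a, (h a i k * h a j l - h a i l * h a j k)) :
    HasSSPApproxEmbeddings g Ω₀ := by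
  intro β
  have H := K.regular
  obtain ⟨p, hp, hpg, hp0, hp1, hp2⟩ := exists_poly_metric hΩ₀ h0 hg hΓ β
  obtain ⟨L, M, hL, hLM, hLd⟩ := exists_transpose_mul_self_eq (hg.2 0 h0)
  obtain ⟨Z₃, hZ₃, hsol⟩ := H.exists_polyMetric_agree K.v_mem K.u_mem K.strain hLM hp
    (fun i j => by rw [hp0, hL]) hp1 (fun i j k l => by rw [hp2, hgauss])
  choose B' hB's hB' using fun l => H.surjective fun k a => -pair (K.A k) (thirdDeriv (Z₃ a) l)
  obtain ⟨t, ht0, ht1⟩ := IsPosForm.exists_add_smul (M' := -∑ i, B' i i) (D' := B') hK' hK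
  rw [← zerothForm_add_smul] at ht0
  rw [← symbolDeriv_add_smul] at ht1
  obtain ⟨Y, Z, hY, hZ, hYZ⟩ := hsol t β
  set B : Fin n → Fin n → Matrix (Fin n) (Fin n) ℝ := B' + t • K.B with hBdef
  let σ : Fin n ⊕ Fin m ≃ Fin (n * (n + 1) / 2) := finSumFinEquiv.trans (finCongr H.card)
  set y := polyMap σ Y Z with hy
  -- one-jets and higher jets at the origin
  have hY1 : ∀ k i, constantCoeff (pderiv i (Y k)) = L k i := fun k i => by
    rw [constantCoeff_eq_of_sub_mem (d := 0) (pderiv_sub_C_mem hY k i), constantCoeff_C]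
  have hZlow : ∀ a, Z a - quadForm (h a) ∈ orderIdeal n 3 := fun a => by
    have h1 := orderIdeal_anti (show 3 ≤ 4 by norm_num) (hZ a)
    have h2 := Submodule.add_mem _ (Submodule.add_mem _ h1 (hZ₃ a))
      (Ideal.mul_mem_left _ (C t) (K.u_mem a))
    convert h2 using 1
    ring
  have hZ1 : ∀ a i, constantCoeff (pderiv i (Z a)) = 0 := fun a i => by
    rw [constantCoeff_eq_of_sub_mem (d := 1) (pderiv_sub_linForm_mem H.h_symm hZlow a i)]
    exact mem_orderIdeal_one_iff.1 (linForm_mem _ _)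
  have hZ2 : ∀ a i j, constantCoeff (pderiv i (pderiv j (Z a))) = h a i j := fun a i j => by
    have h1 := pderiv_sub_mem (d := 1) (pderiv_sub_linForm_mem H.h_symm hZlow a j) i
    rw [constantCoeff_eq_of_sub_mem (d := 0) h1, pderiv_linForm, constantCoeff_C,
      (H.h_symm a).apply]
  have hZ3 : ∀ a l, thirdDeriv (Z a) l = thirdDeriv (Z₃ a) l + t • thirdDeriv (K.u a) l := by
    intro a l
    ext i j
    have h1 := pderiv_sub_mem (d := 1)
      (pderiv_sub_mem (d := 2) (pderiv_sub_mem (d := 3) (hZ a) j) i) l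
    have h2 := constantCoeff_eq_of_sub_mem (d := 0) h1
    simp only [thirdDeriv, Matrix.add_apply, Matrix.smul_apply, Matrix.of_apply, h2, map_add,
      pderiv_quadForm (H.h_symm a), pderiv_linForm, pderiv_C, pderiv_C_mul, smul_eq_mul,
      zero_add, map_mul, constantCoeff_C]
  have hGp : ∀ i j, p i j - polyMetric Y Z i j ∈ orderIdeal n (β + 4) := hYZ
  have hG0 : inducedMetric y 0 = g 0 := by
    ext i j
    rw [hy, inducedMetric_polyMap, ← hp0, constantCoeff_eq_of_sub_mem (hGp i j)]
    simp
  have hG1 : ∀ k i j, pd k (fun x => inducedMetric y x i j) 0 = 0 := by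
    intro k i j
    simp only [hy, inducedMetric_polyMap, pd_eval]
    rw [← hp1 i j k, constantCoeff_eq_of_sub_mem (pderiv_sub_mem (hGp i j) k)]
    simp
  have hΓy : ∀ k i j, christoffel (inducedMetric y) k i j 0 = 0 := fun k i j => by
    simp [christoffel, hG1]
  -- a neighborhood where the map is a nondegenerate embedding
  let f : (Fin n → ℝ) → (Fin n → ℝ) := fun x k => eval x (Y k)
  have hf : ContDiff ℝ 1 f := contDiff_pi.2 fun k => contDiff_eval _
  have hfpd : ∀ x, (Matrix.of fun k l => pd l (fun x => f x k) x) =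
      Matrix.of fun k l => eval x (pderiv l (Y k)) := by
    intro x
    ext k l
    simp only [f, pd_eval, Matrix.of_apply]
  obtain ⟨V₁, hV₁, h01, hemb⟩ := exists_isEmbedding_restrict hf (by
    rw [hfpd]
    convert hLd using 2
    ext k l
    simp [hY1])
  let V₂ : Set (Fin n → ℝ) := {x | (inducedMetric y x).det ≠ 0}
  let V₃ : Set (Fin n → ℝ) := {x | (Matrix.of fun k l => eval x (pderiv l (Y k))).det ≠ 0}
  have hV₂ : IsOpen V₂ := isOpen_ne.preimage (continuousOn_univ.1
    (contDiffOn_det (smoothMatOn_inducedMetric σ Y Z univ)).continuousOn)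
  have hV₃ : IsOpen V₃ := isOpen_ne.preimage (continuousOn_univ.1
    (contDiffOn_det (k := 0) (fun k l => (contDiff_eval (pderiv l (Y k))).contDiffOn)).continuousOn)
  set V := Ω₀ ∩ V₁ ∩ V₂ ∩ V₃ with hVdef
  have hV : IsOpen V := ((hΩ₀.inter hV₁).inter hV₂).inter hV₃
  have h0V : (0 : Fin n → ℝ) ∈ V := by
    refine ⟨⟨⟨h0, h01⟩, ?_⟩, ?_⟩
    · change (inducedMetric y 0).det ≠ 0
      rw [hG0]
      exact (hg.2 0 h0).det_pos.ne'
    · change (Matrix.of fun k l => eval 0 (pderiv l (Y k))).det ≠ 0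
      convert hLd using 2
      ext k l
      simp [hY1]
  have hdV : ∀ x ∈ V, (inducedMetric y x).det ≠ 0 := fun x hx => hx.1.2
  obtain ⟨Ω, 𝒜, hΩ, h0Ω, hΩV, h𝒜s, h𝒜0, hd𝒜, h𝒜symm, h𝒜F, h𝒜li, hFli⟩ :=
    H.exists_extension (B := B) (fun l => ⟨fun k i j => by
        simp only [hBdef, Pi.add_apply, Pi.smul_apply, Matrix.add_apply, Matrix.smul_apply,
          (hB's l).right k i j, (K.B_symm l).right k i j], fun k i j => by
        simp only [hBdef, Pi.add_apply, Pi.smul_apply, Matrix.add_apply, Matrix.smul_apply]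
        rw [(hB's l).left k i j, (K.B_symm l).left k i j]⟩) hV h0V
      (F := normalFF σ y) (smoothMatOn_normalFF σ Y Z hV hdV)
      (fun a => by ext i j; rw [hy, normalFF_zero σ Y Z hZ1, hZ2])
      (fun l k a => by
        have h1 : pdMat l (normalFF σ y a) 0 = thirdDeriv (Z a) l := by
          ext i j
          exact pdMat_normalFF_zero σ Y Z hV h0V hdV hZ1 hΓy a l i j
        have h2 := K.pair_deriv l k a
        rw [h1, hZ3, pair_add_right, pair_smul_right, hBdef]
        simp only [Pi.add_apply, Pi.smul_apply]
        rw [pair_add_left, pair_smul_left, hB']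
        linear_combination t * h2)
  have hspace : ∀ x ∈ Ω, spaceII y x = Submodule.span ℝ (range fun a => normalFF σ y a x) :=
    fun x hx => spaceII_polyMap σ Y Z (hdV x (hΩV hx)) (hΩV hx).2
  have hFsymm : ∀ x a, (normalFF σ y a x).IsSymm := fun x a => Matrix.IsSymm.ext fun i j => by
    have hgs : ∀ k, christoffel (inducedMetric y) k i j x = christoffel (inducedMetric y) k j i x := by
      intro k
      simp only [christoffel]
      congr 1
      refine Finset.sum_congr rfl fun l _ => ?_
      rw [show (fun y_1 => inducedMetric y y_1 i j) = fun y_1 => inducedMetric y y_1 j i from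
        funext fun z => (inducedMetric_isSymm y z).apply j i]
      ring
    simp only [hy, normalFF_apply] at hgs ⊢
    simp only [hgs, pderiv_pderiv_comm j i]
  -- Full symmetry A^{kij} = A^{ikj} makes the principal coefficients the basis matrices themselves,
  -- which is the source of their symmetry.
  have hopA : ∀ i, (reducedOp y 𝒜).A i = 𝒜 i := fun i => by
    funext x
    ext k j
    exact ((h𝒜symm x).right k i j).trans (((h𝒜symm x).left k j i).trans ((h𝒜symm x).right i j k))
  have hopA' : (fun i => (reducedOp y 𝒜).A i 0) = K.A := funext fun i => by rw [hopA, h𝒜0]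
  have hopd : (fun l i => pdMat l ((reducedOp y 𝒜).A i) 0) = B := by
    funext l i
    rw [hopA, hd𝒜]
  obtain ⟨U, hU1, hU2⟩ := exists_stronglySymmetricPositiveOn (P := reducedOp y 𝒜) (Ω := Ω)
    (c := t • K.c) (t • K.S) (fun i j k => by simp only [Pi.smul_apply, K.c_symm i j k]) hΩ h0Ω
    (fun i => by rw [hopA]; exact h𝒜s i)
    (fun k j => ContDiffOn.neg (ContDiffOn.sum fun l _ => ContDiffOn.sum fun r _ =>
      (h𝒜s k l r).mul ((contDiffOn_christoffel hV (smoothMatOn_inducedMetric σ Y Z V) hdV j l r).mono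
        hΩV)))
    (fun x _ i => by rw [hopA]; exact (h𝒜symm x).isSymm i)
    (by ext k j; simp [reducedOp, hΓy])
    (by rw [hopA', hopd]; exact ht1) (by rw [hopA', hopd]; exact ht0)
  have hcard : m = n * (n - 1) / 2 := by
    have := H.card
    rcases n with _ | n
    · simpa using this
    · have e : (n + 1) * (n + 1 + 1) = (n + 1) * (n + 1 - 1) + 2 * (n + 1) := by
        simp only [Nat.add_sub_cancel]; ring
      rw [e] at this
      omega
  refine ⟨Ω, y, 𝒜, t • K.c, t • K.S, U, fun x hx => (hΩV hx).1.1.1, ⟨hΩ, h0Ω, ⟨?_, ?_, ?_⟩, ?_, ?_⟩,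
    ⟨h𝒜s, h𝒜li, ?_, fun x _ => (h𝒜symm x).right, fun x _ => (h𝒜symm x).left⟩,
    fun i j k => by simp only [Pi.smul_apply, K.c_symm i j k], hU1, hU2⟩
  · exact (contDiff_polyMap σ Y Z).analyticOnNhd
  · have h1 := hemb Ω fun x hx => (hΩV hx).1.1.2
    -- The first n coordinates already give an embedding, hence so does the whole map.
    let π : (Fin (n * (n + 1) / 2) → ℝ) → (Fin n → ℝ) := fun w k => w (σ (Sum.inl k))
    have hπ : Continuous π := by fun_prop
    refine Topology.IsEmbedding.of_comp ((contDiff_polyMap (k := 0) σ Y Z).continuous.comp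
      continuous_subtype_val) hπ ?_
    convert h1 using 1
    funext x k
    simp [π, f, hy]
  · intro x hx
    let π : (Fin (n * (n + 1) / 2) → ℝ) →ₗ[ℝ] (Fin n → ℝ) :=
      LinearMap.funLeft ℝ ℝ fun k => σ (Sum.inl k)
    refine LinearIndependent.of_comp π ?_
    have h1 := Matrix.linearIndependent_cols_of_det_ne_zero (hΩV hx).2
    have h2 : (fun l k => eval x (pderiv l (Y k))) = π ∘ fun i => pd i y x := by
      funext l k
      simp [π, LinearMap.funLeft, hy, pd_polyMap]
    rw [← h2]
    exact h1
  · intro x hx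
    rw [hspace x hx, finrank_span_eq_card (hFli x hx), Fintype.card_fin, hcard]
  · intro r hr i j
    rw [hpg r hr i j]
    simp only [hy, inducedMetric_polyMap]
    have h1 := iteratedFDeriv_eval_eq_zero (orderIdeal_anti (show r + 1 ≤ β + 4 by omega) (hGp i j))
    have h2 : (fun x => eval x (p i j)) =
        (fun x => eval x (p i j - polyMetric Y Z i j)) + fun x => eval x (polyMetric Y Z i j) := by
      funext x; simp
    rw [h2, iteratedFDeriv_add_apply (contDiff_eval _).contDiffAt (contDiff_eval _).contDiffAt, h1,
      zero_add]
  · intro x hx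
    rw [hspace x hx]
    exact span_eq_annihilator H.card (h𝒜li x hx) (hFli x hx) (fun k => (h𝒜symm x).isSymm k)
      (hFsymm x) (h𝒜F x hx)

/-! ## Algebraic curvature tensors -/

/-- The symmetries of a curvature tensor, without the Bianchi identity. -/
structure IsCurvatureLike {n : ℕ} (T : Fin n → Fin n → Fin n → Fin n → ℝ) : Prop where
  left : ∀ i j k l, T j i k l = -T i j k l
  right : ∀ i j k l, T i j l k = -T i j k l

theorem isCurvatureLike_riemann {n : ℕ} {g : (Fin n → ℝ) → Matrix (Fin n) (Fin n) ℝ}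
    {Ω : Set (Fin n → ℝ)} (hΩ : IsOpen Ω) (h0 : (0 : Fin n → ℝ) ∈ Ω) (hg : IsSmoothMetricOn g Ω)
    (hΓ : ∀ k i j, christoffel g k i j 0 = 0) :
    IsCurvatureLike (fun i j k l => riemann g i j k l 0) ∧
      ∀ i j k l, riemann g k l i j 0 = riemann g i j k l 0 := by
  obtain ⟨p, hp, -, -, -, h⟩ := exists_poly_metric hΩ h0 hg hΓ 0
  refine ⟨⟨fun i j k l => ?_, fun i j k l => ?_⟩, fun i j k l => ?_⟩
  · linarith [h i j k l, h j i k l]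
  · linarith [h i j k l, h i j l k]
  · have h1 := h i j k l
    have h2 := h k l i j
    rw [pderiv_pderiv_comm k i, pderiv_pderiv_comm l j, pderiv_pderiv_comm k j,
      pderiv_pderiv_comm l i, hp l j, hp k i, hp l i, hp k j] at h2
    linarith

theorem isCurvatureLike_gauss {n m : ℕ} (h : Fin m → Matrix (Fin n) (Fin n) ℝ) :
    IsCurvatureLike fun i j k l => ∑ a, (h a i k * h a j l - h a i l * h a j k) where
  left i j k l := by
    rw [← Finset.sum_neg_distrib]
    exact Finset.sum_congr rfl fun a _ => by ring
  right i j k l := by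
    rw [← Finset.sum_neg_distrib]
    exact Finset.sum_congr rfl fun a _ => by ring

theorem IsCurvatureLike.ext {n : ℕ} {ι : Type*} {T T' : Fin n → Fin n → Fin n → Fin n → ℝ}
    (hT : IsCurvatureLike T) (hT' : IsCurvatureLike T') (b : ι → Fin n × Fin n)
    (hb : ∀ i j, i = j ∨ ∃ a, b a = (i, j) ∨ b a = (j, i))
    (h : ∀ a a', T (b a).1 (b a).2 (b a').1 (b a').2 = T' (b a).1 (b a).2 (b a').1 (b a').2)
    (i j k l : Fin n) : T i j k l = T' i j k l := by
  have h1 : ∀ a k l, T (b a).1 (b a).2 k l = T' (b a).1 (b a).2 k l := by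
    intro a k l
    rcases hb k l with rfl | ⟨a', ha | ha⟩
    · linarith [hT.right (b a).1 (b a).2 k k, hT'.right (b a).1 (b a).2 k k]
    · simpa [ha] using h a a'
    · have := h a a'
      simp only [ha] at this
      rw [hT.right _ _ l k, hT'.right _ _ l k, this]
  rcases hb i j with rfl | ⟨a, ha | ha⟩
  · linarith [hT.left i i k l, hT'.left i i k l]
  · simpa [ha] using h1 a k l
  · have := h1 a k l
    simp only [ha] at this
    rw [hT.left j i, hT'.left j i, this]

/-! ## Two variables -/

theorem X_mul_X_mul_X_mem {n : ℕ} (i j k : Fin n) :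
    (X i * X j * X k : MvPolynomial (Fin n) ℝ) ∈ orderIdeal n 3 :=
  mul_mem_orderIdeal (d := 2) (mul_mem_orderIdeal (d := 1) (X_mem_orderIdeal i)
    (X_mem_orderIdeal j)) (X_mem_orderIdeal k)

theorem X_mul_X_mul_X_mul_X_mem {n : ℕ} (i j k l : Fin n) :
    (X i * X j * X k * X l : MvPolynomial (Fin n) ℝ) ∈ orderIdeal n 4 :=
  mul_mem_orderIdeal (d := 3) (X_mul_X_mul_X_mem i j k) (X_mem_orderIdeal l)

theorem isSymmCubic_fin_two (a b c d : ℝ) :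
    IsSymmCubic ![!![a, b; b, c], !![b, c; c, d]] where
  right k i j := by fin_cases k <;> fin_cases i <;> fin_cases j <;> rfl
  left k i j := by fin_cases k <;> fin_cases i <;> fin_cases j <;> rfl

theorem linearIndependent_fin_two_of {A : Fin 2 → Matrix (Fin 2) (Fin 2) ℝ}
    (h : A 0 0 0 * A 1 0 1 - A 0 0 1 * A 1 0 0 ≠ 0) : LinearIndependent ℝ A := by
  rw [Fintype.linearIndependent_iff]
  intro t ht
  have h1 := congrFun (congrFun ht 0) 0
  have h2 := congrFun (congrFun ht 0) 1
  simp only [Fin.sum_univ_two, Matrix.add_apply, Matrix.smul_apply, smul_eq_mul,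
    Matrix.zero_apply] at h1 h2
  have e0 : t 0 * (A 0 0 0 * A 1 0 1 - A 0 0 1 * A 1 0 0) = 0 := by
    linear_combination A 1 0 1 * h1 - A 1 0 0 * h2
  have e1 : t 1 * (A 0 0 0 * A 1 0 1 - A 0 0 1 * A 1 0 0) = 0 := by
    linear_combination A 0 0 0 * h2 - A 0 0 1 * h1
  intro i
  fin_cases i
  · exact (mul_eq_zero.1 e0).resolve_right h
  · exact (mul_eq_zero.1 e1).resolve_right h

theorem isRegularPair_elliptic {r : ℝ} (hr : r ≠ 0) :
    IsRegularPair ![!![(1 : ℝ), 0; 0, -1], !![0, -1; -1, 0]]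
      (fun _ : Fin 1 => !![r, 0; 0, r]) where
  card := rfl
  h_symm _ := Matrix.IsSymm.ext fun i j => by fin_cases i <;> fin_cases j <;> rfl
  A_symm := isSymmCubic_fin_two 1 0 (-1) 0
  A_li := linearIndependent_fin_two_of (by simp)
  h_li := LinearIndependent.of_subsingleton 0 fun e => hr (by simpa using congrFun (congrFun e 0) 0)
  pair_eq_zero k a := by fin_cases k <;> simp [pair, Fin.sum_univ_two]
  noncharacteristic := ⟨![1, 0], by simp [Fin.sum_univ_two, Matrix.det_fin_two]⟩
  surjective τ := ⟨![!![τ 0 0 / r, 0; 0, 0], !![0, 0; 0, τ 1 0 / r]],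
    isSymmCubic_fin_two _ 0 0 _, fun k a => by
      rw [Subsingleton.elim a 0]
      fin_cases k <;> simp [pair, Fin.sum_univ_two, hr]⟩

theorem isRegularPair_hyperbolic {r : ℝ} (hr : r ≠ 0) :
    IsRegularPair ![!![(1 : ℝ), 0; 0, 1], !![0, 1; 1, 0]]
      (fun _ : Fin 1 => !![r, 0; 0, -r]) where
  card := rfl
  h_symm _ := Matrix.IsSymm.ext fun i j => by fin_cases i <;> fin_cases j <;> rfl
  A_symm := isSymmCubic_fin_two 1 0 1 0
  A_li := linearIndependent_fin_two_of (by simp)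
  h_li := LinearIndependent.of_subsingleton 0 fun e => hr (by simpa using congrFun (congrFun e 0) 0)
  pair_eq_zero k a := by fin_cases k <;> simp [pair, Fin.sum_univ_two]
  noncharacteristic := ⟨![1, 0], by simp [Fin.sum_univ_two, Matrix.det_fin_two]⟩
  surjective τ := ⟨![!![τ 0 0 / r, 0; 0, 0], !![0, 0; 0, -τ 1 0 / r]],
    isSymmCubic_fin_two _ 0 0 _, fun k a => by
      rw [Subsingleton.elim a 0]
      fin_cases k <;> simp [pair, Fin.sum_univ_two, hr]⟩

theorem pderiv_ofNat {n : ℕ} (i : Fin n) (k : ℕ) [k.AtLeastTwo] :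
    pderiv i (ofNat(k) : MvPolynomial (Fin n) ℝ) = 0 :=
  (pderiv i).map_natCast k

/-- The deformation at an elliptic point of a surface. -/
def ellipticJet {r : ℝ} (hr : r ≠ 0) : DeformationJet (fun _ : Fin 1 => !![r, 0; 0, r]) where
  A := ![!![1, 0; 0, -1], !![0, -1; -1, 0]]
  -- With z = x_0 + i x_1 this is v = r² (Re z⁴, Im z⁴) and u = 8 r Re z³. By the Cauchy-Riemann
  -- equations the strain of a holomorphic field is a multiple of the identity, hence of h.
  v := ![C (r ^ 2) * (X 0 * X 0 * X 0 * X 0 - 6 * (X 0 * X 0 * X 1 * X 1) + X 1 * X 1 * X 1 * X 1),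
    C (r ^ 2) * (4 * (X 0 * X 0 * X 0 * X 1) - 4 * (X 0 * X 1 * X 1 * X 1))]
  u _ := C r * (8 * (X 0 * X 0 * X 0) - 24 * (X 0 * X 1 * X 1))
  B := ![![!![-72, 0; 0, -24], !![0, -24; -24, 0]], ![!![0, -72; -72, 0], !![-72, 0; 0, -24]]]
  S := ![!![48, 0; 0, -144], !![0, -144; -144, 0]]
  c := 0
  regular := isRegularPair_elliptic hr
  v_mem j := by
    fin_cases j
    · exact Ideal.mul_mem_left _ _ (Submodule.add_mem _ (Submodule.sub_mem _
        (X_mul_X_mul_X_mul_X_mem 0 0 0 0) (Ideal.mul_mem_left _ _ (X_mul_X_mul_X_mul_X_mem 0 0 1 1)))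
        (X_mul_X_mul_X_mul_X_mem 1 1 1 1))
    · exact Ideal.mul_mem_left _ _ (Submodule.sub_mem _
        (Ideal.mul_mem_left _ _ (X_mul_X_mul_X_mul_X_mem 0 0 0 1))
        (Ideal.mul_mem_left _ _ (X_mul_X_mul_X_mul_X_mem 0 1 1 1)))
  u_mem _ := Ideal.mul_mem_left _ _ (Submodule.sub_mem _
    (Ideal.mul_mem_left _ _ (X_mul_X_mul_X_mem 0 0 0))
    (Ideal.mul_mem_left _ _ (X_mul_X_mul_X_mem 0 1 1)))
  strain i j := by
    fin_cases i <;> fin_cases j <;>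
      simp [Derivation.leibniz, pderiv_X, pderiv_ofNat] <;> ring
  B_symm l := by
    fin_cases l
    · exact isSymmCubic_fin_two (-72) 0 (-24) 0
    · exact isSymmCubic_fin_two 0 (-72) 0 (-24)
  pair_deriv l k a := by
    fin_cases l <;> fin_cases k <;>
      simp [pair, Fin.sum_univ_two, thirdDeriv, Derivation.leibniz, pderiv_X, pderiv_ofNat,
        map_ofNat constantCoeff] <;>
      ring
  c_symm _ _ _ := rfl

theorem isPosForm_fin_two {M : Matrix (Fin 2) (Fin 2) ℝ}
    (h : ∀ ξ, ∃ ε : ℝ, 0 < ε ∧ ε * (ξ 0 ^ 2 + ξ 1 ^ 2) ≤ ξ ⬝ᵥ (M *ᵥ ξ)) : IsPosForm M := by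
  intro ξ hξ
  obtain ⟨ε, hε, h⟩ := h ξ
  refine lt_of_lt_of_le ?_ h
  have h1 : ξ 0 ≠ 0 ∨ ξ 1 ≠ 0 := by
    by_contra! h
    exact hξ (funext fun i => by fin_cases i <;> simp [h])
  rcases h1 with h1 | h1 <;> positivity

theorem isPosBlockForm_fin_two {D : Fin 2 → Fin 2 → Matrix (Fin 2) (Fin 2) ℝ}
    (h : ∀ ξ : Fin 2 → Fin 2 → ℝ, ∃ ε : ℝ, 0 < ε ∧
      ε * (ξ 0 0 ^ 2 + ξ 0 1 ^ 2 + ξ 1 0 ^ 2 + ξ 1 1 ^ 2) ≤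
        ∑ i, ∑ j, ξ j ⬝ᵥ ((D j i + D i j) *ᵥ ξ i)) : IsPosBlockForm D := by
  intro ξ hξ
  obtain ⟨ε, hε, h⟩ := h ξ
  refine lt_of_lt_of_le ?_ h
  have h1 : ξ 0 0 ≠ 0 ∨ ξ 0 1 ≠ 0 ∨ ξ 1 0 ≠ 0 ∨ ξ 1 1 ≠ 0 := by
    by_contra! h
    exact hξ (funext fun i => funext fun j => by fin_cases i <;> fin_cases j <;> simp [h])
  rcases h1 with h1 | h1 | h1 | h1 <;> positivity

/-- `pair_deriv` fixes only the traces of the B l k. The remaining freedom and S are used to make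
the mixed blocks D_{01} and D_{10} opposite. The diagonal blocks are diag(24, 264) and diag(216,
264), counted twice in the block form, and the zeroth form is diag(144, 48); both give the constant
48. -/
theorem ellipticJet_pos {r : ℝ} (hr : r ≠ 0) :
    IsPosBlockForm (symbolDeriv (ellipticJet hr).A (ellipticJet hr).B (ellipticJet hr).S
      (ellipticJet hr).c) ∧
    IsPosForm (zerothForm (ellipticJet hr).A (ellipticJet hr).B (ellipticJet hr).c) := by
  refine ⟨isPosBlockForm_fin_two fun ξ => ?_, isPosForm_fin_two fun ξ => ?_⟩
  · refine ⟨48, by norm_num, ?_⟩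
    simp [ellipticJet, symbolDeriv, Fin.sum_univ_two, dotProduct, Matrix.mulVec, Matrix.mul_apply]
    nlinarith [sq_nonneg (ξ 0 0), sq_nonneg (ξ 0 1), sq_nonneg (ξ 1 0), sq_nonneg (ξ 1 1)]
  · refine ⟨48, by norm_num, ?_⟩
    simp [ellipticJet, zerothForm, Fin.sum_univ_two, dotProduct, Matrix.mulVec]
    nlinarith [sq_nonneg (ξ 0), sq_nonneg (ξ 1)]

/-- The deformation at a hyperbolic point of a surface. -/
def hyperbolicJet {r : ℝ} (hr : r ≠ 0) : DeformationJet (fun _ : Fin 1 => !![r, 0; 0, -r]) where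
  A := ![!![1, 0; 0, 1], !![0, 1; 1, 0]]
  -- The split-complex analogue: if j² = 1 and z = x_0 + j x_1, then u is 8 r times the real part of
  -- z³, and v is r² times the real part and minus the j part of z⁴. The minus sign matches h = r
  -- diag(1, -1).
  v := ![C (r ^ 2) * (X 0 * X 0 * X 0 * X 0 + 6 * (X 0 * X 0 * X 1 * X 1) + X 1 * X 1 * X 1 * X 1),
    C (r ^ 2) * (-4 * (X 0 * X 0 * X 0 * X 1) - 4 * (X 0 * X 1 * X 1 * X 1))]
  u _ := C r * (8 * (X 0 * X 0 * X 0) + 24 * (X 0 * X 1 * X 1))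
  B := ![![!![-192, 0; 0, -96], !![0, -96; -96, 0]], ![!![0, -192; -192, 0], !![-192, 0; 0, -96]]]
  S := ![!![96, 0; 0, 96], !![0, 96; 192, 0]]
  c := ![![![-96, 0], ![0, 192]], ![![0, 0], ![0, 0]]]
  regular := isRegularPair_hyperbolic hr
  v_mem j := by
    fin_cases j
    · exact Ideal.mul_mem_left _ _ (Submodule.add_mem _ (Submodule.add_mem _
        (X_mul_X_mul_X_mul_X_mem 0 0 0 0) (Ideal.mul_mem_left _ _ (X_mul_X_mul_X_mul_X_mem 0 0 1 1)))
        (X_mul_X_mul_X_mul_X_mem 1 1 1 1))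
    · exact Ideal.mul_mem_left _ _ (Submodule.sub_mem _
        (Ideal.mul_mem_left _ _ (X_mul_X_mul_X_mul_X_mem 0 0 0 1))
        (Ideal.mul_mem_left _ _ (X_mul_X_mul_X_mul_X_mem 0 1 1 1)))
  u_mem _ := Ideal.mul_mem_left _ _ (Submodule.add_mem _
    (Ideal.mul_mem_left _ _ (X_mul_X_mul_X_mem 0 0 0))
    (Ideal.mul_mem_left _ _ (X_mul_X_mul_X_mem 0 1 1)))
  strain i j := by
    fin_cases i <;> fin_cases j <;>
      simp [Derivation.leibniz, pderiv_X, pderiv_ofNat] <;> ring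
  B_symm l := by
    fin_cases l
    · exact isSymmCubic_fin_two (-192) 0 (-96) 0
    · exact isSymmCubic_fin_two 0 (-192) 0 (-96)
  pair_deriv l k a := by
    fin_cases l <;> fin_cases k <;>
      simp [pair, Fin.sum_univ_two, thirdDeriv, Derivation.leibniz, pderiv_X, pderiv_ofNat,
        map_ofNat constantCoeff] <;>
      ring
  c_symm i j k := by fin_cases i <;> fin_cases j <;> fin_cases k <;> rfl

/-- The mixed blocks are again opposite. The diagonal blocks are diag(96, 192) and diag(192, 96),
and the zeroth form is diag(288, 96). Here a nonzero c is used as well. -/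
theorem hyperbolicJet_pos {r : ℝ} (hr : r ≠ 0) :
    IsPosBlockForm (symbolDeriv (hyperbolicJet hr).A (hyperbolicJet hr).B (hyperbolicJet hr).S
      (hyperbolicJet hr).c) ∧
    IsPosForm (zerothForm (hyperbolicJet hr).A (hyperbolicJet hr).B (hyperbolicJet hr).c) := by
  refine ⟨isPosBlockForm_fin_two fun ξ => ?_, isPosForm_fin_two fun ξ => ?_⟩
  · refine ⟨96, by norm_num, ?_⟩
    simp [hyperbolicJet, symbolDeriv, Fin.sum_univ_two, dotProduct, Matrix.mulVec, Matrix.mul_apply]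
    nlinarith [sq_nonneg (ξ 0 0), sq_nonneg (ξ 0 1), sq_nonneg (ξ 1 0), sq_nonneg (ξ 1 1)]
  · refine ⟨96, by norm_num, ?_⟩
    simp [hyperbolicJet, zerothForm, Fin.sum_univ_two, dotProduct, Matrix.mulVec]
    nlinarith [sq_nonneg (ξ 0), sq_nonneg (ξ 1)]

theorem hasSSPApproxEmbeddings_fin_two {g : (Fin 2 → ℝ) → Matrix (Fin 2) (Fin 2) ℝ}
    {Ω : Set (Fin 2 → ℝ)} (hΩ : IsOpen Ω) (h0 : (0 : Fin 2 → ℝ) ∈ Ω) (hg : IsSmoothMetricOn g Ω)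
    (hΓ : ∀ k i j, christoffel g k i j 0 = 0) (hK : gaussCurvature g 0 ≠ 0) :
    HasSSPApproxEmbeddings g Ω := by
  have hR : riemann g 0 1 0 1 0 ≠ 0 := fun h => hK (by rw [gaussCurvature, h, zero_div])
  have hgauss : ∀ h : Fin 1 → Matrix (Fin 2) (Fin 2) ℝ,
      riemann g 0 1 0 1 0 = ∑ a, (h a 0 0 * h a 1 1 - h a 0 1 * h a 1 0) → ∀ i j k l,
      riemann g i j k l 0 = ∑ a, (h a i k * h a j l - h a i l * h a j k) := fun h hh =>
    (isCurvatureLike_riemann hΩ h0 hg hΓ).1.ext (isCurvatureLike_gauss h) (fun _ : Unit => (0, 1))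
      (by decide) fun _ _ => hh
  rcases hR.lt_or_gt with hneg | hpos
  · have hr : √(-riemann g 0 1 0 1 0) ≠ 0 := (Real.sqrt_pos.2 (by linarith)).ne'
    refine hasSSPApproxEmbeddings_of_deformationJet (hyperbolicJet hr) (hyperbolicJet_pos hr).1
      (hyperbolicJet_pos hr).2 hΩ h0 hg hΓ (hgauss _ ?_)
    have := Real.mul_self_sqrt (show 0 ≤ -riemann g 0 1 0 1 0 by linarith)
    simp
    linarith
  · have hr : √(riemann g 0 1 0 1 0) ≠ 0 := (Real.sqrt_pos.2 hpos).ne'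
    refine hasSSPApproxEmbeddings_of_deformationJet (ellipticJet hr) (ellipticJet_pos hr).1
      (ellipticJet_pos hr).2 hΩ h0 hg hΓ (hgauss _ ?_)
    have := Real.mul_self_sqrt hpos.le
    simp
    linarith

/-! ## Linear changes of frame -/

/-- Transformation of a cubic form, given as a family of matrices, under a linear map `P`. -/
def frameCubic {n : ℕ} (P : Matrix (Fin n) (Fin n) ℝ) (A : Fin n → Matrix (Fin n) (Fin n) ℝ)
    (k : Fin n) : Matrix (Fin n) (Fin n) ℝ :=
  ∑ c, P k c • (P * A c * Pᵀ)

theorem frameCubic_apply {n : ℕ} (P : Matrix (Fin n) (Fin n) ℝ)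
    (A : Fin n → Matrix (Fin n) (Fin n) ℝ) (k i j : Fin n) :
    frameCubic P A k i j = ∑ c, ∑ a, ∑ b, P k c * P i a * P j b * A c a b := by
  simp only [frameCubic, Matrix.sum_apply, Matrix.smul_apply, Matrix.mul_apply, smul_eq_mul,
    Matrix.transpose_apply, Finset.mul_sum, Finset.sum_mul]
  refine Finset.sum_congr rfl fun c _ => ?_
  rw [Finset.sum_comm]
  refine Finset.sum_congr rfl fun a _ => Finset.sum_congr rfl fun b _ => ?_
  ring

theorem IsSymmCubic.frame {n : ℕ} {A : Fin n → Matrix (Fin n) (Fin n) ℝ} (hA : IsSymmCubic A)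
    (P : Matrix (Fin n) (Fin n) ℝ) : IsSymmCubic (frameCubic P A) where
  right k i j := by
    rw [frameCubic_apply, frameCubic_apply]
    refine Finset.sum_congr rfl fun c _ => ?_
    rw [Finset.sum_comm]
    refine Finset.sum_congr rfl fun a _ => Finset.sum_congr rfl fun b _ => ?_
    rw [hA.right c a b]
    ring
  left k i j := by
    rw [frameCubic_apply, frameCubic_apply]
    have h : ∀ F : Fin n → Fin n → Fin n → ℝ,
        ∑ c, ∑ a, ∑ b, F c a b = ∑ c, ∑ a, ∑ b, F b a c := fun F => by
      rw [Finset.sum_comm, Finset.sum_congr rfl fun a _ => Finset.sum_comm, Finset.sum_comm]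
    rw [h]
    refine Finset.sum_congr rfl fun c _ => Finset.sum_congr rfl fun a _ =>
      Finset.sum_congr rfl fun b _ => ?_
    rw [hA.left b a c]
    ring

theorem IsSymmCubic.sum_smul {n : ℕ} {ι : Type*} {s : Finset ι} {t : ι → ℝ}
    {B : ι → Fin n → Matrix (Fin n) (Fin n) ℝ} (hB : ∀ a, IsSymmCubic (B a)) :
    IsSymmCubic fun k => ∑ a ∈ s, t a • B a k where
  right k i j := by
    simp only [Matrix.sum_apply, Matrix.smul_apply]
    exact Finset.sum_congr rfl fun a _ => congrArg _ ((hB a).right k i j)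
  left k i j := by
    simp only [Matrix.sum_apply, Matrix.smul_apply]
    exact Finset.sum_congr rfl fun a _ => congrArg _ ((hB a).left k i j)

theorem pair_eq_trace {n : ℕ} (M N : Matrix (Fin n) (Fin n) ℝ) : pair M N = (Mᵀ * N).trace := by
  simp only [pair, Matrix.trace, Matrix.diag_apply, Matrix.mul_apply, Matrix.transpose_apply]
  exact Finset.sum_comm

section Frame

variable {n m : ℕ} {P Q : Matrix (Fin n) (Fin n) ℝ}

theorem pair_frame (hQP : Q * P = 1) (M N : Matrix (Fin n) (Fin n) ℝ) :
    pair (P * M * Pᵀ) (Qᵀ * N * Q) = pair M N := by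
  have h : (P * M * Pᵀ)ᵀ * (Qᵀ * N * Q) = P * (Mᵀ * (Q * P)ᵀ * N * Q) := by
    simp only [Matrix.transpose_mul, Matrix.transpose_transpose, mul_assoc]
  rw [pair_eq_trace, pair_eq_trace, h, Matrix.trace_mul_comm, hQP, Matrix.transpose_one, mul_one,
    mul_assoc _ Q P, hQP, mul_one]

theorem pair_frameCubic (hQP : Q * P = 1) (A : Fin n → Matrix (Fin n) (Fin n) ℝ)
    (N : Matrix (Fin n) (Fin n) ℝ) (k : Fin n) :
    pair (frameCubic P A k) (Qᵀ * N * Q) = ∑ c, P k c * pair (A c) N := by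
  rw [frameCubic, pair_sum_left]
  exact Finset.sum_congr rfl fun c _ => by rw [pair_smul_left, pair_frame hQP]

theorem sum_mul_of_mul_eq_one (hPQ : P * Q = 1) (a b : Fin n) :
    ∑ i, P a i * Q i b = if a = b then 1 else 0 := by
  rw [← Matrix.mul_apply, hPQ, Matrix.one_apply]

theorem IsRegularPair.frame {A : Fin n → Matrix (Fin n) (Fin n) ℝ}
    {h : Fin m → Matrix (Fin n) (Fin n) ℝ} (H : IsRegularPair A h) (hPQ : P * Q = 1) :
    IsRegularPair (frameCubic P A) fun a => Qᵀ * h a * Q := by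
  have hQP : Q * P = 1 := mul_eq_one_comm.1 hPQ
  have hconj : ∀ {P Q M : Matrix (Fin n) (Fin n) ℝ}, Q * P = 1 → P * M * Pᵀ = 0 → M = 0 := by
    intro P Q M hQP hM
    have : Q * (P * M * Pᵀ) * Qᵀ = (Q * P) * M * (Q * P)ᵀ := by
      simp only [Matrix.transpose_mul, mul_assoc]
    rw [hM, hQP] at this
    simpa using this.symm
  refine ⟨H.card, fun a => ?_, H.A_symm.frame P, ?_, ?_, fun k a => ?_, ?_, fun τ => ?_⟩
  · rw [Matrix.IsSymm, Matrix.transpose_mul, Matrix.transpose_mul, Matrix.transpose_transpose,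
      (H.h_symm a).eq, mul_assoc]
  · rw [Fintype.linearIndependent_iff]
    intro t ht
    have h1 : P * (∑ c, (∑ k, t k * P k c) • A c) * Pᵀ = 0 := by
      rw [← ht]
      simp only [frameCubic, Finset.smul_sum, Finset.sum_smul, Matrix.mul_sum, Matrix.sum_mul,
        Matrix.mul_smul, Matrix.smul_mul, smul_smul]
      exact Finset.sum_comm
    have h2 := Fintype.linearIndependent_iff.1 H.A_li _ (hconj hQP h1)
    intro k
    have h3 : t = (t ᵥ* P) ᵥ* Q := by rw [Matrix.vecMul_vecMul, hPQ, Matrix.vecMul_one]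
    have h4 : t ᵥ* P = 0 := funext h2
    rw [h3, h4, Matrix.zero_vecMul, Pi.zero_apply]
  · rw [Fintype.linearIndependent_iff]
    intro t ht
    have h1 : Qᵀ * (∑ a, t a • h a) * Qᵀᵀ = 0 := by
      rw [← ht, Matrix.transpose_transpose]
      simp only [Matrix.mul_sum, Matrix.sum_mul, Matrix.mul_smul, Matrix.smul_mul]
    exact Fintype.linearIndependent_iff.1 H.h_li _
      (hconj (Q := Pᵀ) (by rw [← Matrix.transpose_mul, hQP, Matrix.transpose_one]) h1)
  · rw [pair_frameCubic hQP]
    simp [H.pair_eq_zero]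
  · obtain ⟨ξ, hξ⟩ := H.noncharacteristic
    refine ⟨ξ ᵥ* Q, ?_⟩
    have h1 : ∑ i, (ξ ᵥ* Q) i • frameCubic P A i = P * (∑ c, ξ c • A c) * Pᵀ := by
      have h2 : ξ = (ξ ᵥ* Q) ᵥ* P := by rw [Matrix.vecMul_vecMul, hQP, Matrix.vecMul_one]
      conv_rhs => rw [h2]
      simp only [frameCubic, Matrix.vecMul, dotProduct, Finset.smul_sum, Finset.sum_smul,
        Matrix.mul_sum, Matrix.sum_mul, Matrix.mul_smul, Matrix.smul_mul, smul_smul]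
      exact Finset.sum_comm
    rw [h1, Matrix.det_mul, Matrix.det_mul, Matrix.det_transpose]
    have hP : IsUnit P.det := Matrix.isUnit_det_of_right_inverse hPQ
    exact (hP.mul hξ).mul hP
  · obtain ⟨N, hNs, hN⟩ := H.surjective fun b a => ∑ k, Q b k * τ k a
    refine ⟨frameCubic P N, hNs.frame P, fun k a => ?_⟩
    rw [pair_frameCubic hQP]
    simp only [hN, Finset.mul_sum, ← mul_assoc]
    rw [Finset.sum_comm]
    simp only [← Finset.sum_mul, sum_mul_of_mul_eq_one hPQ]
    simp

/-- Linear substitution of variables. -/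
def substLin (Q : Matrix (Fin n) (Fin n) ℝ) : MvPolynomial (Fin n) ℝ →ₐ[ℝ] MvPolynomial (Fin n) ℝ :=
  aeval (linForm Q)

theorem pderiv_substLin (Q : Matrix (Fin n) (Fin n) ℝ) (i : Fin n) (p : MvPolynomial (Fin n) ℝ) :
    pderiv i (substLin Q p) = ∑ a, C (Q a i) * substLin Q (pderiv a p) := by
  induction p using MvPolynomial.induction_on with
  | C r => simp [substLin]
  | add p q hp hq => simp only [map_add, hp, hq, mul_add, Finset.sum_add_distrib]
  | mul_X p j hp =>
    simp only [map_mul, Derivation.leibniz, hp, smul_eq_mul, map_add, mul_add,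
      Finset.sum_add_distrib]
    have h1 : substLin Q (X j) = linForm Q j := by simp [substLin]
    rw [h1, pderiv_linForm]
    have h2 : ∀ a, C (Q a i) * (substLin Q p * substLin Q (pderiv a (X j : MvPolynomial (Fin n) ℝ)))
        = if a = j then substLin Q p * C (Q j i) else 0 := by
      intro a
      by_cases h : a = j
      · subst h; simp [mul_comm]
      · simp [pderiv_X_of_ne (Ne.symm h), h]
    simp only [h2, Finset.sum_ite_eq', Finset.mem_univ, if_true, Finset.mul_sum]
    congr 1
    exact Finset.sum_congr rfl fun a _ => by ring

theorem substLin_mem {d : ℕ} (Q : Matrix (Fin n) (Fin n) ℝ) {p : MvPolynomial (Fin n) ℝ}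
    (hp : p ∈ orderIdeal n d) : substLin Q p ∈ orderIdeal n d := by
  have h1 : Ideal.map (substLin Q) (idealOfVars (Fin n) ℝ) ≤ idealOfVars (Fin n) ℝ := by
    rw [idealOfVars, Ideal.map_span, Ideal.span_le]
    rintro _ ⟨_, ⟨j, rfl⟩, rfl⟩
    have := linForm_mem Q j
    rw [orderIdeal, pow_one] at this
    simpa [substLin] using this
  have h2 := Ideal.mem_map_of_mem (substLin Q) hp
  rw [orderIdeal, Ideal.map_pow] at h2
  exact Ideal.pow_right_mono h1 d h2

theorem constantCoeff_substLin (Q : Matrix (Fin n) (Fin n) ℝ) (p : MvPolynomial (Fin n) ℝ) :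
    constantCoeff (substLin Q p) = constantCoeff p := by
  induction p using MvPolynomial.induction_on with
  | C r => simp [substLin]
  | add p q hp hq => simp only [map_add, hp, hq]
  | mul_X p j hp =>
    have := mem_orderIdeal_one_iff.1 (linForm_mem Q j)
    simp [map_mul, substLin, this]

theorem thirdDeriv_substLin (Q : Matrix (Fin n) (Fin n) ℝ) (p : MvPolynomial (Fin n) ℝ)
    (l : Fin n) : thirdDeriv (substLin Q p) l = Qᵀ * (∑ b, Q b l • thirdDeriv p b) * Q := by
  ext i j
  simp only [thirdDeriv, Matrix.of_apply, pderiv_substLin, map_sum, pderiv_C_mul,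
    map_mul, constantCoeff_C, constantCoeff_substLin, Matrix.mul_apply, Matrix.sum_apply,
    Matrix.transpose_apply, Matrix.smul_apply, smul_eq_mul, Finset.mul_sum, Finset.sum_mul]
  refine Finset.sum_congr rfl fun a _ => ?_
  rw [Finset.sum_comm]
  refine Finset.sum_congr rfl fun b _ => Finset.sum_congr rfl fun c _ => ?_
  ring

/-- Transformation of a deformation jet under a linear change of frame. -/
def DeformationJet.frame {h : Fin m → Matrix (Fin n) (Fin n) ℝ} (K : DeformationJet h)
    (hPQ : P * Q = 1) : DeformationJet fun a => Qᵀ * h a * Q where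
  A := frameCubic P K.A
  v j := ∑ b, C (Q b j) * substLin Q (K.v b)
  u a := substLin Q (K.u a)
  B l k := ∑ b, Q b l • frameCubic P (K.B b) k
  S l := ∑ b, Q b l • (Qᵀ * K.S b * Pᵀ)
  c i j k := ∑ a, ∑ b, ∑ d, P i a * Q b j * Q d k * K.c a b d
  regular := K.regular.frame hPQ
  v_mem j := Ideal.sum_mem _ fun b _ => Ideal.mul_mem_left _ _ (substLin_mem Q (K.v_mem b))
  u_mem a := substLin_mem Q (K.u_mem a)
  strain i j := by
    have h1 : ∀ i j, pderiv i (∑ b, C (Q b j) * substLin Q (K.v b)) =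
        ∑ a, ∑ b, C (Q a i) * C (Q b j) * substLin Q (pderiv a (K.v b)) := by
      intro i j
      simp only [map_sum, pderiv_C_mul, pderiv_substLin, Finset.mul_sum]
      rw [Finset.sum_comm]
      exact Finset.sum_congr rfl fun a _ => Finset.sum_congr rfl fun b _ => by ring
    have h2 : ∀ a b, substLin Q (pderiv a (K.v b)) + substLin Q (pderiv b (K.v a)) =
        ∑ α, C (h α a b) * substLin Q (K.u α) := by
      intro a b
      rw [← map_add, K.strain, map_sum]
      exact Finset.sum_congr rfl fun α _ => by rw [map_mul]; simp [substLin]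
    rw [h1, h1 j i, Finset.sum_comm (f := fun a b => C (Q a j) * C (Q b i) * _),
      ← Finset.sum_add_distrib]
    have h3 : ∀ a b, C (Q a i) * C (Q b j) * substLin Q (pderiv a (K.v b)) +
        C (Q b j) * C (Q a i) * substLin Q (pderiv b (K.v a)) =
        ∑ α, C (Q a i * h α a b * Q b j) * substLin Q (K.u α) := by
      intro a b
      rw [mul_comm (C (Q b j)), ← mul_add, h2, Finset.mul_sum]
      refine Finset.sum_congr rfl fun α _ => ?_
      simp only [map_mul]
      ring
    simp only [← Finset.sum_add_distrib, h3]
    rw [Finset.sum_congr rfl fun a _ => Finset.sum_comm, Finset.sum_comm]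
    refine Finset.sum_congr rfl fun α _ => ?_
    simp only [← Finset.sum_mul, ← map_sum]
    congr 2
    simp only [Matrix.mul_apply, Matrix.transpose_apply, Finset.sum_mul]
    exact Finset.sum_comm
  B_symm l := IsSymmCubic.sum_smul fun b => (K.B_symm b).frame P
  pair_deriv l k a := by
    have hQP : Q * P = 1 := mul_eq_one_comm.1 hPQ
    rw [thirdDeriv_substLin, pair_sum_left, pair_frameCubic hQP]
    simp only [pair_smul_left, pair_frameCubic hQP, pair_sum_right, pair_smul_right, Finset.mul_sum]
    rw [Finset.sum_comm, ← Finset.sum_add_distrib]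
    refine Finset.sum_eq_zero fun c _ => ?_
    rw [← Finset.sum_add_distrib]
    refine Finset.sum_eq_zero fun b _ => ?_
    linear_combination Q b l * P k c * K.pair_deriv b c a
  c_symm i j k := by
    refine Finset.sum_congr rfl fun a _ => ?_
    rw [Finset.sum_comm]
    refine Finset.sum_congr rfl fun b _ => Finset.sum_congr rfl fun d _ => ?_
    rw [K.c_symm a d b]
    ring

/-- The symbol derivative behaves as a tensor, covariant in j and contravariant in i. The
symmetrization in `IsPosBlockForm` mixes the two variances, so its positivity is not automatic in a
new frame; `IsPosBlockForm.eventually_frame` secures it near the identity. -/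
theorem symbolDeriv_frame {h : Fin m → Matrix (Fin n) (Fin n) ℝ} (K : DeformationJet h)
    (hPQ : P * Q = 1) (j i : Fin n) :
    symbolDeriv (K.frame hPQ).A (K.frame hPQ).B (K.frame hPQ).S (K.frame hPQ).c j i =
      ∑ b, ∑ a, (Q b j * P i a) • (P * symbolDeriv K.A K.B K.S K.c b a * Pᵀ) := by
  have hQP : Q * P = 1 := mul_eq_one_comm.1 hPQ
  have hQP' : Pᵀ * Qᵀ = 1 := by rw [← Matrix.transpose_mul, hQP, Matrix.transpose_one]
  have h1 : (∑ b, Q b j • (Qᵀ * K.S b * Pᵀ))ᵀ * frameCubic P K.A i =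
      ∑ b, ∑ a, (Q b j * P i a) • (P * ((K.S b)ᵀ * K.A a) * Pᵀ) := by
    rw [frameCubic, Matrix.transpose_sum, Matrix.sum_mul]
    refine Finset.sum_congr rfl fun b _ => ?_
    rw [Matrix.mul_sum]
    refine Finset.sum_congr rfl fun a _ => ?_
    rw [Matrix.transpose_smul, Matrix.smul_mul, Matrix.mul_smul, smul_smul]
    congr 1
    simp only [Matrix.transpose_mul, Matrix.transpose_transpose, ← mul_assoc]
    rw [mul_assoc (P * (K.S b)ᵀ) Q P, hQP, mul_one]
  have h2 : frameCubic P K.A i * (∑ b, Q b j • (Qᵀ * K.S b * Pᵀ)) =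
      ∑ b, ∑ a, (Q b j * P i a) • (P * (K.A a * K.S b) * Pᵀ) := by
    rw [frameCubic, Matrix.mul_sum]
    refine Finset.sum_congr rfl fun b _ => ?_
    rw [Matrix.sum_mul]
    refine Finset.sum_congr rfl fun a _ => ?_
    rw [Matrix.smul_mul, Matrix.mul_smul, smul_smul, mul_comm (P i a)]
    congr 1
    simp only [← mul_assoc]
    rw [mul_assoc (P * K.A a) Pᵀ Qᵀ, hQP', mul_one]
  have h3 : ∑ r, (∑ a, ∑ b, ∑ d, P i a * Q b r * Q d j * K.c a b d) • frameCubic P K.A r =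
      ∑ b, ∑ a, (Q b j * P i a) • (P * (∑ r, K.c a r b • K.A r) * Pᵀ) := by
    have h4 : ∀ a b d, ∑ r, (P i a * Q b r * Q d j * K.c a b d) • frameCubic P K.A r =
        (P i a * Q d j * K.c a b d) • (P * K.A b * Pᵀ) := by
      intro a b d
      simp only [frameCubic, Finset.smul_sum, smul_smul]
      rw [Finset.sum_comm]
      have h5 : ∀ e, ∑ r, (P i a * Q b r * Q d j * K.c a b d * P r e) • (P * K.A e * Pᵀ) =
          if b = e then (P i a * Q d j * K.c a b d) • (P * K.A b * Pᵀ) else 0 := by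
        intro e
        rw [← Finset.sum_smul]
        have h6 : ∑ r, P i a * Q b r * Q d j * K.c a b d * P r e =
            (P i a * Q d j * K.c a b d) * ∑ r, Q b r * P r e := by
          rw [Finset.mul_sum]
          exact Finset.sum_congr rfl fun r _ => by ring
        rw [h6, sum_mul_of_mul_eq_one hQP]
        by_cases hbe : b = e
        · subst hbe; simp
        · simp [hbe]
      simp [h5]
    simp only [Finset.sum_smul]
    rw [Finset.sum_comm, Finset.sum_comm (s := Finset.univ (α := Fin n))
      (f := fun b a => (Q b j * P i a) • (P * (∑ r, K.c a r b • K.A r) * Pᵀ))]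
    refine Finset.sum_congr rfl fun a _ => ?_
    rw [Finset.sum_comm]
    have h7 : ∀ d, (Q d j * P i a) • (P * (∑ r, K.c a r d • K.A r) * Pᵀ) =
        ∑ b, (P i a * Q d j * K.c a b d) • (P * K.A b * Pᵀ) := by
      intro d
      simp only [Matrix.mul_sum, Matrix.sum_mul, Matrix.mul_smul, Matrix.smul_mul, Finset.smul_sum,
        smul_smul]
      exact Finset.sum_congr rfl fun b _ => by rw [mul_comm (Q d j)]
    simp only [h7]
    rw [Finset.sum_comm (s := Finset.univ (α := Fin n)) (f := fun d b =>
      (P i a * Q d j * K.c a b d) • (P * K.A b * Pᵀ))]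
    refine Finset.sum_congr rfl fun b _ => ?_
    rw [Finset.sum_comm]
    exact Finset.sum_congr rfl fun d _ => h4 a b d
  have h8 : ∑ b, Q b j • frameCubic P (K.B b) i =
      ∑ b, ∑ a, (Q b j * P i a) • (P * K.B b a * Pᵀ) := by
    simp only [frameCubic, Finset.smul_sum, smul_smul]
  simp only [symbolDeriv, DeformationJet.frame]
  rw [h1, h2, h3, h8]
  simp only [← Finset.sum_add_distrib, ← Finset.sum_sub_distrib, ← smul_add, ← smul_sub,
    ← Matrix.mul_add, ← Matrix.add_mul, ← Matrix.mul_sub, ← Matrix.sub_mul]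

theorem zerothForm_frame {h : Fin m → Matrix (Fin n) (Fin n) ℝ} (K : DeformationJet h)
    (hPQ : P * Q = 1) :
    zerothForm (K.frame hPQ).A (K.frame hPQ).B (K.frame hPQ).c =
      P * zerothForm K.A K.B K.c * Pᵀ := by
  have hQP : Q * P = 1 := mul_eq_one_comm.1 hPQ
  -- the zeroth form is a trace of the symbol derivative with vanishing linear change of unknowns
  have key : ∀ {h : Fin m → Matrix (Fin n) (Fin n) ℝ} (K : DeformationJet h),
      zerothForm K.A K.B K.c = -∑ i, symbolDeriv K.A K.B 0 K.c i i := fun K => by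
    simp [zerothForm, symbolDeriv]
  let K' : DeformationJet h := { K with S := 0 }
  have h1 : symbolDeriv (K.frame hPQ).A (K.frame hPQ).B 0 (K.frame hPQ).c =
      symbolDeriv (K'.frame hPQ).A (K'.frame hPQ).B (K'.frame hPQ).S (K'.frame hPQ).c := by
    have : (K'.frame hPQ).S = 0 := by
      funext l; simp [DeformationJet.frame, K']
    rw [this]
    rfl
  rw [key, key K, h1]
  simp only [symbolDeriv_frame, Matrix.mul_neg, Matrix.neg_mul, Matrix.mul_sum, Matrix.sum_mul]
  congr 1
  rw [Finset.sum_comm]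
  refine Finset.sum_congr rfl fun b _ => ?_
  rw [Finset.sum_comm]
  simp only [← Finset.sum_smul, sum_mul_of_mul_eq_one hQP]
  simp
  rfl

end Frame

theorem IsPosForm.conj {n : ℕ} {M P Q : Matrix (Fin n) (Fin n) ℝ} (hM : IsPosForm M)
    (hPQ : P * Q = 1) : IsPosForm (P * M * Pᵀ) := by
  intro ξ hξ
  have h1 : ξ ᵥ* P ≠ 0 := fun h => hξ (by
    rw [← Matrix.vecMul_one ξ, ← hPQ, ← Matrix.vecMul_vecMul, h, Matrix.zero_vecMul])
  have := hM _ h1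
  rwa [← Matrix.mulVec_mulVec, ← Matrix.mulVec_mulVec, Matrix.dotProduct_mulVec,
    Matrix.mulVec_transpose]

theorem eventually_inv_mul_eq_one {n : ℕ} :
    ∀ᶠ Q in 𝓝 (1 : Matrix (Fin n) (Fin n) ℝ), Q⁻¹ * Q = 1 := by
  have h : ∀ᶠ Q in 𝓝 (1 : Matrix (Fin n) (Fin n) ℝ), Q.det ≠ 0 :=
    (Continuous.matrix_det continuous_id).continuousAt.eventually_ne (by simp)
  exact h.mono fun Q hQ => Matrix.nonsing_inv_mul Q (isUnit_iff_ne_zero.2 hQ)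

theorem continuousAt_matrix_inv {n : ℕ} {M : Matrix (Fin n) (Fin n) ℝ} (hM : M.det ≠ 0) :
    ContinuousAt (fun Q : Matrix (Fin n) (Fin n) ℝ => Q⁻¹) M := by
  simp only [Matrix.inv_def, Ring.inverse_eq_inv]
  exact ((Continuous.matrix_det continuous_id).continuousAt.inv₀ hM).smul
    (Continuous.matrix_adjugate continuous_id).continuousAt

/-- Positivity of the block form survives small changes of frame and of the coefficients. -/
theorem IsPosBlockForm.eventually_frame {n : ℕ} {D : Fin n → Fin n → Matrix (Fin n) (Fin n) ℝ}
    (hD : IsPosBlockForm D) : ∀ᶠ Q in 𝓝 (1 : Matrix (Fin n) (Fin n) ℝ), ∀ᶠ D' in 𝓝 D,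
      IsPosBlockForm fun j i => ∑ b, ∑ a, (Q b j * Q⁻¹ i a) • (Q⁻¹ * D' b a * (Q⁻¹)ᵀ) := by
  -- Currying a joint neighborhood allows the frame to be fixed first and the coefficients to be
  -- brought close to D afterwards.
  refine Filter.Eventually.curry_nhds (p := fun x : Matrix (Fin n) (Fin n) ℝ ×
    (Fin n → Fin n → Matrix (Fin n) (Fin n) ℝ) => IsPosBlockForm fun j i =>
      ∑ b, ∑ a, (x.1 b j * x.1⁻¹ i a) • (x.1⁻¹ * x.2 b a * (x.1⁻¹)ᵀ)) ?_
  have hinv : ContinuousAt (fun x : Matrix (Fin n) (Fin n) ℝ ×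
      (Fin n → Fin n → Matrix (Fin n) (Fin n) ℝ) => x.1⁻¹) (1, D) :=
    ContinuousAt.comp (g := fun Q : Matrix (Fin n) (Fin n) ℝ => Q⁻¹)
      (continuousAt_matrix_inv (by simp))
      continuousAt_fst
  have hcont : ContinuousAt (fun x : Matrix (Fin n) (Fin n) ℝ ×
      (Fin n → Fin n → Matrix (Fin n) (Fin n) ℝ) => fun j i =>
      ∑ b, ∑ a, (x.1 b j * x.1⁻¹ i a) • (x.1⁻¹ * x.2 b a * (x.1⁻¹)ᵀ)) (1, D) := by
    refine continuousAt_pi.2 fun j => continuousAt_pi.2 fun i => tendsto_finsetSum _ fun b _ =>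
      tendsto_finsetSum _ fun a _ => ?_
    have e1 : ContinuousAt (fun x : Matrix (Fin n) (Fin n) ℝ ×
      (Fin n → Fin n → Matrix (Fin n) (Fin n) ℝ) => x.1 b j) (1, D) := by fun_prop
    have e2 : ContinuousAt (fun x : Matrix (Fin n) (Fin n) ℝ ×
      (Fin n → Fin n → Matrix (Fin n) (Fin n) ℝ) => x.1⁻¹ i a) (1, D) :=
      continuousAt_pi.1 (continuousAt_pi.1 hinv i) a
    have e3 : ContinuousAt (fun x : Matrix (Fin n) (Fin n) ℝ ×
      (Fin n → Fin n → Matrix (Fin n) (Fin n) ℝ) => x.2 b a) (1, D) := by fun_prop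
    have e4 : ContinuousAt (fun x : Matrix (Fin n) (Fin n) ℝ ×
        (Fin n → Fin n → Matrix (Fin n) (Fin n) ℝ) => (x.1⁻¹)ᵀ) (1, D) :=
      continuous_id.matrix_transpose.continuousAt.comp hinv
    exact (e1.mul e2).smul ((hinv.mul e3).mul e4)
  refine hcont.eventually (p := fun D => IsPosBlockForm D) (IsPosBlockForm.eventually ?_)
  convert hD using 3 with j i
  simp [Matrix.one_apply]

/-! ## Deformation jets in three variables -/

/-- The symmetric cubic form with components `m k i = N^{kii}` and `e = N^{123}`. -/
def cubicOf (m : Matrix (Fin 3) (Fin 3) ℝ) (e : ℝ) : Fin 3 → Matrix (Fin 3) (Fin 3) ℝ :=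
  ![!![m 0 0, m 1 0, m 2 0; m 1 0, m 0 1, e; m 2 0, e, m 0 2],
    !![m 1 0, m 0 1, e; m 0 1, m 1 1, m 2 1; e, m 2 1, m 1 2],
    !![m 2 0, e, m 0 2; e, m 2 1, m 1 2; m 0 2, m 1 2, m 2 2]]

theorem isSymmCubic_cubicOf (m : Matrix (Fin 3) (Fin 3) ℝ) (e : ℝ) : IsSymmCubic (cubicOf m e) where
  right k i j := by fin_cases k <;> fin_cases i <;> fin_cases j <;> rfl
  left k i j := by fin_cases k <;> fin_cases i <;> fin_cases j <;> rfl

/-- The cubic form with `A^{123} = 1` and `A^{iii} = 2 t_i`. -/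
def diagCubic (t : Fin 3 → ℝ) : Fin 3 → Matrix (Fin 3) (Fin 3) ℝ :=
  cubicOf (Matrix.diagonal fun i => 2 * t i) 1

/-- Second fundamental forms annihilated by `diagCubic t`; the rows of `V` are the vectors
`H_{ii}`, and `H_{jk} = - t_i H_{ii}` for distinct `i, j, k`. -/
def diagFF (t : Fin 3 → ℝ) (V : Matrix (Fin 3) (Fin 3) ℝ) (a : Fin 3) : Matrix (Fin 3) (Fin 3) ℝ :=
  !![V 0 a, -(t 2 * V 2 a), -(t 1 * V 1 a); -(t 2 * V 2 a), V 1 a, -(t 0 * V 0 a);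
    -(t 1 * V 1 a), -(t 0 * V 0 a), V 2 a]

theorem pair_diagFF (t : Fin 3 → ℝ) (V : Matrix (Fin 3) (Fin 3) ℝ) (M : Matrix (Fin 3) (Fin 3) ℝ)
    (a : Fin 3) : pair M (diagFF t V a) =
      ∑ q, V q a * (M q q - t q * (M (q + 1) (q + 2) + M (q + 2) (q + 1))) := by
  simp [pair, Fin.sum_univ_three, diagFF]
  ring

theorem pair_diagCubic (t : Fin 3 → ℝ) (M : Matrix (Fin 3) (Fin 3) ℝ) (k : Fin 3) :
    pair (diagCubic t k) M = 2 * t k * M k k + M (k + 1) (k + 2) + M (k + 2) (k + 1) := by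
  fin_cases k <;> simp [pair, Fin.sum_univ_three, diagCubic, cubicOf] <;> ring

/-- The solution `N` of `N^{kii} - 2 t_i N^{kjl} = σ_{ki}` with `N^{123} = 0`. -/
def solveCubic (t : Fin 3 → ℝ) (d : ℝ) (σ : Matrix (Fin 3) (Fin 3) ℝ) :
    Fin 3 → Matrix (Fin 3) (Fin 3) ℝ :=
  cubicOf (Matrix.of fun k i => if k = i then σ k k else
    d * (σ k i + 2 * t i * σ (-(k + i)) k + 4 * t i * t k * σ i (-(k + i)))) 0

/-- For k ≠ i let p = -(k + i), the third index, since 0 + 1 + 2 = 0 in `Fin 3`, and put m(k,i) =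
N^{kii}. The equation reads m(k,i) = σ_{ki} + 2 t_i m(p,k). Three iterations return to m(k,i) with
factor 8 t_0 t_1 t_2, whence the formula and the role of d. For k = i it is immediate because
N^{123} = 0. -/
theorem pair_solveCubic {t : Fin 3 → ℝ} {d : ℝ} (hd : d * (1 - 8 * (t 0 * t 1 * t 2)) = 1)
    (V σ : Matrix (Fin 3) (Fin 3) ℝ) (k a : Fin 3) :
    pair (solveCubic t d σ k) (diagFF t V a) = (σ * V) k a := by
  rw [pair_diagFF, Matrix.mul_apply]
  refine Finset.sum_congr rfl fun q _ => ?_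
  rw [mul_comm]
  congr 1
  fin_cases k <;> fin_cases q <;> simp [solveCubic, cubicOf, show (-1 : Fin 3) = 2 from rfl,
    show (-2 : Fin 3) = 1 from rfl]
  · linear_combination σ 0 1 * hd
  · linear_combination σ 0 2 * hd
  · linear_combination σ 1 0 * hd
  · linear_combination σ 1 2 * hd
  · linear_combination σ 2 0 * hd
  · linear_combination σ 2 1 * hd

/-- Independence of the A^k comes from A^{123} = 1 and that of the h^a from the invertibility of V.
The first coordinate covector is noncharacteristic because det A^1 = -2 t_1 in one-based indices. -/
theorem isRegularPair_diag {t : Fin 3 → ℝ} {d : ℝ} (hd : d * (1 - 8 * (t 0 * t 1 * t 2)) = 1)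
    (ht : t 0 ≠ 0) {V W : Matrix (Fin 3) (Fin 3) ℝ} (hVW : V * W = 1) :
    IsRegularPair (diagCubic t) (diagFF t V) where
  card := rfl
  h_symm a := Matrix.IsSymm.ext fun i j => by fin_cases i <;> fin_cases j <;> rfl
  A_symm := isSymmCubic_cubicOf _ _
  A_li := by
    rw [Fintype.linearIndependent_iff]
    intro r hr
    have h1 := congrFun (congrFun hr 1) 2
    have h2 := congrFun (congrFun hr 0) 2
    have h3 := congrFun (congrFun hr 0) 1
    simp [Fin.sum_univ_three, diagCubic, cubicOf] at h1 h2 h3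
    intro i
    fin_cases i <;> assumption
  h_li := by
    rw [Fintype.linearIndependent_iff]
    intro r hr
    have h1 : V *ᵥ r = 0 := by
      funext q
      have := congrFun (congrFun hr q) q
      have h2 : ∀ a, diagFF t V a q q = V q a := fun a => by fin_cases q <;> rfl
      simpa [Matrix.sum_apply, h2, Matrix.mulVec, dotProduct, mul_comm] using this
    intro i
    rw [← Matrix.one_mulVec r, ← mul_eq_one_comm.1 hVW, ← Matrix.mulVec_mulVec, h1,
      Matrix.mulVec_zero, Pi.zero_apply]
  pair_eq_zero k a := by
    rw [pair_diagFF]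
    refine Finset.sum_eq_zero fun q _ => mul_eq_zero_of_right _ ?_
    fin_cases k <;> fin_cases q <;> simp [diagCubic, cubicOf] <;> ring
  noncharacteristic := ⟨![1, 0, 0], by
    simp [Fin.sum_univ_three, diagCubic, cubicOf, Matrix.det_fin_three, ht]⟩
  surjective τ := ⟨solveCubic t d (Matrix.of τ * W), isSymmCubic_cubicOf _ _, fun k a => by
    rw [pair_solveCubic hd, mul_assoc, mul_eq_one_comm.1 hVW, mul_one, Matrix.of_apply]⟩

/-- The cubic part of the deformation in the direction `H_{ii}`. -/
def cubicDeform (t μ : Fin 3 → ℝ) (i : Fin 3) : MvPolynomial (Fin 3) ℝ :=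
  C (8 * μ i) * (X i * X i * X i)
  + C (16 * (t (i + 2) * t i ^ 2 * μ i)) * (X (i + 1) * X (i + 1) * X (i + 1))
  + C (16 * (t (i + 1) * t i ^ 2 * μ i)) * (X (i + 2) * X (i + 2) * X (i + 2))
  - C (24 * (t (i + 2) ^ 2 * μ (i + 2))) * (X (i + 1) * X (i + 1) * X (i + 2))
  - C (24 * (t (i + 1) ^ 2 * μ (i + 1))) * (X (i + 2) * X (i + 2) * X (i + 1))
  + C (48 * (t i * μ i)) * (X i * X (i + 1) * X (i + 2))

/-- The tangential deformation that compensates `cubicDeform`. -/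
def quarticDeform (t μ : Fin 3 → ℝ) (i : Fin 3) : MvPolynomial (Fin 3) ℝ :=
  C (μ i) * (X i * X i * X i * X i)
  + C (8 * (t (i + 2) * t i ^ 2 * μ i)) * (X i * X (i + 1) * X (i + 1) * X (i + 1))
  + C (8 * (t (i + 1) * t i ^ 2 * μ i)) * (X i * X (i + 2) * X (i + 2) * X (i + 2))
  - C (12 * (t (i + 2) ^ 2 * μ (i + 2))) * (X i * X (i + 1) * X (i + 1) * X (i + 2))
  - C (12 * (t (i + 1) ^ 2 * μ (i + 1))) * (X i * X (i + 2) * X (i + 2) * X (i + 1))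
  + C (12 * (t i * μ i)) * (X i * X i * X (i + 1) * X (i + 2))
  + C (6 * (t i ^ 2 * μ i)) * (X (i + 1) * X (i + 1) * X (i + 2) * X (i + 2))
  - C (4 * (t (i + 1) * μ (i + 1))) * (X (i + 1) * X (i + 1) * X (i + 1) * X (i + 2))
  - C (4 * (t (i + 2) * μ (i + 2))) * (X (i + 2) * X (i + 2) * X (i + 2) * X (i + 1))
  - C (4 * (t i * t (i + 2) ^ 3 * μ (i + 2))) * (X (i + 1) * X (i + 1) * X (i + 1) * X (i + 1))
  - C (4 * (t i * t (i + 1) ^ 3 * μ (i + 1))) * (X (i + 2) * X (i + 2) * X (i + 2) * X (i + 2))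

theorem cubicDeform_mem (t μ : Fin 3 → ℝ) (i : Fin 3) : cubicDeform t μ i ∈ orderIdeal 3 3 := by
  unfold cubicDeform
  repeat' first
    | exact Ideal.mul_mem_left _ _ (X_mul_X_mul_X_mem _ _ _)
    | apply Submodule.add_mem
    | apply Submodule.sub_mem

theorem quarticDeform_mem (t μ : Fin 3 → ℝ) (i : Fin 3) : quarticDeform t μ i ∈ orderIdeal 3 4 := by
  unfold quarticDeform
  repeat' first
    | exact Ideal.mul_mem_left _ _ (X_mul_X_mul_X_mul_X_mem _ _ _ _)
    | apply Submodule.add_mem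
    | apply Submodule.sub_mem

theorem pderiv_quarticDeform_self (t μ : Fin 3 → ℝ) (i : Fin 3) :
    pderiv i (quarticDeform t μ i) + pderiv i (quarticDeform t μ i) = cubicDeform t μ i := by
  fin_cases i <;>
    simp [quarticDeform, cubicDeform, Derivation.leibniz, pderiv_X, pderiv_ofNat, map_ofNat C] <;>
    ring

theorem pderiv_quarticDeform (t μ : Fin 3 → ℝ) (i : Fin 3) :
    pderiv (i + 1) (quarticDeform t μ (i + 2)) + pderiv (i + 2) (quarticDeform t μ (i + 1)) =
      -(C (t i) * cubicDeform t μ i) := by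
  fin_cases i <;>
    simp [quarticDeform, cubicDeform, Derivation.leibniz, pderiv_X, pderiv_ofNat, map_ofNat C] <;>
    ring

/-- The values `A^{kij} ∂_l ∂_i ∂_j U_q` for `A = diagCubic t` and `U = cubicDeform t μ`. -/
def derivCoeff (t μ : Fin 3 → ℝ) (l : Fin 3) : Matrix (Fin 3) (Fin 3) ℝ :=
  Matrix.of fun k q =>
    if l = k then if q = k then 192 * (t q * μ q) else
      96 * (t q * μ q) + 192 * (t 0 * t 1 * t 2 * (t q * μ q))
    else if q = k then -(96 * (t (-(l + k)) ^ 2 * μ (-(l + k))))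
    else if q = l then 0 else -(96 * (t k * t l ^ 2 * μ l))

set_option maxHeartbeats 1000000 in
theorem pair_diagCubic_thirdDeriv (t μ : Fin 3 → ℝ) (l k q : Fin 3) :
    pair (diagCubic t k) (thirdDeriv (cubicDeform t μ q) l) = derivCoeff t μ l k q := by
  rw [pair_diagCubic]
  fin_cases l <;> fin_cases k <;> fin_cases q <;>
    simp [thirdDeriv, cubicDeform, derivCoeff, Derivation.leibniz, pderiv_X,
      show (-1 : Fin 3) = 2 from rfl, show (-2 : Fin 3) = 1 from rfl] <;>
    ring

/-- The deformation jet in three variables, with parameters: `t` and `V` describe the second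
fundamental form, `μ` the third order part, and `f` the normalization of the basis of the
annihilator. -/
def diagJet {t : Fin 3 → ℝ} {d : ℝ} (hd : d * (1 - 8 * (t 0 * t 1 * t 2)) = 1) (ht : t 0 ≠ 0)
    {V W : Matrix (Fin 3) (Fin 3) ℝ} (hVW : V * W = 1) (μ f : Fin 3 → ℝ)
    (S : Fin 3 → Matrix (Fin 3) (Fin 3) ℝ) (c : Fin 3 → Fin 3 → Fin 3 → ℝ)
    (hc : ∀ i j k, c i j k = c i k j) : DeformationJet (diagFF t V) where
  A := diagCubic t
  v := quarticDeform t μ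
  u a := ∑ q, C (W a q) * cubicDeform t μ q
  -- Wᵀ * W is the inverse Gram matrix of the rows of V. Pairing with h multiplies it by V and
  -- leaves the Wᵀ that comes from u = W U. The multiple `f l` of A pairs to zero with h and is
  -- therefore free.
  B l k := solveCubic t d (-(derivCoeff t μ l * (Wᵀ * W))) k + f l • diagCubic t k
  S := S
  c := c
  regular := isRegularPair_diag hd ht hVW
  v_mem := quarticDeform_mem t μ
  u_mem a := Ideal.sum_mem _ fun q _ => Ideal.mul_mem_left _ _ (cubicDeform_mem t μ q)
  strain i j := by
    have h1 : ∀ q, ∑ a, C (V q a) * ∑ r, C (W a r) * cubicDeform t μ r = cubicDeform t μ q := by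
      intro q
      simp only [Finset.mul_sum, ← mul_assoc, ← C_mul]
      rw [Finset.sum_comm]
      simp only [← Finset.sum_mul, ← map_sum, sum_mul_of_mul_eq_one hVW]
      simp
    have h2 : ∀ q, ∑ a, C (-(t q * V q a)) * ∑ r, C (W a r) * cubicDeform t μ r =
        -(C (t q) * cubicDeform t μ q) := by
      intro q
      rw [← h1 q, Finset.mul_sum, ← Finset.sum_neg_distrib]
      refine Finset.sum_congr rfl fun a _ => ?_
      rw [C_neg, C_mul]
      ring
    have h3 := pderiv_quarticDeform_self t μ
    have h4 := pderiv_quarticDeform t μ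
    fin_cases i <;> fin_cases j
    · exact (h3 0).trans (h1 0).symm
    · exact (h4 2).trans (h2 2).symm
    · exact ((add_comm _ _).trans (h4 1)).trans (h2 1).symm
    · exact ((add_comm _ _).trans (h4 2)).trans (h2 2).symm
    · exact (h3 1).trans (h1 1).symm
    · exact (h4 0).trans (h2 0).symm
    · exact (h4 1).trans (h2 1).symm
    · exact ((add_comm _ _).trans (h4 0)).trans (h2 0).symm
    · exact (h3 2).trans (h1 2).symm
  B_symm l := by
    have h1 : IsSymmCubic (solveCubic t d (-(derivCoeff t μ l * (Wᵀ * W)))) :=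
      isSymmCubic_cubicOf _ _
    have h2 : IsSymmCubic (diagCubic t) := isSymmCubic_cubicOf _ _
    refine ⟨fun k i j => ?_, fun k i j => ?_⟩ <;> simp only [Matrix.add_apply, Matrix.smul_apply]
    · rw [h1.right k i j, h2.right k i j]
    · rw [h1.left k i j, h2.left k i j]
  pair_deriv l k a := by
    have h1 : thirdDeriv (∑ q, C (W a q) * cubicDeform t μ q) l =
        ∑ q, W a q • thirdDeriv (cubicDeform t μ q) l := by
      ext i j
      simp [thirdDeriv, Matrix.sum_apply]
    rw [h1, pair_sum_right, pair_add_left, pair_smul_left,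
      (isRegularPair_diag hd ht hVW).pair_eq_zero, mul_zero, add_zero, pair_solveCubic hd,
      Matrix.neg_mul, mul_assoc, mul_assoc, mul_eq_one_comm.1 hVW, mul_one, Matrix.neg_apply,
      Matrix.mul_apply, ← Finset.sum_neg_distrib, ← Finset.sum_add_distrib]
    refine Finset.sum_eq_zero fun q _ => ?_
    rw [pair_smul_right, pair_diagCubic_thirdDeriv, Matrix.transpose_apply]
    ring
  c_symm := hc

/-! ## The degenerate limit of the deformation jets in three variables -/

theorem symbolDeriv_add {n : ℕ} (A : Fin n → Matrix (Fin n) (Fin n) ℝ)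
    (B B' : Fin n → Fin n → Matrix (Fin n) (Fin n) ℝ) (S S' : Fin n → Matrix (Fin n) (Fin n) ℝ)
    (c c' : Fin n → Fin n → Fin n → ℝ) :
    symbolDeriv A (B + B') (S + S') (c + c') = symbolDeriv A B S c + symbolDeriv A B' S' c' := by
  funext j i
  simp only [symbolDeriv, Pi.add_apply, Matrix.transpose_add, Matrix.add_mul, Matrix.mul_add,
    add_smul, Finset.sum_add_distrib]
  abel

/-- The regular part of the change of unknowns. -/
def regS (l : Fin 3) : Matrix (Fin 3) (Fin 3) ℝ :=
  Matrix.single (l + 1) (l + 2) 4 + Matrix.single (l + 2) (l + 1) 4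

/-- The regular part of the change of variables. -/
def regC (i j k : Fin 3) : ℝ := if i ≠ j ∧ i ≠ k ∧ j ≠ k then 2 else 0

/-- The singular part of the change of unknowns. -/
def singS (t : Fin 3 → ℝ) (l : Fin 3) : Matrix (Fin 3) (Fin 3) ℝ := Matrix.single l l (2 / t l)

/-- The singular part of the change of variables. -/
def singC (t : Fin 3 → ℝ) (i j k : Fin 3) : ℝ := if i = j ∧ i = k then -(2 / t i) else 0

/-- The contribution of the singular parts, whose poles cancel. -/
def singDeriv (s : Fin 3 → ℝ) (j i : Fin 3) : Matrix (Fin 3) (Fin 3) ℝ :=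
  if i = j then Matrix.single i i 8 else Matrix.single i i (-(4 * (s i * s j)))

/-- For i = j the multiple of A^i cancels the term from c, and S meets only the entry 2 t_i, leaving
8. For i ≠ j the multiple of A^i cancels what S produces at the unit entries, and the entry 2 t_i
leaves -4 t_i / t_j = -4 s_i s_j. -/
theorem symbolDeriv_sing {s : Fin 3 → ℝ} (hs : ∀ i, s i * s i = 1) {x : ℝ} (hx : x ≠ 0) :
    symbolDeriv (diagCubic (x • s)) (fun l k => (-(2 / (x • s) l)) • diagCubic (x • s) k)
      (singS (x • s)) (singC (x • s)) = singDeriv s := by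
  have hinv : ∀ i, (s i)⁻¹ = s i := fun i => inv_eq_of_mul_eq_one_right (hs i)
  have h1 : ∀ l, 2 / (x • s) l = 2 * x⁻¹ * s l := fun l => by
    rw [Pi.smul_apply, smul_eq_mul, div_eq_mul_inv, mul_inv, hinv, mul_assoc]
  have hxx : x⁻¹ * x = 1 := inv_mul_cancel₀ hx
  funext j i
  ext a b
  simp only [symbolDeriv, singS, singC, Matrix.sub_apply, Matrix.add_apply,
    Matrix.smul_apply, Matrix.mul_apply, Matrix.transpose_apply, Fin.sum_univ_three, h1]
  generalize x⁻¹ = y at hxx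
  fin_cases j <;> fin_cases i <;> fin_cases a <;> fin_cases b <;>
    simp [singDeriv, diagCubic, cubicOf]
  · linear_combination 8 * (y * x) * hs 0 + 8 * hxx
  · linear_combination 4 * s 1 * s 0 * hxx
  · linear_combination 4 * s 2 * s 0 * hxx
  · linear_combination 4 * s 0 * s 1 * hxx
  · linear_combination 8 * (y * x) * hs 1 + 8 * hxx
  · linear_combination 4 * s 2 * s 1 * hxx
  · linear_combination 4 * s 0 * s 2 * hxx
  · linear_combination 4 * s 1 * s 2 * hxx
  · linear_combination 8 * (y * x) * hs 2 + 8 * hxx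

/-- In the trace the singular part of c offsets the singular multiples of A, and the regular part of
c drops out because it vanishes on repeated indices. -/
theorem zerothForm_sing {t : Fin 3 → ℝ} (A : Fin 3 → Matrix (Fin 3) (Fin 3) ℝ)
    (B : Fin 3 → Fin 3 → Matrix (Fin 3) (Fin 3) ℝ) :
    zerothForm A (fun l k => B l k + (-(2 / t l)) • A k) (regC + singC t) = -∑ i, B i i := by
  rw [zerothForm, ← Finset.sum_neg_distrib]
  refine Finset.sum_congr rfl fun i _ => ?_
  have h : ∀ m, (regC + singC t) i m i • A m = if m = i then (-(2 / t i)) • A i else 0 := by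
    intro m
    by_cases hm : m = i
    · subst hm; simp [regC, singC]
    · simp [regC, singC, hm, Ne.symm hm]
  rw [Finset.sum_congr rfl fun m _ => h m]
  simp

/-- The limit of the regular part of the derivatives of the basis of the annihilator. -/
def limB (l k : Fin 3) : Matrix (Fin 3) (Fin 3) ℝ :=
  solveCubic 0 1 (Matrix.of fun k q => if l = k then if q = k then -4 else -2 else 0) k

/-- The limit of the derivatives of the symbol. -/
def limDeriv (s : Fin 3 → ℝ) : Fin 3 → Fin 3 → Matrix (Fin 3) (Fin 3) ℝ :=
  symbolDeriv (diagCubic 0) limB regS regC + singDeriv s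

/-- In the mixed blocks the contributions of `limB`, `regS` and `regC` are -2 + 4 - 2 = 0, leaving
only the singular part. In the diagonal blocks `regS` turns the entries -2 into 6, and the singular
part turns -4 into 4. -/
theorem limDeriv_eq (s : Fin 3 → ℝ) (j i : Fin 3) : limDeriv s j i =
    if i = j then Matrix.diagonal fun q => if q = j then 4 else 6
    else Matrix.single i i (-(4 * (s i * s j))) := by
  ext a b
  simp only [limDeriv, symbolDeriv, Pi.add_apply, Matrix.sub_apply, Matrix.add_apply,
    Matrix.smul_apply, Matrix.mul_apply, Matrix.transpose_apply,
    Fin.sum_univ_three]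
  fin_cases j <;> fin_cases i <;> fin_cases a <;> fin_cases b <;>
    simp [limB, regS, regC, singDeriv, solveCubic, diagCubic, cubicOf] <;>
    norm_num

theorem isPosBlockForm_limDeriv {s : Fin 3 → ℝ} (hs : ∀ i, s i * s i = 1) :
    IsPosBlockForm (limDeriv s) := by
  intro ξ hξ
  -- The form splits into six binary forms in (ξ_ii, ξ_ji) with i ≠ j. The coefficient 8 of ξ_ii² is
  -- shared equally by the two forms that contain it, hence the 4 here.
  have key : ∀ a b i j, a ^ 2 + b ^ 2 ≤ 4 * a ^ 2 - 8 * (s i * s j) * a * b + 12 * b ^ 2 := by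
    intro a b i j
    have h1 : (s i * s j) ^ 2 = 1 := by
      calc (s i * s j) ^ 2 = (s i * s i) * (s j * s j) := by ring
        _ = 1 := by rw [hs, hs, one_mul]
    nlinarith [sq_nonneg (2 * a - 2 * (s i * s j) * b), sq_nonneg (a - 2 * (s i * s j) * b),
      sq_nonneg a, sq_nonneg b]
  have h : ∑ i, ∑ j, ξ i j ^ 2 ≤
      ∑ i, ∑ j, ξ j ⬝ᵥ ((limDeriv s j i + limDeriv s i j) *ᵥ ξ i) := by
    simp only [limDeriv_eq]
    simp [Fin.sum_univ_three, Matrix.mulVec, dotProduct]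
    nlinarith [key (ξ 0 0) (ξ 1 0) 0 1, key (ξ 0 0) (ξ 2 0) 0 2, key (ξ 1 1) (ξ 0 1) 1 0,
      key (ξ 1 1) (ξ 2 1) 1 2, key (ξ 2 2) (ξ 0 2) 2 0, key (ξ 2 2) (ξ 1 2) 2 1,
      sq_nonneg (ξ 0 0), sq_nonneg (ξ 1 1), sq_nonneg (ξ 2 2)]
  refine lt_of_lt_of_le ?_ h
  obtain ⟨i, hi⟩ := Function.ne_iff.1 hξ
  obtain ⟨j, hj⟩ := Function.ne_iff.1 hi
  have hj : ξ i j ≠ 0 := hj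
  refine Finset.sum_pos' (fun i _ => Finset.sum_nonneg fun j _ => sq_nonneg _)
    ⟨i, Finset.mem_univ _, Finset.sum_pos' (fun j _ => sq_nonneg _) ⟨j, Finset.mem_univ _, ?_⟩⟩
  positivity

theorem isPosForm_limB : IsPosForm (-∑ i, limB i i) := by
  have h : -∑ i, limB i i = (8 : ℝ) • (1 : Matrix (Fin 3) (Fin 3) ℝ) := by
    ext a b
    fin_cases a <;> fin_cases b <;>
      simp [limB, solveCubic, cubicOf, Fin.sum_univ_three] <;> norm_num
  intro ξ hξ
  rw [h, Matrix.smul_mulVec, Matrix.one_mulVec, dotProduct_smul, smul_eq_mul]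
  have := dotProduct_self_star_pos_iff.2 hξ
  simp only [star_trivial] at this
  linarith

theorem continuous_cubicOf (k : Fin 3) :
    Continuous fun x : Matrix (Fin 3) (Fin 3) ℝ × ℝ => cubicOf x.1 x.2 k := by
  refine continuous_matrix fun i j => ?_
  fin_cases k <;> fin_cases i <;> fin_cases j <;> simp [cubicOf] <;> fun_prop

theorem continuous_diagCubic : Continuous diagCubic := by
  refine continuous_pi fun k => (continuous_cubicOf k).comp
    (Continuous.prodMk (continuous_matrix fun i j => ?_) continuous_const)
  simp only [Matrix.of_apply]
  split_ifs <;> fun_prop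

theorem continuous_solveCubic (k : Fin 3) :
    Continuous fun x : (Fin 3 → ℝ) × ℝ × Matrix (Fin 3) (Fin 3) ℝ =>
      solveCubic x.1 x.2.1 x.2.2 k := by
  refine (continuous_cubicOf k).comp
    (Continuous.prodMk (continuous_matrix fun i j => ?_) continuous_const)
  simp only [Matrix.of_apply]
  split_ifs <;> fun_prop

/-! ## Prescribed curvature in three variables -/

/-- In three variables the Gauss equations say that the curvature matrix is the sum of the adjugates
of the h^a. For this family the sum depends on V only through its Gram matrix. -/
theorem sum_adjugate_diagFF (t : Fin 3 → ℝ) (V : Matrix (Fin 3) (Fin 3) ℝ) :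
    ∑ a, (diagFF t V a).adjugate = Matrix.of fun j k =>
      if j = k then (V * Vᵀ) (j + 1) (j + 2) - t j ^ 2 * (V * Vᵀ) j j
      else t j * t k * (V * Vᵀ) j k + t (-(j + k)) * (V * Vᵀ) (-(j + k)) (-(j + k)) := by
  ext j k
  fin_cases j <;> fin_cases k <;>
    simp [Fin.sum_univ_three, diagFF, Matrix.adjugate_fin_three, Matrix.mul_apply,
      show (-1 : Fin 3) = 2 from rfl, show (-2 : Fin 3) = 1 from rfl] <;>
    ring

/-- The rescaled Gram matrix of the normal vectors `H_{ii}`. -/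
def scaledGram (R : Matrix (Fin 3) (Fin 3) ℝ) (s r : Fin 3 → ℝ) (x : ℝ) :
    Matrix (Fin 3) (Fin 3) ℝ :=
  Matrix.of fun j k =>
    if j = k then (r j - x ^ 2 * (s 0 * s 1 * s 2) * R j j) / (1 + s 0 * s 1 * s 2 * x ^ 3)
    else x * R (-(j + k)) (-(j + k)) + x ^ 2 *
      ((r (-(j + k)) - x ^ 2 * (s 0 * s 1 * s 2) * R (-(j + k)) (-(j + k))) /
        (1 + s 0 * s 1 * s 2 * x ^ 3))

/-- The rescaled coefficients `derivCoeff`. -/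
def scaledCoeff (s r : Fin 3 → ℝ) (x : ℝ) (l : Fin 3) : Matrix (Fin 3) (Fin 3) ℝ :=
  Matrix.of fun k q =>
    if l = k then if q = k then 4 * r q else 2 * r q + 4 * (s 0 * s 1 * s 2) * x ^ 3 * r q
    else if q = k then -(2 * x * s (-(l + k)) * r (-(l + k)))
    else if q = l then 0 else -(2 * x ^ 2 * (s k * s l * r l))

/-- The size x⁻² of μ is chosen so that t_q μ_q = r_q / (48 x). The resulting factor x⁻¹ is balanced
by the inverse Gram matrix, which carries a factor x. -/
theorem derivCoeff_eq_scaledCoeff {s : Fin 3 → ℝ} (hs : ∀ i, s i * s i = 1) (r : Fin 3 → ℝ) {x : ℝ}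
    (hx : x ≠ 0) (l : Fin 3) :
    derivCoeff (x • s) (fun i => s i * r i / (48 * x ^ 2)) l = x⁻¹ • scaledCoeff s r x l := by
  ext k q
  have h1 : ∀ q, x * s q * (s q * r q / (48 * x ^ 2)) = x⁻¹ * r q / 48 := fun q => by
    field_simp
    linear_combination r q * hs q
  have h2 : ∀ q, (x * s q) ^ 2 * (s q * r q / (48 * x ^ 2)) = s q * r q / 48 := fun q => by
    field_simp
    linear_combination s q * r q * hs q
  simp only [derivCoeff, scaledCoeff, Matrix.of_apply, Matrix.smul_apply, Pi.smul_apply,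
    smul_eq_mul, mul_assoc (x * s k), h1, h2]
  split_ifs
  · ring
  · ring
  · field_simp; ring
  · ring
  · field_simp; ring

theorem isSymm_scaledGram (R : Matrix (Fin 3) (Fin 3) ℝ) (s r : Fin 3 → ℝ) (x : ℝ) :
    (scaledGram R s r x).IsSymm := Matrix.IsSymm.ext fun i j => by
  by_cases h : i = j
  · rw [h]
  · simp only [scaledGram, Matrix.of_apply, if_neg h, if_neg (Ne.symm h), add_comm j i]

theorem scaledGram_zero (R : Matrix (Fin 3) (Fin 3) ℝ) (s r : Fin 3 → ℝ) :
    scaledGram R s r 0 = Matrix.diagonal r := by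
  ext i j
  simp [scaledGram, Matrix.diagonal_apply]

theorem continuousAt_scaledGram (R : Matrix (Fin 3) (Fin 3) ℝ) (s r : Fin 3 → ℝ) :
    ContinuousAt (scaledGram R s r) 0 := by
  have h : ∀ i, ContinuousAt (fun x : ℝ =>
      (r i - x ^ 2 * (s 0 * s 1 * s 2) * R i i) / (1 + s 0 * s 1 * s 2 * x ^ 3)) 0 := fun i =>
    ContinuousAt.div (by fun_prop) (by fun_prop) (by simp)
  refine continuousAt_pi.2 fun i => continuousAt_pi.2 fun j => ?_
  simp only [scaledGram, Matrix.of_apply]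
  split_ifs
  · exact h i
  · exact (continuousAt_id.mul continuousAt_const).add ((continuousAt_id.pow 2).mul (h _))

/-- For distinct i, j, k the diagonal equations give G_jk = R_ii + t_i² G_ii. Substituted in the
off-diagonal ones they give t_i (1 + t_0 t_1 t_2) G_ii = R_jk - t_j t_k R_ii. With t = x s and G =
x⁻¹ `scaledGram` this is the stated matrix; its limit is diag(r) because s_i R_jk = r_i. -/
theorem sum_adjugate_diagFF_scaledGram {R : Matrix (Fin 3) (Fin 3) ℝ} (hR : R.IsSymm)
    {s r : Fin 3 → ℝ} (hs : ∀ i, s i * s i = 1) (hRr : ∀ i, R (i + 1) (i + 2) = s i * r i) {x : ℝ}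
    (hx : x ≠ 0) (hx' : 1 + s 0 * s 1 * s 2 * x ^ 3 ≠ 0) {V : Matrix (Fin 3) (Fin 3) ℝ}
    (hV : V * Vᵀ = x⁻¹ • scaledGram R s r x) :
    ∑ a, (diagFF (x • s) V a).adjugate = R := by
  obtain ⟨w, hw⟩ : ∃ w : Fin 3 → ℝ, ∀ i,
      (r i - x ^ 2 * (s 0 * s 1 * s 2) * R i i) / (1 + s 0 * s 1 * s 2 * x ^ 3) = w i :=
    ⟨_, fun _ => rfl⟩
  have hw' : ∀ i, r i - x ^ 2 * (s 0 * s 1 * s 2) * R i i = w i * (1 + s 0 * s 1 * s 2 * x ^ 3) :=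
    fun i => (div_eq_iff hx').1 (hw i)
  have hxx : x⁻¹ * x = 1 := inv_mul_cancel₀ hx
  rw [sum_adjugate_diagFF, hV]
  simp only [Matrix.smul_apply, scaledGram, hw]
  have h10 := hR.apply 0 1
  have h20 := hR.apply 0 2
  have h21 := hR.apply 1 2
  have e0 : R 1 2 = s 0 * r 0 := hRr 0
  have e1 : R 2 0 = s 1 * r 1 := hRr 1
  have e2 : R 0 1 = s 2 * r 2 := hRr 2
  generalize x⁻¹ = y at hxx
  ext j k
  fin_cases j <;> fin_cases k <;>
    simp [show (-1 : Fin 3) = 2 from rfl, show (-2 : Fin 3) = 1 from rfl]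
  · linear_combination R 0 0 * hxx - x ^ 2 * y * w 0 * hs 0
  · linear_combination (x ^ 2 * (s 0 * s 1) * (R 2 2 + x * w 2) + s 2 * w 2) * hxx - s 2 * hw' 2
      - x ^ 2 * (s 0 * s 1) * (R 2 2 + x * w 2) * hs 2 - e2
  · linear_combination (x ^ 2 * (s 0 * s 2) * (R 1 1 + x * w 1) + s 1 * w 1) * hxx - s 1 * hw' 1
      - x ^ 2 * (s 0 * s 2) * (R 1 1 + x * w 1) * hs 1 - e1 + h20
  · linear_combination (x ^ 2 * (s 1 * s 0) * (R 2 2 + x * w 2) + s 2 * w 2) * hxx - s 2 * hw' 2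
      - x ^ 2 * (s 1 * s 0) * (R 2 2 + x * w 2) * hs 2 - e2 - h10
  · linear_combination R 1 1 * hxx - x ^ 2 * y * w 1 * hs 1
  · linear_combination (x ^ 2 * (s 1 * s 2) * (R 0 0 + x * w 0) + s 0 * w 0) * hxx - s 0 * hw' 0
      - x ^ 2 * (s 1 * s 2) * (R 0 0 + x * w 0) * hs 0 - e0
  · linear_combination (x ^ 2 * (s 2 * s 0) * (R 1 1 + x * w 1) + s 1 * w 1) * hxx - s 1 * hw' 1
      - x ^ 2 * (s 2 * s 0) * (R 1 1 + x * w 1) * hs 1 - e1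
  · linear_combination (x ^ 2 * (s 2 * s 1) * (R 0 0 + x * w 0) + s 0 * w 0) * hxx - s 0 * hw' 0
      - x ^ 2 * (s 2 * s 1) * (R 0 0 + x * w 0) * hs 0 - e0 - h21
  · linear_combination R 2 2 * hxx - x ^ 2 * y * w 2 * hs 2

/-- The regular part of the derivatives of the basis of the annihilator. -/
def scaledB (R : Matrix (Fin 3) (Fin 3) ℝ) (s r : Fin 3 → ℝ) (x : ℝ) (l k : Fin 3) :
    Matrix (Fin 3) (Fin 3) ℝ :=
  solveCubic (x • s) (1 - 8 * ((x • s) 0 * (x • s) 1 * (x • s) 2))⁻¹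
    (-(scaledCoeff s r x l * (scaledGram R s r x)⁻¹)) k

theorem continuous_one_sub_smul (s : Fin 3 → ℝ) :
    Continuous fun x : ℝ => 1 - 8 * ((x • s) 0 * (x • s) 1 * (x • s) 2) := by
  simp only [Pi.smul_apply, smul_eq_mul]
  fun_prop

theorem continuous_scaledCoeff (s r : Fin 3 → ℝ) (l : Fin 3) :
    Continuous fun x => scaledCoeff s r x l := by
  refine continuous_matrix fun i j => ?_
  simp only [scaledCoeff, Matrix.of_apply]
  split_ifs <;> fun_prop

theorem continuousAt_scaledB (R : Matrix (Fin 3) (Fin 3) ℝ) (s : Fin 3 → ℝ) {r : Fin 3 → ℝ}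
    (hr : ∀ i, 0 < r i) : ContinuousAt (scaledB R s r) 0 := by
  have hGinv : ContinuousAt (fun x => (scaledGram R s r x)⁻¹) 0 := by
    refine ContinuousAt.comp (f := scaledGram R s r) (continuousAt_matrix_inv ?_)
      (continuousAt_scaledGram R s r)
    rw [scaledGram_zero, Matrix.det_diagonal]
    exact Finset.prod_ne_zero_iff.2 fun i _ => (hr i).ne'
  have hd : ContinuousAt (fun x : ℝ => (1 - 8 * ((x • s) 0 * (x • s) 1 * (x • s) 2))⁻¹) 0 :=
    (continuous_one_sub_smul s).continuousAt.inv₀ (by simp)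
  refine continuousAt_pi.2 fun l => continuousAt_pi.2 fun k => ?_
  have hx : ContinuousAt (fun x : ℝ => x • s) 0 := by fun_prop
  exact ContinuousAt.comp (f := fun x : ℝ => (x • s,
    (1 - 8 * ((x • s) 0 * (x • s) 1 * (x • s) 2))⁻¹,
    -(scaledCoeff s r x l * (scaledGram R s r x)⁻¹))) (continuous_solveCubic k).continuousAt
    (hx.prodMk (hd.prodMk ((continuous_scaledCoeff s r l).continuousAt.mul hGinv).neg))

theorem scaledB_zero (R : Matrix (Fin 3) (Fin 3) ℝ) (s : Fin 3 → ℝ) {r : Fin 3 → ℝ}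
    (hr : ∀ i, 0 < r i) : scaledB R s r 0 = limB := by
  have h : (Matrix.diagonal r)⁻¹ = Matrix.diagonal fun i => (r i)⁻¹ := by
    refine Matrix.inv_eq_left_inv ?_
    rw [Matrix.diagonal_mul_diagonal, ← Matrix.diagonal_one]
    congr 1
    funext i
    exact inv_mul_cancel₀ (hr i).ne'
  funext l k
  simp only [scaledB, limB, scaledGram_zero, h]
  congr 1
  · simp
  · simp
  · ext i j
    have := (hr j).ne'
    rw [Matrix.neg_apply, Matrix.mul_diagonal]
    simp only [scaledCoeff, Matrix.of_apply]
    split_ifs <;> simp <;> field_simp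

theorem continuous_symbolDeriv {n : ℕ} (S : Fin n → Matrix (Fin n) (Fin n) ℝ)
    (c : Fin n → Fin n → Fin n → ℝ) : Continuous fun x : (Fin n → Matrix (Fin n) (Fin n) ℝ) ×
      (Fin n → Fin n → Matrix (Fin n) (Fin n) ℝ) => symbolDeriv x.1 x.2 S c := by
  refine continuous_pi fun j => continuous_pi fun i => ?_
  unfold symbolDeriv
  fun_prop

theorem continuousAt_symbolDeriv_scaledB (R : Matrix (Fin 3) (Fin 3) ℝ) (s : Fin 3 → ℝ)
    {r : Fin 3 → ℝ} (hr : ∀ i, 0 < r i) : ContinuousAt (fun x : ℝ =>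
      symbolDeriv (diagCubic (x • s)) (scaledB R s r x) regS regC + singDeriv s) 0 := by
  have hA : Continuous fun x : ℝ => diagCubic (x • s) := continuous_diagCubic.comp (by fun_prop)
  have h : ContinuousAt (fun x : ℝ => (diagCubic (x • s), scaledB R s r x)) 0 :=
    hA.continuousAt.prodMk (continuousAt_scaledB R s hr)
  exact (ContinuousAt.comp (f := fun x : ℝ => (diagCubic (x • s), scaledB R s r x))
    (continuous_symbolDeriv regS regC).continuousAt h).add continuousAt_const

/-- For small x > 0 the scaled Gram matrix is close to diag(r), hence positive definite and
realizable as a Gram matrix, while the forms are close to limits independent of R and r. The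
property p is kept general so that positivity after a change of frame can be inserted. -/
theorem exists_diagJet {R : Matrix (Fin 3) (Fin 3) ℝ} (hR : R.IsSymm) {s r : Fin 3 → ℝ}
    (hs : ∀ i, s i * s i = 1) (hr : ∀ i, 0 < r i) (hRr : ∀ i, R (i + 1) (i + 2) = s i * r i)
    {p : (Fin 3 → Fin 3 → Matrix (Fin 3) (Fin 3) ℝ) → Prop} (hp : ∀ᶠ D in 𝓝 (limDeriv s), p D) :
    ∃ (h : Fin 3 → Matrix (Fin 3) (Fin 3) ℝ) (K : DeformationJet h), ∑ a, (h a).adjugate = R ∧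
      p (symbolDeriv K.A K.B K.S K.c) ∧ IsPosForm (zerothForm K.A K.B K.c) := by
  have hG0 : IsPosForm (scaledGram R s r 0) := by
    rw [scaledGram_zero]
    exact fun ξ hξ => (Matrix.posDef_iff_dotProduct_mulVec.1
      (Matrix.PosDef.diagonal hr)).2 hξ
  have hZ : ContinuousAt (fun x : ℝ => -∑ i, scaledB R s r x i i) 0 :=
    (tendsto_finsetSum _ fun i _ =>
      continuousAt_pi.1 (continuousAt_pi.1 (continuousAt_scaledB R s hr) i) i).neg
  have hD := continuousAt_symbolDeriv_scaledB R s hr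
  rw [ContinuousAt, scaledB_zero R s hr, zero_smul, ← limDeriv] at hD
  rw [ContinuousAt, scaledB_zero R s hr] at hZ
  have ev1 := (hD.eventually hp).filter_mono (nhdsWithin_le_nhds (s := Ioi 0))
  have ev2 := (hZ.eventually isPosForm_limB.eventually).filter_mono
    (nhdsWithin_le_nhds (s := Ioi 0))
  have ev3 : ∀ᶠ x in 𝓝[>] (0 : ℝ), IsPosForm (scaledGram R s r x) :=
    ((continuousAt_scaledGram R s r).eventually hG0.eventually).filter_mono nhdsWithin_le_nhds
  have ev4 : ∀ᶠ x in 𝓝[>] (0 : ℝ), 1 - 8 * ((x • s) 0 * (x • s) 1 * (x • s) 2) ≠ 0 :=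
    ((continuous_one_sub_smul s).continuousAt.eventually_ne (by simp)).filter_mono
      nhdsWithin_le_nhds
  have ev5 : ∀ᶠ x in 𝓝[>] (0 : ℝ), 1 + s 0 * s 1 * s 2 * x ^ 3 ≠ 0 :=
    (ContinuousAt.eventually_ne (g := fun x : ℝ => 1 + s 0 * s 1 * s 2 * x ^ 3) (by fun_prop)
      (by simp)).filter_mono nhdsWithin_le_nhds
  obtain ⟨x, h1, h2, h3, h4, h5, hx⟩ :=
    (ev1.and (ev2.and (ev3.and (ev4.and (ev5.and self_mem_nhdsWithin))))).exists
  have hx : 0 < x := hx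
  have hG : (x⁻¹ • scaledGram R s r x).PosDef :=
    (Matrix.posDef_iff_dotProduct_mulVec.2
      ⟨(Matrix.conjTranspose_eq_transpose_of_trivial _).trans (isSymm_scaledGram R s r x), fun ξ hξ => by simpa using h3 ξ hξ⟩).smul (inv_pos.2 hx)
  obtain ⟨L, M, hL, hLM, -⟩ := exists_transpose_mul_self_eq hG
  have hM : Mᵀ * M = x • (scaledGram R s r x)⁻¹ := by
    have e1 : x⁻¹ • scaledGram R s r x * (Mᵀ * M) = 1 := by
      have e2 : L * Mᵀ = 1 := by
        rw [← Matrix.transpose_transpose L, ← Matrix.transpose_mul, mul_eq_one_comm.1 hLM,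
          Matrix.transpose_one]
      rw [← hL, mul_assoc, ← mul_assoc L, e2, one_mul, hLM]
    have e3 : scaledGram R s r x * (x⁻¹ • (Mᵀ * M)) = 1 := by
      rw [Matrix.mul_smul, ← Matrix.smul_mul, e1]
    rw [Matrix.inv_eq_right_inv e3, smul_smul, mul_inv_cancel₀ hx.ne', one_smul]
  have hsx : ∀ i, (x • s) i ≠ 0 := fun i h => by
    have h6 : s i = 0 := by simpa [hx.ne'] using h
    simpa [h6] using hs i
  have hc : ∀ i j k, (regC + singC (x • s)) i j k = (regC + singC (x • s)) i k j := by
    intro i j k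
    fin_cases i <;> fin_cases j <;> fin_cases k <;> simp [regC, singC]
  let K := diagJet (t := x • s) (inv_mul_cancel₀ h4) (hsx 0) hLM
    (fun i => s i * r i / (48 * x ^ 2)) (fun l => -(2 / (x • s) l)) (regS + singS (x • s))
    (regC + singC (x • s)) hc
  have hKB : K.B = scaledB R s r x + fun l k => (-(2 / (x • s) l)) • diagCubic (x • s) k := by
    funext l k
    simp only [K, diagJet, scaledB, Pi.add_apply, hM, derivCoeff_eq_scaledCoeff hs r hx.ne']
    rw [Matrix.smul_mul, Matrix.mul_smul, smul_smul, inv_mul_cancel₀ hx.ne', one_smul]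
  refine ⟨_, K, ?_, ?_, ?_⟩
  · exact sum_adjugate_diagFF_scaledGram hR hs hRr hx.ne' h5 (by
      rw [Matrix.transpose_transpose, hL])
  · rw [hKB, show K.S = regS + singS (x • s) from rfl, show K.c = regC + singC (x • s) from rfl,
      symbolDeriv_add, show K.A = diagCubic (x • s) from rfl, symbolDeriv_sing hs hx.ne']
    exact h1
  · rw [hKB]
    exact (zerothForm_sing (t := x • s) (diagCubic (x • s)) (scaledB R s r x)).symm ▸ h2

/-! ## Frames with nonvanishing off-diagonal curvature -/

theorem exists_dotProduct_mulVec_ne_zero {n : ℕ} {R : Matrix (Fin n) (Fin n) ℝ} (hR : R.IsSymm)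
    (hR0 : R ≠ 0) : ∃ q, q ⬝ᵥ (R *ᵥ q) ≠ 0 := by
  by_contra! h
  refine hR0 (Matrix.ext fun i j => ?_)
  have h1 := h (Pi.single i 1)
  have h2 := h (Pi.single j 1)
  have h3 := h (Pi.single i 1 + Pi.single j 1)
  have h4 := hR.apply i j
  simp [Matrix.mulVec_add] at h1 h2 h3
  rw [Matrix.zero_apply]
  linarith

/-- Join the identity by a line to the matrix all of whose rows are q, with qᵀ R q ≠ 0. At parameter
1 every entry of the conjugated matrix equals qᵀ R q, so no entry vanishes identically along the
line, and by analyticity none has zeros accumulating at parameter 0. -/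
theorem frequently_offDiag_ne_zero {R : Matrix (Fin 3) (Fin 3) ℝ} (hR : R.IsSymm) (hR0 : R ≠ 0) :
    ∃ᶠ Q in 𝓝 (1 : Matrix (Fin 3) (Fin 3) ℝ), ∀ i, (Q * R * Qᵀ) (i + 1) (i + 2) ≠ 0 := by
  obtain ⟨q, hq⟩ := exists_dotProduct_mulVec_ne_zero hR hR0
  let N : ℝ → Matrix (Fin 3) (Fin 3) ℝ := fun x => 1 + x • (Matrix.of (fun _ => q) - 1)
  have hN : Filter.Tendsto N (𝓝[≠] 0) (𝓝 1) := by
    have h : Continuous N := by fun_prop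
    have := h.tendsto 0
    simp only [N, zero_smul, add_zero] at this
    exact this.mono_left nhdsWithin_le_nhds
  refine hN.frequently (Filter.Eventually.frequently (Filter.eventually_all.2 fun i => ?_))
  have hf : AnalyticOnNhd ℝ (fun x => (N x * R * (N x)ᵀ) (i + 1) (i + 2)) univ := by
    intro x _
    simp only [N, Matrix.mul_apply, Matrix.transpose_apply, Matrix.add_apply, Matrix.smul_apply,
      smul_eq_mul, Fin.sum_univ_three]
    fun_prop
  by_contra hcon
  have h := hf.eqOn_zero_of_preconnected_of_frequently_eq_zero isPreconnected_univ (mem_univ 0)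
    ((Filter.not_eventually.1 hcon).mono fun x hx => not_not.1 hx) (mem_univ 1)
  refine hq ?_
  simp [N, Matrix.mul_apply, dotProduct, Matrix.mulVec, Fin.sum_univ_three] at h ⊢
  linear_combination h

/-! ### The Gauss equations in three variables and the conclusion -/

theorem sum_adjugate_frame {m : ℕ} (h : Fin m → Matrix (Fin 3) (Fin 3) ℝ)
    (Q : Matrix (Fin 3) (Fin 3) ℝ) : ∑ a, (Qᵀ * h a * Q).adjugate =
      Q.adjugate * (∑ a, (h a).adjugate) * Q.adjugateᵀ := by
  simp only [Matrix.mul_sum, Matrix.sum_mul, Matrix.adjugate_mul_distrib, Matrix.adjugate_transpose,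
    mul_assoc]

theorem riemann_eq_gauss {m : ℕ} {g : (Fin 3 → ℝ) → Matrix (Fin 3) (Fin 3) ℝ} {Ω : Set (Fin 3 → ℝ)}
    (hΩ : IsOpen Ω) (h0 : (0 : Fin 3 → ℝ) ∈ Ω) (hg : IsSmoothMetricOn g Ω)
    (hΓ : ∀ k i j, christoffel g k i j 0 = 0) {h : Fin m → Matrix (Fin 3) (Fin 3) ℝ}
    (hs : ∀ a, (h a).IsSymm) (hR : ∑ a, (h a).adjugate = curvatureMatrix g 0) (i j k l : Fin 3) :
    riemann g i j k l 0 = ∑ a, (h a i k * h a j l - h a i l * h a j k) := by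
  obtain ⟨hT, hpair⟩ := isCurvatureLike_riemann hΩ h0 hg hΓ
  refine hT.ext (isCurvatureLike_gauss h) ![((1 : Fin 3), (2 : Fin 3)), (2, 0), (0, 1)] ?_ ?_ i j k l
  · decide
  intro a a'
  have hc : riemann g (![((1 : Fin 3), (2 : Fin 3)), (2, 0), (0, 1)] a).1
      (![((1 : Fin 3), (2 : Fin 3)), (2, 0), (0, 1)] a).2
      (![((1 : Fin 3), (2 : Fin 3)), (2, 0), (0, 1)] a').1
      (![((1 : Fin 3), (2 : Fin 3)), (2, 0), (0, 1)] a').2 0 = curvatureMatrix g 0 a a' := by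
    fin_cases a <;> fin_cases a' <;> first | rfl | exact hpair _ _ _ _
  refine hc.trans ?_
  rw [← hR, Matrix.sum_apply]
  refine Finset.sum_congr rfl fun b _ => ?_
  have e : ∀ i j, h b j i = h b i j := fun i j => (hs b).apply i j
  fin_cases a <;> fin_cases a' <;>
    simp [Matrix.adjugate_fin_three, e 0 1, e 0 2, e 1 2] <;> ring

/-- The limits `limDeriv s` are indexed by finitely many sign patterns, so one neighborhood of the
identity preserves positivity for all of them. Q is taken there with nonzero off-diagonal entries,
and only then are the signs of the transformed curvature read off. -/
theorem hasSSPApproxEmbeddings_fin_three {g : (Fin 3 → ℝ) → Matrix (Fin 3) (Fin 3) ℝ}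
    {Ω : Set (Fin 3 → ℝ)} (hΩ : IsOpen Ω) (h0 : (0 : Fin 3 → ℝ) ∈ Ω) (hg : IsSmoothMetricOn g Ω)
    (hΓ : ∀ k i j, christoffel g k i j 0 = 0) (hK : curvatureMatrix g 0 ≠ 0) :
    HasSSPApproxEmbeddings g Ω := by
  have hsymm : (curvatureMatrix g 0).IsSymm :=
    Matrix.IsSymm.ext fun i j => by fin_cases i <;> fin_cases j <;> rfl
  let sgn : Finset (Fin 3 → ℝ) := Fintype.piFinset fun _ => {1, -1}
  have hsgn : ∀ s ∈ sgn, ∀ i, s i * s i = 1 := by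
    intro s hs i
    have := Fintype.mem_piFinset.1 hs i
    rcases Finset.mem_insert.1 this with h | h
    · rw [h, one_mul]
    · rw [Finset.mem_singleton.1 h]; norm_num
  have hev := (Filter.eventually_all_finset sgn).2 fun s hs =>
    (isPosBlockForm_limDeriv (hsgn s hs)).eventually_frame
  obtain ⟨Q, hQ, hpos, hQ1⟩ := ((frequently_offDiag_ne_zero hsymm hK).and_eventually
    (hev.and eventually_inv_mul_eq_one)).exists
  have hadj : Q⁻¹.adjugate = Q⁻¹.det • Q := by
    rw [← mul_one Q⁻¹.adjugate, ← hQ1, ← mul_assoc, Matrix.adjugate_mul, Matrix.smul_mul, one_mul]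
  have hdet : Q⁻¹.det ≠ 0 := (Matrix.isUnit_det_of_right_inverse hQ1).ne_zero
  -- The curvature matrix to be realized before the change of frame. By `hadj` it is a nonzero
  -- multiple of the curvature matrix conjugated by Q, so its off-diagonal entries do not vanish;
  -- `sum_adjugate_frame` carries it back to the original one.
  let R := Q⁻¹.adjugate * curvatureMatrix g 0 * Q⁻¹.adjugateᵀ
  have hR : R.IsSymm := by
    simp only [R, Matrix.IsSymm, Matrix.transpose_mul, Matrix.transpose_transpose, hsymm.eq,
      mul_assoc]
  have hR0 : ∀ i, R (i + 1) (i + 2) ≠ 0 := fun i => by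
    simp only [R, hadj, Matrix.transpose_smul, Matrix.smul_mul, Matrix.mul_smul, Matrix.smul_apply,
      smul_eq_mul]
    exact mul_ne_zero hdet (mul_ne_zero hdet (hQ i))
  let s : Fin 3 → ℝ := fun i => SignType.sign (R (i + 1) (i + 2))
  have hs : s ∈ sgn := Fintype.mem_piFinset.2 fun i => by
    rcases (hR0 i).lt_or_gt with h | h <;> simp [s, h]
  obtain ⟨h, K, hRh, hp, hz⟩ := exists_diagJet hR (hsgn s hs) (fun i => abs_pos.2 (hR0 i))
    (fun i => (sign_mul_abs _).symm) (hpos s hs)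
  refine hasSSPApproxEmbeddings_of_deformationJet (K.frame hQ1) ?_ ?_ hΩ h0 hg hΓ
    (riemann_eq_gauss hΩ h0 hg hΓ (K.frame hQ1).regular.h_symm ?_)
  · have : symbolDeriv (K.frame hQ1).A (K.frame hQ1).B (K.frame hQ1).S (K.frame hQ1).c = _ :=
      funext fun j => funext fun i => symbolDeriv_frame K hQ1 j i
    rw [this]
    exact hp
  · rw [zerothForm_frame]
    exact hz.conj hQ1
  · have h1 : Q.adjugate * Q⁻¹.adjugate = 1 := by
      rw [← Matrix.adjugate_mul_distrib, hQ1, Matrix.adjugate_one]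
    rw [sum_adjugate_frame, hRh]
    calc Q.adjugate * R * Q.adjugateᵀ
        = (Q.adjugate * Q⁻¹.adjugate) * curvatureMatrix g 0 *
          (Q.adjugate * Q⁻¹.adjugate)ᵀ := by
          simp only [R, Matrix.transpose_mul, mul_assoc]
      _ = curvatureMatrix g 0 := by rw [h1, Matrix.transpose_one, one_mul, mul_one]

end IsomEmb

end

theorem mainTheorem3 :
    (∀ (g : (Fin 2 → ℝ) → Matrix (Fin 2) (Fin 2) ℝ) (Ω₀ : Set (Fin 2 → ℝ)),
      IsOpen Ω₀ → (0 : Fin 2 → ℝ) ∈ Ω₀ → IsomEmb.IsSmoothMetricOn g Ω₀ →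
      (∀ k i j, IsomEmb.christoffel g k i j 0 = 0) →
      IsomEmb.gaussCurvature g 0 ≠ 0 →
      IsomEmb.HasSSPApproxEmbeddings g Ω₀) ∧
    (∀ (g : (Fin 3 → ℝ) → Matrix (Fin 3) (Fin 3) ℝ) (Ω₀ : Set (Fin 3 → ℝ)),
      IsOpen Ω₀ → (0 : Fin 3 → ℝ) ∈ Ω₀ → IsomEmb.IsSmoothMetricOn g Ω₀ →
      (∀ k i j, IsomEmb.christoffel g k i j 0 = 0) →
      IsomEmb.curvatureMatrix g 0 ≠ 0 →
      IsomEmb.HasSSPApproxEmbeddings g Ω₀) :=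
  ⟨fun _ _ hΩ h0 hg hΓ hK => IsomEmb.hasSSPApproxEmbeddings_fin_two hΩ h0 hg hΓ hK,
    fun _ _ hΩ h0 hg hΓ hK => IsomEmb.hasSSPApproxEmbeddings_fin_three hΩ h0 hg hΓ hK⟩
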